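/- Let $I\subset\mathbb R$ be open and let $\gamma,X,Y:I\to\mathbb R^4$ be $C^\infty$ maps such that, for all $t\in I$, $|X|=|Y|=1$, $\langle X,Y\rangle=0$, $\langle X,Y'\rangle=0$, $|X'|=1$, and $\dim\langle X,Y,X',Y'\rangle_{\mathbb R}=3$ (pseudo-non-degeneracy, with constrictively adapted directors and normalized parameter). Let $Z=X\wedge Y\wedge X'$ be the triple exterior product in $\mathbb R^4$; then $X,Y,X',Z$ is an orthonormal frame, and functions $a,b_1,\dots,b_4$ on $I$ are defined by $$Y'=aX',\qquad \gamma'=b_1X+b_2Y+b_3X'+b_4Z .$$ Put $\delta=-\det(X,Y,X',X'')$, and assume $b_4\equiv0$ on $I$, so that $$f(t,s,r)=\gamma(t)+sX(t)+rY(t),\qquad (t,s,r)\in I\times\mathbb R^2,$$ is a pseudo-non-degenerate two-ruled frontal. Put $\lambda=b_3+s+ra$ and $\eta=\partial_t-b_1\partial_s-b_2\partial_r$, so that $\eta\lambda=b_3'+ra'-b_1-ab_2$. Let $p=(t,s,r)\in I\times\mathbb R^2$. Then $p$ is a singular point of $f$ (that is, $df_p$ is not injective) if and only if $b_3(t)+s+ra(t)=0$.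 Let $p$ be a singular point of $f$. 1. If $\eta\lambda(p)\neq0$ (the null direction is transverse to the singular set at $p$), then the germ of $f$ at $p$ is a cuspidal cross cap $\times$ interval if and only if $\delta(t)=0$ and $\delta'(t)\neq0$. 2. The condition $\eta\lambda(p)\ne0$ is necessary: if the germ of $f$ at $p$ is a cuspidal cross cap $\times$ interval, then $\eta\lambda(p)\neq0$ (and hence $\delta(t)=0$ and $\delta'(t)\neq0$). Here the germ of $f$ at $p$ is called a cuspidal cross cap $\times$ interval if there are $C^\infty$ diffeomorphism germs $\phi:(\mathbb R^3,p)\to(\mathbb R^3,0)$ and $\Phi:(\mathbb R^4,f(p))\to(\mathbb R^4,0)$ such that $\Phi\circ f\circ\phi^{-1}$ is the germ at $0$ of $(t,s,r)\mapsto(t,s,r^2,sr^3)$. -/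

import Mathlib

open scoped ContDiff Manifold Topology RealInnerProductSpace

noncomputable section

namespace TwoRuled

/-- The target space `ℝ⁴` with its standard inner product. -/
abbrev R4 : Type := EuclideanSpace ℝ (Fin 4)

/-- The source space `ℝ³` with coordinates `(t, s, r)`. -/
abbrev R3 : Type := ℝ × ℝ × ℝ

/-- The determinant of the `4 × 4` matrix with rows `u, v, w, z`. -/
def det4 (u v w z : R4) : ℝ :=
  Matrix.det (Matrix.of ![fun j => u j, fun j => v j, fun j => w j, fun j => z j])

/-- The triple exterior product `u ∧ v ∧ w`: the formal determinant with first row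
`(e₁, e₂, e₃, e₄)` and further rows `u, v, w`. -/
def wedge3 (u v w : R4) : R4 :=
  WithLp.toLp 2 fun i => det4 (EuclideanSpace.single i 1) u v w

/-- The two-ruled hypersurface `f(t, s, r) = γ(t) + s X(t) + r Y(t)`. -/
def twoRuled (γ X Y : ℝ → R4) : R3 → R4 :=
  fun p => γ p.1 + p.2.1 • X p.1 + p.2.2 • Y p.1

/-- The smooth two-ruled hypersurface over the parameter set `I` is pseudo-non-degenerate, its
director curves are constrictively adapted, and the parameter is normalized by `|X'| = 1`. -/
structure IsPseudoNondegenerate (I : Set ℝ) (γ X Y : ℝ → R4) : Prop where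
  smooth_base : ContDiffOn ℝ ∞ γ I
  smooth_fst : ContDiffOn ℝ ∞ X I
  smooth_snd : ContDiffOn ℝ ∞ Y I
  norm_fst : ∀ t ∈ I, ‖X t‖ = 1
  norm_snd : ∀ t ∈ I, ‖Y t‖ = 1
  inner_fst_snd : ∀ t ∈ I, ⟪X t, Y t⟫ = 0
  inner_fst_deriv_snd : ∀ t ∈ I, ⟪X t, deriv Y t⟫ = 0
  norm_deriv_fst : ∀ t ∈ I, ‖deriv X t‖ = 1
  finrank_span : ∀ t ∈ I,
    Module.finrank ℝ (Submodule.span ℝ ({X t, Y t, deriv X t, deriv Y t} : Set R4)) = 3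

/-- The fourth frame vector `Z = X ∧ Y ∧ X'`; `X, Y, X', Z` is an orthonormal frame. -/
def frameZ (X Y : ℝ → R4) (t : ℝ) : R4 := wedge3 (X t) (Y t) (deriv X t)

/-- The function `a` with `Y' = a X'` (recall `|X'| = 1`). -/
def coeffA (X Y : ℝ → R4) (t : ℝ) : ℝ := ⟪deriv Y t, deriv X t⟫

/-- The coefficient `b₁` in `γ' = b₁ X + b₂ Y + b₃ X' + b₄ Z`
(the frame `X, Y, X', Z` is orthonormal). -/
def coeffB1 (γ X : ℝ → R4) (t : ℝ) : ℝ := ⟪deriv γ t, X t⟫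

/-- The coefficient `b₂` in `γ' = b₁ X + b₂ Y + b₃ X' + b₄ Z`. -/
def coeffB2 (γ Y : ℝ → R4) (t : ℝ) : ℝ := ⟪deriv γ t, Y t⟫

/-- The coefficient `b₃` in `γ' = b₁ X + b₂ Y + b₃ X' + b₄ Z`. -/
def coeffB3 (γ X : ℝ → R4) (t : ℝ) : ℝ := ⟪deriv γ t, deriv X t⟫

/-- The coefficient `b₄` in `γ' = b₁ X + b₂ Y + b₃ X' + b₄ Z`. -/
def coeffB4 (γ X Y : ℝ → R4) (t : ℝ) : ℝ := ⟪deriv γ t, frameZ X Y t⟫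

/-- The function `δ = -det(X, Y, X', X'')`. -/
def coeffDelta (X Y : ℝ → R4) (t : ℝ) : ℝ :=
  -det4 (X t) (Y t) (deriv X t) (deriv (deriv X) t)

/-- A pseudo-non-degenerate two-ruled frontal: a pseudo-non-degenerate two-ruled hypersurface
with `b₄ ≡ 0`. -/
structure IsPseudoNondegenerateFrontal (I : Set ℝ) (γ X Y : ℝ → R4) : Prop
    extends IsPseudoNondegenerate I γ X Y where
  coeffB4_eq_zero : ∀ t ∈ I, coeffB4 γ X Y t = 0

/-- A singular point of `f`: the differential is not injective. -/
def IsSingularPoint (f : R3 → R4) (p : R3) : Prop :=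
  ¬ Function.Injective (fderiv ℝ f p)

/-- The identifier of singularities `λ(t, s, r) = b₃(t) + s + r a(t)`. -/
def identifier (γ X Y : ℝ → R4) : R3 → ℝ :=
  fun p => coeffB3 γ X p.1 + p.2.1 + p.2.2 * coeffA X Y p.1

/-- The null vector field `η = ∂ₜ - b₁ ∂ₛ - b₂ ∂ᵣ`. -/
def nullField (γ X Y : ℝ → R4) : R3 → R3 :=
  fun p => (1, -coeffB1 γ X p.1, -coeffB2 γ Y p.1)

/-- The directional derivative `ηλ` at `p`. -/
def nullDerivIdentifier (γ X Y : ℝ → R4) (p : R3) : ℝ :=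
  fderiv ℝ (identifier γ X Y) p (nullField γ X Y p)

/-- Smooth `𝒜`-equivalence of the germ of `f` at `p` (with value `f p`) and the germ of `g`
at `q` (with value `g q`): `Φ ∘ f = g ∘ φ` near `p` for diffeomorphism germs
`φ : (ℝ³, p) → (ℝ³, q)` and `Φ : (ℝ⁴, f p) → (ℝ⁴, g q)`. -/
def AEquivalent (f : R3 → R4) (p : R3) (g : R3 → R4) (q : R3) : Prop :=
  ∃ (φ : R3 → R3) (Φ : R4 → R4),
    IsLocalDiffeomorphAt 𝓘(ℝ, R3) 𝓘(ℝ, R3) ∞ φ p ∧ φ p = q ∧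
    IsLocalDiffeomorphAt 𝓘(ℝ, R4) 𝓘(ℝ, R4) ∞ Φ (f p) ∧ Φ (f p) = g q ∧
    ∀ᶠ x in 𝓝 p, Φ (f x) = g (φ x)

/-- The germ of `f` at `p` is a cuspidal cross cap `×` interval: it is `𝒜`-equivalent to
`(t, s, r) ↦ (t, s, r², s r³)` at the origin. -/
def IsCuspidalCrossCapInterval (f : R3 → R4) (p : R3) : Prop :=
  AEquivalent f p (fun x => !₂[x.1, x.2.1, x.2.2 ^ 2, x.2.1 * x.2.2 ^ 3]) 0

end TwoRuled

end

/-! Everything is read off in the orthonormal frame X, Y, X', Z. By `fderiv_twoRuled`, df(v) has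
X'-coefficient v₁λ, while its X- and Y-coefficients are those of a submersion. So f is singular
exactly where λ = 0, the kernel there is spanned by η, and Z is a unit normal everywhere. Since Z' =
-δX' (`deriv_frameZ`), δ measures the rotation of this normal.

Sufficiency (`aequivalent_crossCapInterval`). Freeze the frame at t₀. The functions ⟨f, X(t₀)⟩, ⟨f,
Y(t₀)⟩ and t are coordinates on the source. Along a curve on which the first two are constant, the
velocity of f is orthogonal to X(t₀), Y(t₀) and Z(t), so the remaining components z and k satisfy dk
= m(t) dz with m = -⟨X'(t₀), Z⟩ / ⟨Z(t₀), Z⟩. At p, the second derivative of z along the curve is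
ηλ; if it is nonzero, z is a fold, and the curves are transverse to the singular set, so each can be
parametrized from its singular point. Normalize the fold to ±w² (`exists_fold_normal_form`) and
split m, as a function of w, into P(w²) + wQ(w²). Integration gives k = k₀ + w²P₁(e, w²) + w³K(e,
w²), and a target diffeomorphism removes all but w³K. Up to a factor that does not vanish at the
base point, K(e, 0) is m'(t), which is δ times a function equal to 1 at t₀. When δ = 0 and δ' ≠ 0, K
can itself be used as a coordinate, and the normal form appears (`aequivalent_of_cubic`).

The splitting into even and odd parts (`IsStripBump.exists_even_odd`) is Whitney's theorem with
parameters. It is obtained from Fourier series: cos(nw) and sin(nw)/(nw) are smooth functions of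
n²w², and the coefficients of a smooth bump decay fast enough for termwise differentiation.

Necessity (`necessary_of_aequivalent`). The normal form g has an explicit conormal field. Pulled
back by Φ it annihilates X, Y and, by density of the regular points, X'. Differentiating this last
relation along η at singular points, with X'' = -X - aY + δZ, yields δ·A = (3/2)·s·B, where s is the
second coordinate of φ and A, B are nonzero at p (`eventually_coeffDelta_mul_eq`). Hence δ = 0 and
δ' ≠ 0. Transversality of η holds because in the source of g the singular set is r = 0 and the null
direction is ∂ᵣ. -/

noncomputable section

namespace TwoRuled
open Set MeasureTheory

/-! ### Smooth dependence of integrals on parameters. -/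

section ParametricIntegral

variable {E F : Type*} [NormedAddCommGroup E] [NormedSpace ℝ E] [FiniteDimensional ℝ E]
  [NormedAddCommGroup F] [NormedSpace ℝ F]

/-- Differentiation under the integral sign for a `C¹` integrand on a compact interval. -/
theorem hasFDerivAt_intervalIntegral_of_contDiff [CompleteSpace F] {f : E × ℝ → F}
    (hf : ContDiff ℝ 1 f) (a b : ℝ) (y : E) :
    HasFDerivAt (fun y => ∫ u in a..b, f (y, u))
      (∫ u in a..b, (fderiv ℝ f (y, u)).comp (ContinuousLinearMap.inl ℝ E ℝ)) y := by
  have hc : Continuous fun p : E × ℝ => (fderiv ℝ f p).comp (ContinuousLinearMap.inl ℝ E ℝ) :=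
    (hf.continuous_fderiv (by simp)).clm_comp continuous_const
  obtain ⟨C, hC⟩ := ((isCompact_closedBall y 1).prod (isCompact_uIcc (a := a) (b := b))
    ).exists_bound_of_continuousOn hc.continuousOn
  refine intervalIntegral.hasFDerivAt_integral_of_dominated_of_fderiv_le (bound := fun _ => C)
    (F' := fun y u => (fderiv ℝ f (y, u)).comp (ContinuousLinearMap.inl ℝ E ℝ))
    (Metric.closedBall_mem_nhds y one_pos) ?_ ?_ ?_ ?_ (by simp) ?_
  · exact .of_forall fun x => (hf.continuous.comp (by fun_prop)).aestronglyMeasurable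
  · exact (hf.continuous.comp (by fun_prop : Continuous fun u : ℝ => (y, u))).intervalIntegrable _ _
  · exact (hc.comp (by fun_prop : Continuous fun u : ℝ => (y, u))).aestronglyMeasurable
  · refine .of_forall fun u hu x hx => hC (x, u) ⟨hx, uIoc_subset_uIcc hu⟩
  · refine .of_forall fun u _ x _ => ?_
    have h1 : HasFDerivAt (fun x : E => (x, u)) (ContinuousLinearMap.inl ℝ E ℝ) x :=
      hasFDerivAt_prodMk_left x u
    exact ((hf.differentiable (by simp) (x, u)).hasFDerivAt).comp x h1

/-- The integral of a smooth function over a compact interval depends smoothly on parameters. -/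
theorem contDiff_intervalIntegral {f : E × ℝ → ℝ} (hf : ContDiff ℝ ∞ f) (a b : ℝ) :
    ContDiff ℝ ∞ fun y => ∫ u in a..b, f (y, u) := by
  refine contDiff_infty.2 fun n => ?_
  induction n generalizing f with
  | zero =>
    refine contDiff_zero.2 ?_
    exact intervalIntegral.continuous_parametric_intervalIntegral_of_continuous'
      (f := fun y u => f (y, u)) hf.continuous a b
  | succ n ih =>
    have hd := hasFDerivAt_intervalIntegral_of_contDiff (hf.of_le (by simp)) a b
    have h1 : ContDiff ℝ ∞ (fderiv ℝ f) := (contDiff_infty_iff_fderiv.1 hf).2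
    push_cast
    refine contDiff_succ_iff_fderiv_apply.2 ⟨fun y => (hd y).differentiableAt, by simp, fun v => ?_⟩
    -- A directional derivative of the integral is again a parameter integral with a smooth
    -- integrand, which is why the induction ranges over all integrands.
    have h2 : ContDiff ℝ ∞ fun p : E × ℝ => fderiv ℝ f p (v, 0) := h1.clm_apply contDiff_const
    convert ih h2 using 2 with y
    rw [(hd y).fderiv, ContinuousLinearMap.intervalIntegral_apply]
    · simp
    · refine Continuous.intervalIntegrable ?_ _ _
      exact (h1.continuous.comp (by fun_prop)).clm_comp continuous_const

end ParametricIntegral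

/-! ### The cosine as a smooth function of the square, with bounded derivatives. -/

section EvenExtension

/-- The entire function `z ↦ ∑ (-z)ⁿ / (2n)!`, which satisfies `cosSqrt (w ^ 2) = cos w`. -/
def cosSqrt (z : ℝ) : ℝ :=
  (FormalMultilinearSeries.ofScalars ℝ fun n : ℕ => (-1 : ℝ) ^ n / (2 * n).factorial).sum z

theorem cosSqrt_sq (w : ℝ) : cosSqrt (w ^ 2) = Real.cos w := by
  rw [cosSqrt, FormalMultilinearSeries.sum, Real.cos_eq_tsum]
  refine tsum_congr fun n => ?_
  rw [FormalMultilinearSeries.ofScalars_apply_eq]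
  simp only [smul_eq_mul, pow_mul]
  ring

/-- Consecutive coefficients have absolute ratio 1 / ((2n + 2)(2n + 1)), so the radius of
convergence is infinite. -/
theorem contDiff_cosSqrt : ContDiff ℝ ∞ cosSqrt := by
  set c : ℕ → ℝ := fun n : ℕ => (-1 : ℝ) ^ n / (2 * n).factorial with hc
  have hr : (FormalMultilinearSeries.ofScalars ℝ c).radius = ⊤ := by
    refine FormalMultilinearSeries.ofScalars_radius_eq_top_of_tendsto ℝ c
      (.of_forall fun n => by simp [hc, Nat.factorial_ne_zero]) ?_
    refine squeeze_zero (fun n => by positivity) (fun n => ?_)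
      (tendsto_one_div_add_atTop_nhds_zero_nat (𝕜 := ℝ))
    have h1 : ((2 * (n + 1)).factorial : ℝ) = (2 * n + 2) * ((2 * n + 1) * (2 * n).factorial) := by
      have : 2 * (n + 1) = (2 * n + 1) + 1 := by ring
      rw [this, Nat.factorial_succ, Nat.factorial_succ]
      push_cast; ring
    have h2 : (0 : ℝ) < (2 * n).factorial := by positivity
    have h3 : ‖c n.succ‖ / ‖c n‖ = 1 / ((2 * n + 2) * (2 * n + 1)) := by
      simp only [hc, Nat.succ_eq_add_one, norm_div, norm_pow, norm_neg, norm_one, one_pow,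
        RCLike.norm_natCast, h1]
      rw [Real.norm_of_nonneg (by positivity)]
      field_simp
    rw [h3]
    refine one_div_le_one_div_of_le (by positivity) ?_
    have : (0 : ℝ) ≤ n := by positivity
    nlinarith
  have h := (FormalMultilinearSeries.ofScalars ℝ c).hasFPowerSeriesOnBall (by simp [hr])
  rw [hr] at h
  have h' : AnalyticOnNhd ℝ cosSqrt Set.univ := by
    have := h.analyticOnNhd
    rwa [Metric.eball_top] at this
  exact h'.contDiff

/-- Smooth real functions all of whose derivatives are bounded. -/
def IsBoundedSmooth (e : ℝ → ℝ) : Prop :=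
  ContDiff ℝ ∞ e ∧ ∀ k : ℕ, ∃ C, ∀ z, |iteratedDeriv k e z| ≤ C

theorem IsBoundedSmooth.deriv {e : ℝ → ℝ} (h : IsBoundedSmooth e) : IsBoundedSmooth (deriv e) := by
  refine ⟨(contDiff_infty_iff_deriv.1 h.1).2, fun k => ?_⟩
  obtain ⟨C, hC⟩ := h.2 (k + 1)
  exact ⟨C, fun z => by rw [← iteratedDeriv_succ']; exact hC z⟩

theorem IsBoundedSmooth.const_mul {e : ℝ → ℝ} (h : IsBoundedSmooth e) (c : ℝ) :
    IsBoundedSmooth fun z => c * e z := by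
  refine ⟨contDiff_const.mul h.1, fun k => ?_⟩
  obtain ⟨C, hC⟩ := h.2 k
  refine ⟨|c| * C, fun z => ?_⟩
  rw [iteratedDeriv_const_mul_field, abs_mul]
  gcongr
  exact hC z

theorem IsBoundedSmooth.bound {e : ℝ → ℝ} (h : IsBoundedSmooth e) : ∃ C, ∀ z, |e z| ≤ C := by
  simpa using h.2 0

/-- In the variable w = √z, differentiation in z is (2w)⁻¹ d/dw, which preserves this class of
expressions. For w ≥ 1 the argument w⁻¹ stays in [0, 1], so every derivative is bounded at +∞. -/
theorem iteratedDeriv_cosSqrt_sq (k : ℕ) : ∃ p q : Polynomial ℝ, ∀ w : ℝ, 0 < w →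
    iteratedDeriv k cosSqrt (w ^ 2) = p.eval w⁻¹ * Real.cos w + q.eval w⁻¹ * Real.sin w := by
  induction k with
  | zero => exact ⟨1, 0, fun w _ => by simp [cosSqrt_sq]⟩
  | succ k ih =>
    obtain ⟨p, q, h⟩ := ih
    -- The factor X / 2 is (2w)⁻¹, and -X² times a derivative is the chain rule for w⁻¹.
    refine ⟨.C (1/2) * .X * (q - .X ^ 2 * p.derivative),
      .C (1/2) * .X * (-p - .X ^ 2 * q.derivative), fun w hw => ?_⟩
    have hinv : HasDerivAt (fun w : ℝ => w⁻¹) (-(w ^ 2)⁻¹) w := hasDerivAt_inv hw.ne'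
    have h1 : HasDerivAt (fun w => p.eval w⁻¹ * Real.cos w + q.eval w⁻¹ * Real.sin w) _ w :=
      (((p.hasDerivAt w⁻¹).comp w hinv).mul (Real.hasDerivAt_cos w)).add
        (((q.hasDerivAt w⁻¹).comp w hinv).mul (Real.hasDerivAt_sin w))
    have h2 : HasDerivAt (iteratedDeriv k cosSqrt) (iteratedDeriv (k + 1) cosSqrt (w ^ 2)) (w ^ 2) := by
      rw [iteratedDeriv_succ]
      exact ((contDiff_cosSqrt.of_le (m := (k + 1 : ℕ)) (by exact_mod_cast le_top)
        ).differentiable_iteratedDeriv k (by norm_cast; omega) _).hasDerivAt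
    have h3 := HasDerivAt.comp w (h₂ := iteratedDeriv k cosSqrt) (h := fun x => x ^ 2) h2 (hasDerivAt_pow 2 w)
    have h4 := h3.unique (h1.congr_of_eventuallyEq (by
      filter_upwards [lt_mem_nhds hw] with x hx using h x hx))
    have hw' := hw.ne'
    simp only [Function.comp_def] at h4
    simp only [Polynomial.eval_mul, Polynomial.eval_C, Polynomial.eval_X, Polynomial.eval_sub,
      Polynomial.eval_pow, Polynomial.eval_neg]
    field_simp at h4 ⊢
    norm_num at h4
    simp only [one_div]
    linarith

/-- There is a smooth function on the whole line, with bounded derivatives, that restricts to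
`z ↦ cos √z` on the nonnegative half-line. -/
theorem exists_isBoundedSmooth_cos :
    ∃ e : ℝ → ℝ, IsBoundedSmooth e ∧ ∀ w, e (w ^ 2) = Real.cos w := by
  -- On the negative axis `cosSqrt` grows like a hyperbolic cosine of √|z|. The cutoff removes it
  -- below -2 and is 1 from -1 on, so the values at squares are untouched.
  set e : ℝ → ℝ := fun z => Real.smoothTransition (z + 2) * cosSqrt z with he
  have hs : ContDiff ℝ ∞ e :=
    ((Real.smoothTransition.contDiff).comp (by fun_prop)).mul contDiff_cosSqrt
  have h1 : ∀ z > -1, e =ᶠ[𝓝 z] cosSqrt := fun z hz => by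
    filter_upwards [lt_mem_nhds hz] with x hx
    simp [he, Real.smoothTransition.one_of_one_le (show 1 ≤ x + 2 by linarith)]
  have h0 : ∀ z < -2, e =ᶠ[𝓝 z] fun _ => 0 := fun z hz => by
    filter_upwards [gt_mem_nhds hz] with x hx
    simp [he, Real.smoothTransition.zero_of_nonpos (show x + 2 ≤ 0 by linarith)]
  refine ⟨e, ⟨hs, fun k => ?_⟩, fun w => ?_⟩
  · have hck : Continuous (iteratedDeriv k e) :=
      hs.continuous_iteratedDeriv k (by exact_mod_cast le_top)
    obtain ⟨C₁, hC₁⟩ := (isCompact_Icc (a := (-2 : ℝ)) (b := 1)).exists_bound_of_continuousOn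
      hck.continuousOn
    obtain ⟨p, q, hpq⟩ := iteratedDeriv_cosSqrt_sq k
    obtain ⟨C₂, hC₂⟩ := (isCompact_Icc (a := (0 : ℝ)) (b := 1)).exists_bound_of_continuousOn
      p.continuous.continuousOn
    obtain ⟨C₃, hC₃⟩ := (isCompact_Icc (a := (0 : ℝ)) (b := 1)).exists_bound_of_continuousOn
      q.continuous.continuousOn
    -- Three regions: zero below -2, compactness on [-2, 1], the explicit trigonometric form beyond
    -- 1.
    refine ⟨max (max C₁ 0) (C₂ + C₃), fun z => ?_⟩
    rcases lt_or_ge z (-2) with hz | hz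
    · rw [(h0 z hz).iteratedDeriv_eq k]
      simp
    rcases le_or_gt z 1 with hz' | hz'
    · exact ((hC₁ z ⟨hz, hz'⟩).trans (le_max_left _ _)).trans (le_max_left _ _)
    · refine le_trans ?_ (le_max_right _ _)
      rw [(h1 z (by linarith)).iteratedDeriv_eq k]
      have hw : 0 < √z := Real.sqrt_pos.2 (by linarith)
      have hw1 : 1 ≤ √z := Real.one_le_sqrt.2 hz'.le
      have := hpq √z hw
      rw [Real.sq_sqrt (by linarith)] at this
      rw [this]
      have hm : (√z)⁻¹ ∈ Icc (0 : ℝ) 1 := ⟨by positivity, inv_le_one_of_one_le₀ hw1⟩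
      refine (abs_add_le _ _).trans (add_le_add ?_ ?_)
      · rw [abs_mul]
        exact (mul_le_of_le_one_right (abs_nonneg _) (Real.abs_cos_le_one _)).trans (hC₂ _ hm)
      · rw [abs_mul]
        exact (mul_le_of_le_one_right (abs_nonneg _) (Real.abs_sin_le_one _)).trans (hC₃ _ hm)
  · rw [(h1 (w ^ 2) (by nlinarith)).eq_of_nhds, cosSqrt_sq]

end EvenExtension
end TwoRuled
end

noncomputable section

namespace TwoRuled
open Set MeasureTheory

/-! ### Even and odd parts as smooth functions of w², by Fourier series with parameters. -/

section Whitney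

variable {E F G : Type*} [NormedAddCommGroup E] [NormedSpace ℝ E]
  [NormedAddCommGroup F] [NormedSpace ℝ F] [NormedAddCommGroup G] [NormedSpace ℝ G]

/-- The derivative in the last variable. -/
def dw (H : E × ℝ → F) (p : E × ℝ) : F := fderiv ℝ H p (0, 1)

/-- Smooth functions on `E × ℝ` with compact support contained in `E × (-π, π)`. -/
structure IsStripBump (H : E × ℝ → F) : Prop where
  contDiff : ContDiff ℝ ∞ H
  hasCompactSupport : HasCompactSupport H
  tsupport_subset : tsupport H ⊆ {p | p.2 ∈ Ioo (-Real.pi) Real.pi}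

namespace IsStripBump

variable {H : E × ℝ → F}

/-- A single closure property that covers the w-derivative, the directional derivatives and the
differential in the parameter. -/
theorem clm_fderiv (h : IsStripBump H) (L : (E × ℝ →L[ℝ] F) →L[ℝ] G) :
    IsStripBump fun p => L (fderiv ℝ H p) where
  contDiff := L.contDiff.comp (contDiff_infty_iff_fderiv.1 h.contDiff).2
  hasCompactSupport := (h.hasCompactSupport.fderiv ℝ).comp_left (map_zero L)
  tsupport_subset := ((tsupport_comp_subset (map_zero L) _).trans
    (tsupport_fderiv_subset ℝ)).trans h.tsupport_subset

theorem sub (h : IsStripBump H) {K : E × ℝ → F} (k : IsStripBump K) :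
    IsStripBump fun p => H p - K p where
  contDiff := h.contDiff.sub k.contDiff
  hasCompactSupport := h.hasCompactSupport.sub k.hasCompactSupport
  tsupport_subset := (tsupport_sub H K).trans (union_subset h.tsupport_subset k.tsupport_subset)

theorem neg (h : IsStripBump H) : IsStripBump fun p => - H p where
  contDiff := h.contDiff.neg
  hasCompactSupport := h.hasCompactSupport.neg
  tsupport_subset := by
    have : tsupport (fun p => - H p) = tsupport H := tsupport_neg H
    exact this.trans_subset h.tsupport_subset

theorem eq_zero (h : IsStripBump H) (y : E) {w : ℝ} (hw : w ∉ Ioo (-Real.pi) Real.pi) :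
    H (y, w) = 0 :=
  image_eq_zero_of_notMem_tsupport fun hmem => hw (h.tsupport_subset hmem)

theorem exists_bound (h : IsStripBump H) : ∃ C, ∀ p, ‖H p‖ ≤ C :=
  h.hasCompactSupport.exists_bound_of_continuous h.contDiff.continuous

theorem isStripBump_dw (h : IsStripBump H) : IsStripBump (dw H) :=
  h.clm_fderiv (ContinuousLinearMap.apply ℝ F ((0 : E), (1 : ℝ)))

theorem hasDerivAt (h : IsStripBump H) (y : E) (w : ℝ) :
    HasDerivAt (fun w => H (y, w)) (dw H (y, w)) w := by
  have h1 := ((h.contDiff.differentiable (by simp)) (y, w)).hasFDerivAt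
  have h2 : HasDerivAt (fun w : ℝ => (y, w)) ((0 : E), (1 : ℝ)) w :=
    (hasDerivAt_const w y).prodMk (hasDerivAt_id w)
  exact h1.comp_hasDerivAt w h2

theorem continuous_snd (h : IsStripBump H) (y : E) : Continuous fun w => H (y, w) :=
  h.contDiff.continuous.comp (by fun_prop)

end IsStripBump

/-- The cosine Fourier coefficients in the last variable. -/
def cosCoeff (H : E × ℝ → F) (n : ℤ) (y : E) : F :=
  ∫ w in -Real.pi..Real.pi, Real.cos (n * w) • H (y, w)

/-- The sine Fourier coefficients in the last variable. -/
def sinCoeff (H : E × ℝ → F) (n : ℤ) (y : E) : F :=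
  ∫ w in -Real.pi..Real.pi, Real.sin (n * w) • H (y, w)

/-- Integration by parts; the boundary terms vanish because the support lies strictly inside (-π,
π). -/
theorem cosCoeff_dw {H : E × ℝ → ℝ} (h : IsStripBump H) (n : ℤ) (y : E) :
    cosCoeff (dw H) n y = n * sinCoeff H n y := by
  have h0 : ∀ w, w ∉ Ioo (-Real.pi) Real.pi → H (y, w) = 0 := fun w hw => h.eq_zero y hw
  have := intervalIntegral.integral_mul_deriv_eq_deriv_mul (a := -Real.pi) (b := Real.pi)
    (u := fun w => Real.cos (n * w)) (v := fun w => H (y, w))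
    (u' := fun w => -Real.sin (n * w) * n) (v' := fun w => dw H (y, w))
    (fun w _ => by simpa using ((hasDerivAt_id w).const_mul (n : ℝ)).cos)
    (fun w _ => h.hasDerivAt y w)
    (Continuous.intervalIntegrable (by fun_prop) _ _)
    ((h.isStripBump_dw.continuous_snd y).intervalIntegrable _ _)
  simp only [cosCoeff, sinCoeff, smul_eq_mul]
  rw [this, h0 _ (by simp), h0 _ (by simp), ← intervalIntegral.integral_const_mul, mul_zero,
    mul_zero, sub_zero, zero_sub, ← intervalIntegral.integral_neg]
  congr 1 with w
  ring

theorem sinCoeff_dw {H : E × ℝ → ℝ} (h : IsStripBump H) (n : ℤ) (y : E) :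
    sinCoeff (dw H) n y = -n * cosCoeff H n y := by
  have h0 : ∀ w, w ∉ Ioo (-Real.pi) Real.pi → H (y, w) = 0 := fun w hw => h.eq_zero y hw
  have := intervalIntegral.integral_mul_deriv_eq_deriv_mul (a := -Real.pi) (b := Real.pi)
    (u := fun w => Real.sin (n * w)) (v := fun w => H (y, w))
    (u' := fun w => Real.cos (n * w) * n) (v' := fun w => dw H (y, w))
    (fun w _ => by simpa using ((hasDerivAt_id w).const_mul (n : ℝ)).sin)
    (fun w _ => h.hasDerivAt y w)
    (Continuous.intervalIntegrable (by fun_prop) _ _)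
    ((h.isStripBump_dw.continuous_snd y).intervalIntegrable _ _)
  simp only [cosCoeff, sinCoeff, smul_eq_mul]
  rw [this, h0 _ (by simp), h0 _ (by simp), ← intervalIntegral.integral_const_mul, mul_zero,
    mul_zero, sub_zero, zero_sub, ← intervalIntegral.integral_neg]
  congr 1 with w
  ring

theorem cosCoeff_neg_dw_dw {H : E × ℝ → ℝ} (h : IsStripBump H) (n : ℤ) (y : E) :
    cosCoeff (fun p => - dw (dw H) p) n y = n ^ 2 * cosCoeff H n y := by
  have : cosCoeff (fun p => - dw (dw H) p) n y = - cosCoeff (dw (dw H)) n y := by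
    simp [cosCoeff]
  rw [this, cosCoeff_dw h.isStripBump_dw, sinCoeff_dw h]
  ring

theorem norm_cosCoeff_le {H : E × ℝ → F} (h : IsStripBump H) :
    ∃ C, 0 ≤ C ∧ ∀ (n : ℤ) (y : E), ‖cosCoeff H n y‖ ≤ C := by
  obtain ⟨C, hC⟩ := h.exists_bound
  have hC0 : 0 ≤ C := (norm_nonneg _).trans (hC 0)
  refine ⟨C * |Real.pi - -Real.pi|, by positivity, fun n y => ?_⟩
  refine intervalIntegral.norm_integral_le_of_norm_le_const fun w _ => ?_
  rw [norm_smul]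
  exact (mul_le_of_le_one_left (norm_nonneg _) (Real.abs_cos_le_one _)).trans (hC _)

/-- The operator `1 - ∂²/∂w²`, which multiplies Fourier coefficients by `1 + n ^ 2`. -/
def helmholtz (H : E × ℝ → ℝ) (p : E × ℝ) : ℝ := H p - dw (dw H) p

theorem isStripBump_helmholtz {H : E × ℝ → ℝ} (h : IsStripBump H) : IsStripBump (helmholtz H) :=
  h.sub h.isStripBump_dw.isStripBump_dw

theorem cosCoeff_helmholtz {H : E × ℝ → ℝ} (h : IsStripBump H) (n : ℤ) (y : E) :
    cosCoeff (helmholtz H) n y = (1 + n ^ 2) * cosCoeff H n y := by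
  have h2 := cosCoeff_neg_dw_dw h n y
  have hi : ∀ {K : E × ℝ → ℝ}, IsStripBump K → IntervalIntegrable
      (fun w => Real.cos (n * w) • K (y, w)) volume (-Real.pi) Real.pi := fun hK =>
    Continuous.intervalIntegrable
      ((by fun_prop : Continuous fun w : ℝ => Real.cos (n * w)).smul (hK.continuous_snd y)) _ _
  have : cosCoeff (helmholtz H) n y = cosCoeff H n y + cosCoeff (fun p => - dw (dw H) p) n y := by
    rw [cosCoeff, cosCoeff, cosCoeff, ← intervalIntegral.integral_add (hi h)
      (hi h.isStripBump_dw.isStripBump_dw.neg)]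
    congr 1 with w
    simp [helmholtz]; ring
  rw [this, h2]; ring

theorem isStripBump_fderiv_inl {H : E × ℝ → F} (h : IsStripBump H) :
    IsStripBump fun p => (fderiv ℝ H p).comp (ContinuousLinearMap.inl ℝ E ℝ) :=
  h.clm_fderiv ((ContinuousLinearMap.compL ℝ E (E × ℝ) F).flip (ContinuousLinearMap.inl ℝ E ℝ))

theorem isStripBump_fderiv_apply {H : E × ℝ → F} (h : IsStripBump H) (v : E × ℝ) :
    IsStripBump fun p => fderiv ℝ H p v :=
  h.clm_fderiv (ContinuousLinearMap.apply ℝ F v)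

theorem summable_inv_one_add_sq : Summable fun n : ℤ => ((1 : ℝ) + n ^ 2)⁻¹ := by
  refine Summable.of_nonneg_of_le (fun n => by positivity) (fun n => ?_)
    (((Real.summable_one_div_int_pow (p := 2)).2 one_lt_two).add
      (summable_of_ne_finset_zero (s := {(0 : ℤ)}) (f := fun n : ℤ => if n = 0 then (1 : ℝ) else 0)
        (by simp)))
  by_cases hn : n = 0
  · simp [hn]
  · have : (0 : ℝ) < (n : ℝ) ^ 2 := by positivity
    simp only [hn, if_false, add_zero, one_div]
    exact inv_anti₀ this (by linarith)

/-- The coefficients of (1 - ∂²/∂w²)H are bounded and equal 1 + n² times those of H. This quadratic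
decay suffices, because every derivative of the series below is again such a series for another
bump. -/
theorem norm_cosCoeff_le_inv {H : E × ℝ → ℝ} (h : IsStripBump H) :
    ∃ C, 0 ≤ C ∧ ∀ (n : ℤ) (y : E), |cosCoeff H n y| ≤ C * ((1 : ℝ) + n ^ 2)⁻¹ := by
  obtain ⟨C, hC0, hC⟩ := norm_cosCoeff_le (isStripBump_helmholtz h)
  refine ⟨C, hC0, fun n y => ?_⟩
  have h1 := hC n y
  have hp : (0 : ℝ) < 1 + n ^ 2 := by positivity
  rw [cosCoeff_helmholtz h, Real.norm_eq_abs, abs_mul, abs_of_pos hp] at h1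
  rw [← div_eq_mul_inv, le_div_iff₀ hp]
  linarith

theorem cosCoeff_fderiv_apply {H : E × ℝ → ℝ} (h : IsStripBump H) (n : ℤ) (y v : E) :
    cosCoeff (fun p => (fderiv ℝ H p).comp (ContinuousLinearMap.inl ℝ E ℝ)) n y v =
      cosCoeff (fun p => fderiv ℝ H p (v, 0)) n y := by
  rw [cosCoeff, ContinuousLinearMap.intervalIntegral_apply]
  · simp [cosCoeff]
  · refine Continuous.intervalIntegrable ?_ _ _
    refine (by fun_prop : Continuous fun w : ℝ => Real.cos (n * w)).smul ?_
    exact ((contDiff_infty_iff_fderiv.1 h.contDiff).2.continuous.comp (by fun_prop)).clm_comp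
      continuous_const

/-- The Fourier multiplier series `∑ e (n² ζ) aₙ(y)`. -/
def multiplierSum (H : E × ℝ → ℝ) (e : ℝ → ℝ) (p : E × ℝ) : ℝ :=
  ∑' n : ℤ, e (n ^ 2 * p.2) * cosCoeff H n p.1

theorem summable_multiplier {H : E × ℝ → ℝ} (h : IsStripBump H) {e : ℝ → ℝ}
    (he : IsBoundedSmooth e) (p : E × ℝ) :
    Summable fun n : ℤ => e (n ^ 2 * p.2) * cosCoeff H n p.1 := by
  obtain ⟨C, hC0, hC⟩ := norm_cosCoeff_le_inv h
  obtain ⟨D, hD⟩ := he.bound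
  refine Summable.of_norm_bounded (g := fun n : ℤ => D * (C * ((1 : ℝ) + n ^ 2)⁻¹))
    ((summable_inv_one_add_sq.mul_left C).mul_left D) fun n => ?_
  rw [norm_mul]
  exact mul_le_mul (hD _) (hC n _) (norm_nonneg _) ((abs_nonneg _).trans (hD 0))

variable [FiniteDimensional ℝ E]

/-- Coefficients are allowed values in a normed space precisely so that the differential of a
coefficient is the coefficient of the partial differential. -/
theorem hasFDerivAt_cosCoeff [CompleteSpace F] {H : E × ℝ → F} (h : IsStripBump H) (n : ℤ) (y : E) :
    HasFDerivAt (cosCoeff H n)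
      (cosCoeff (fun p => (fderiv ℝ H p).comp (ContinuousLinearMap.inl ℝ E ℝ)) n y) y := by
  have hf : ContDiff ℝ 1 fun p : E × ℝ => Real.cos (n * p.2) • H p :=
    ContDiff.smul (by fun_prop) (h.contDiff.of_le (by simp))
  refine (hasFDerivAt_intervalIntegral_of_contDiff hf _ _ y).congr_fderiv ?_
  rw [cosCoeff]
  congr 1 with w : 1
  ext v
  have h1 : HasFDerivAt (fun y => Real.cos (n * w) • H (y, w))
      (Real.cos (n * w) • (fderiv ℝ H (y, w)).comp (ContinuousLinearMap.inl ℝ E ℝ)) y :=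
    (((h.contDiff.differentiable (by simp) (y, w)).hasFDerivAt).comp y
      (hasFDerivAt_prodMk_left y w)).const_smul _
  have h2 := HasFDerivAt.comp (f := fun y : E => (y, w)) y
    ((hf.differentiable (by simp) (y, w)).hasFDerivAt) (hasFDerivAt_prodMk_left y w)
  rw [← h2.unique h1]

/-- The factor 1 + n² does not involve the parameter, so the same device gives the decay after
differentiation in y. -/
theorem norm_fderiv_cosCoeff_le_inv {H : E × ℝ → ℝ} (h : IsStripBump H) :
    ∃ C, 0 ≤ C ∧ ∀ (n : ℤ) (y : E), ‖fderiv ℝ (cosCoeff H n) y‖ ≤ C * ((1 : ℝ) + n ^ 2)⁻¹ := by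
  have h' := isStripBump_helmholtz h
  obtain ⟨C, hC0, hC⟩ := norm_cosCoeff_le (isStripBump_fderiv_inl h')
  refine ⟨C, hC0, fun n y => ?_⟩
  have hp : (0 : ℝ) < 1 + n ^ 2 := by positivity
  have h1 := hC n y
  rw [← (hasFDerivAt_cosCoeff h' n y).fderiv] at h1
  have h2 : cosCoeff (helmholtz H) n = fun y => ((1 : ℝ) + n ^ 2) * cosCoeff H n y :=
    funext fun y => cosCoeff_helmholtz h n y
  rw [h2, fderiv_const_mul (hasFDerivAt_cosCoeff h n y).differentiableAt, norm_smul,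
    Real.norm_eq_abs, abs_of_pos hp] at h1
  rw [← div_eq_mul_inv, le_div_iff₀ hp]
  linarith

/-- Differentiating e(n²ζ) in ζ produces a factor n², which is moved onto the coefficient as
-∂²H/∂w². Both partial derivatives are therefore multiplier series of the same type, for new bumps
and with e or e', and all are dominated by a multiple of ∑ (1 + n²)⁻¹. -/
theorem hasFDerivAt_multiplierSum {H : E × ℝ → ℝ} (h : IsStripBump H) {e : ℝ → ℝ}
    (he : IsBoundedSmooth e) (p : E × ℝ) :
    ∃ L : E × ℝ →L[ℝ] ℝ, HasFDerivAt (multiplierSum H e) L p ∧ ∀ v : E × ℝ,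
      L v = multiplierSum (fun p => fderiv ℝ H p (v.1, 0)) e p +
        v.2 * multiplierSum (fun p => - dw (dw H) p) (deriv e) p := by
  have hH'' := h.isStripBump_dw.isStripBump_dw.neg
  obtain ⟨C, hC0, hC⟩ := norm_fderiv_cosCoeff_le_inv h
  obtain ⟨C', hC0', hC'⟩ := norm_cosCoeff_le_inv hH''
  obtain ⟨D, hD⟩ := he.bound
  obtain ⟨D', hD'⟩ := he.deriv.bound
  have hD0 : 0 ≤ D := (abs_nonneg _).trans (hD 0)
  have hD0' : 0 ≤ D' := (abs_nonneg _).trans (hD' 0)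
  let L : ℤ → E × ℝ → (E × ℝ →L[ℝ] ℝ) := fun n p =>
    e (n ^ 2 * p.2) • (fderiv ℝ (cosCoeff H n) p.1).comp (ContinuousLinearMap.fst ℝ E ℝ) +
    (deriv e (n ^ 2 * p.2) * cosCoeff (fun p => - dw (dw H) p) n p.1) •
      ContinuousLinearMap.snd ℝ E ℝ
  let u : ℤ → ℝ := fun n => D * (C * ((1 : ℝ) + n ^ 2)⁻¹) + D' * (C' * ((1 : ℝ) + n ^ 2)⁻¹)
  have hu : Summable u := ((summable_inv_one_add_sq.mul_left C).mul_left D).add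
    ((summable_inv_one_add_sq.mul_left C').mul_left D')
  have hd : ∀ (n : ℤ) (p : E × ℝ),
      HasFDerivAt (fun p : E × ℝ => e (n ^ 2 * p.2) * cosCoeff H n p.1) (L n p) p := by
    intro n p
    have h1 : HasFDerivAt (fun p : E × ℝ => cosCoeff H n p.1)
        ((fderiv ℝ (cosCoeff H n) p.1).comp (ContinuousLinearMap.fst ℝ E ℝ)) p :=
      (hasFDerivAt_cosCoeff h n p.1).differentiableAt.hasFDerivAt.comp p hasFDerivAt_fst
    have h2 : HasFDerivAt (fun p : E × ℝ => (n : ℝ) ^ 2 * p.2)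
        ((n : ℝ) ^ 2 • ContinuousLinearMap.snd ℝ E ℝ) p := hasFDerivAt_snd.const_mul _
    have h3 : HasFDerivAt (fun p : E × ℝ => e (n ^ 2 * p.2))
        (deriv e (n ^ 2 * p.2) • (n : ℝ) ^ 2 • ContinuousLinearMap.snd ℝ E ℝ) p :=
      (he.1.differentiable (by simp) _).hasDerivAt.comp_hasFDerivAt p h2
    refine (h3.mul h1).congr_fderiv ?_
    ext v
    · simp [L]
    · simp only [L, cosCoeff_neg_dw_dw h]
      simp
      ring
  have hL : ∀ (n : ℤ) (p : E × ℝ), ‖L n p‖ ≤ u n := by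
    intro n p
    refine (norm_add_le _ _).trans (add_le_add ?_ ?_)
    · rw [norm_smul]
      refine mul_le_mul (hD _) ?_ (norm_nonneg _) hD0
      refine (ContinuousLinearMap.opNorm_comp_le _ _).trans ?_
      exact (mul_le_of_le_one_right (norm_nonneg _) (ContinuousLinearMap.norm_fst_le _ _ _)).trans
        (hC n _)
    · rw [norm_smul, norm_mul]
      refine (mul_le_of_le_one_right (by positivity) (ContinuousLinearMap.norm_snd_le _ _ _)).trans ?_
      exact mul_le_mul (hD' _) (hC' n _) (norm_nonneg _) hD0'
  refine ⟨∑' n, L n p, hasFDerivAt_tsum hu hd hL (summable_multiplier h he p) p, fun v => ?_⟩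
  have hs : Summable fun n => L n p := Summable.of_norm_bounded hu fun n => hL n p
  rw [show (∑' n, L n p) v = ∑' n, L n p v from
    (ContinuousLinearMap.apply ℝ ℝ v).map_tsum hs, multiplierSum, multiplierSum, ← tsum_mul_left,
    ← (summable_multiplier (isStripBump_fderiv_apply h (v.1, 0)) he p).tsum_add
      ((summable_multiplier hH'' he.deriv p).mul_left _)]
  refine tsum_congr fun n => ?_
  simp only [L, (hasFDerivAt_cosCoeff h n p.1).fderiv]
  simp [cosCoeff_fderiv_apply h]
  ring

/-- The class of multiplier series is stable under directional derivatives up to sums and constants,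
so one induction over all H and e gives every order. -/
theorem contDiff_multiplierSum {H : E × ℝ → ℝ} (h : IsStripBump H) {e : ℝ → ℝ}
    (he : IsBoundedSmooth e) : ContDiff ℝ ∞ (multiplierSum H e) := by
  refine contDiff_infty.2 fun n => ?_
  induction n generalizing H e with
  | zero =>
    refine contDiff_zero.2 (continuous_iff_continuousAt.2 fun p => ?_)
    obtain ⟨L, hL, -⟩ := hasFDerivAt_multiplierSum h he p
    exact hL.continuousAt
  | succ n ih =>
    push_cast
    refine contDiff_succ_iff_fderiv_apply.2 ⟨fun p => ?_, by simp, fun v => ?_⟩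
    · obtain ⟨L, hL, -⟩ := hasFDerivAt_multiplierSum h he p
      exact hL.differentiableAt
    · have hv : (fun p => fderiv ℝ (multiplierSum H e) p v) = fun p =>
          multiplierSum (fun p => fderiv ℝ H p (v.1, 0)) e p +
            v.2 * multiplierSum (fun p => - dw (dw H) p) (deriv e) p := funext fun p => by
        obtain ⟨L, hL, hLv⟩ := hasFDerivAt_multiplierSum h he p
        rw [hL.fderiv, hLv]
      rw [hv]
      exact (ih (isStripBump_fderiv_apply h _) he).add
        (contDiff_const.mul (ih h.isStripBump_dw.isStripBump_dw.neg he.deriv))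

omit [FiniteDimensional ℝ E] in
theorem abs_sinCoeff_le {H : E × ℝ → ℝ} (h : IsStripBump H) (n : ℤ) (y : E) :
    |sinCoeff H n y| ≤ |cosCoeff (dw H) n y| := by
  rw [cosCoeff_dw h, abs_mul]
  rcases eq_or_ne n 0 with rfl | hn
  · simp [sinCoeff]
  · refine le_mul_of_one_le_left (abs_nonneg _) ?_
    exact_mod_cast Int.one_le_abs hn

-- The real part of the complex Fourier series of the 2π-periodic extension. Summability of the sine
-- part comes from the cosine coefficients of ∂H/∂w.
omit [FiniteDimensional ℝ E] in
theorem hasSum_cosCoeff_sinCoeff {H : E × ℝ → ℝ} (h : IsStripBump H) (y : E) {w : ℝ}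
    (hw : w ∈ Ioo (-Real.pi) Real.pi) :
    HasSum (fun n : ℤ => (2 * Real.pi)⁻¹ * (Real.cos (n * w) * cosCoeff H n y +
      Real.sin (n * w) * sinCoeff H n y)) (H (y, w)) := by
  have : Fact (0 < 2 * Real.pi) := ⟨Real.two_pi_pos⟩
  have hpi : -Real.pi + 2 * Real.pi = Real.pi := by ring
  set g : ℝ → ℂ := fun w => (H (y, w) : ℂ) with hg
  have hgc : Continuous g := Complex.continuous_ofReal.comp (h.continuous_snd y)
  -- The periodic extension is continuous because H vanishes at both endpoints.
  let f : C(AddCircle (2 * Real.pi), ℂ) := ⟨AddCircle.liftIoc (2 * Real.pi) (-Real.pi) g,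
    AddCircle.liftIoc_continuous (by
      rw [hpi]
      simp only [hg]
      rw [h.eq_zero y (by simp), h.eq_zero y (by simp)]) hgc.continuousOn⟩
  have hcoe : ∀ x ∈ Ioc (-Real.pi) Real.pi, f (x : AddCircle (2 * Real.pi)) = g x := fun x hx => by
    change AddCircle.liftIoc (2 * Real.pi) (-Real.pi) g x = g x
    exact AddCircle.liftIoc_coe_apply (by rwa [hpi])
  have hexp : ∀ (n : ℤ) (x : ℝ), fourier n (x : AddCircle (2 * Real.pi)) =
      ((Real.cos (n * x) : ℝ) : ℂ) + (Real.sin (n * x) : ℝ) * Complex.I := fun n x => by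
    rw [fourier_coe_apply]
    push_cast
    rw [← Complex.exp_mul_I]
    congr 1
    have : (Real.pi : ℂ) ≠ 0 := by exact_mod_cast Real.pi_ne_zero
    field_simp
  have hcoeff : ∀ n : ℤ, fourierCoeff f n = ((2 * Real.pi)⁻¹ : ℝ) *
      (((cosCoeff H n y : ℝ) : ℂ) - ((sinCoeff H n y : ℝ) : ℂ) * Complex.I) := fun n => by
    rw [fourierCoeff_eq_intervalIntegral _ n (-Real.pi), hpi, Complex.real_smul, one_div]
    congr 1
    have hle : -Real.pi ≤ Real.pi := by linarith [Real.pi_pos]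
    have h1 : ∫ x in -Real.pi..Real.pi,
          fourier (-n) (x : AddCircle (2 * Real.pi)) • f (x : AddCircle (2 * Real.pi)) =
        ∫ x in -Real.pi..Real.pi, (((Real.cos (n * x) • H (y, x) : ℝ) : ℂ) -
          ((Real.sin (n * x) • H (y, x) : ℝ) : ℂ) * Complex.I) := by
      refine intervalIntegral.integral_congr_ae (.of_forall fun x hx => ?_)
      rw [uIoc_of_le hle] at hx
      rw [hcoe x hx, hexp]
      simp [hg]
      ring
    have hc1 : Continuous fun x => Real.cos (n * x) • H (y, x) :=
      (by fun_prop : Continuous fun w : ℝ => Real.cos (n * w)).smul (h.continuous_snd y)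
    have hc2 : Continuous fun x => Real.sin (n * x) • H (y, x) :=
      (by fun_prop : Continuous fun w : ℝ => Real.sin (n * w)).smul (h.continuous_snd y)
    have hi1 : IntervalIntegrable (fun x => ((Real.cos (n * x) • H (y, x) : ℝ) : ℂ)) volume
        (-Real.pi) Real.pi := (Complex.continuous_ofReal.comp hc1).intervalIntegrable _ _
    have hi2 : IntervalIntegrable (fun x => ((Real.sin (n * x) • H (y, x) : ℝ) : ℂ) * Complex.I)
        volume (-Real.pi) Real.pi :=
      ((Complex.continuous_ofReal.comp hc2).mul continuous_const).intervalIntegrable _ _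
    rw [h1, intervalIntegral.integral_sub hi1 hi2, intervalIntegral.integral_mul_const,
      intervalIntegral.integral_ofReal, intervalIntegral.integral_ofReal, cosCoeff, sinCoeff]
  have hsum : Summable (fourierCoeff f) := by
    obtain ⟨C, -, hC⟩ := norm_cosCoeff_le_inv h
    obtain ⟨C', -, hC'⟩ := norm_cosCoeff_le_inv h.isStripBump_dw
    refine Summable.of_norm_bounded (g := fun n : ℤ => (2 * Real.pi)⁻¹ *
      (C * ((1 : ℝ) + n ^ 2)⁻¹ + C' * ((1 : ℝ) + n ^ 2)⁻¹))
      (((summable_inv_one_add_sq.mul_left C).add (summable_inv_one_add_sq.mul_left C')).mul_left _)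
      fun n => ?_
    rw [hcoeff, norm_mul, Complex.norm_real, Real.norm_of_nonneg (by positivity)]
    refine mul_le_mul_of_nonneg_left ((norm_sub_le _ _).trans (add_le_add ?_ ?_)) (by positivity)
    · rw [Complex.norm_real]; exact hC n y
    · rw [norm_mul, Complex.norm_I, mul_one, Complex.norm_real]
      exact (abs_sinCoeff_le h n y).trans (hC' n y)
  have hS := Complex.hasSum_re (has_pointwise_sum_fourier_series_of_summable hsum
    (w : AddCircle (2 * Real.pi)))
  rw [hcoe w ⟨hw.1, hw.2.le⟩] at hS
  convert hS using 2 with n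
  · rw [hcoeff, hexp, smul_eq_mul, mul_assoc, Complex.re_ofReal_mul]
    simp only [Complex.mul_re, Complex.mul_im, Complex.sub_re, Complex.sub_im, Complex.add_re,
      Complex.add_im, Complex.ofReal_re, Complex.ofReal_im, Complex.I_re, Complex.I_im]
    ring
  · simp [hg]

/-- Replace cos(nw) by e(n²w²) and sin(nw) by nw·(-2e'(n²w²)) in the Fourier series. The spare
factor n turns the sine coefficient of H into the cosine coefficient of ∂H/∂w, so both parts are
multiplier series at ζ = w². -/
theorem IsStripBump.exists_even_odd {H : E × ℝ → ℝ} (h : IsStripBump H) :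
    ∃ P Q : E × ℝ → ℝ, ContDiff ℝ ∞ P ∧ ContDiff ℝ ∞ Q ∧
      ∀ y, ∀ w ∈ Ioo (-Real.pi) Real.pi, H (y, w) = P (y, w ^ 2) + w * Q (y, w ^ 2) := by
  obtain ⟨e, he, hcos⟩ := exists_isBoundedSmooth_cos
  have hs : IsBoundedSmooth fun z => -2 * deriv e z := he.deriv.const_mul (-2)
  -- Obtained by differentiating e(u²) = cos u.
  have hsin : ∀ u, Real.sin u = u * (-2 * deriv e (u ^ 2)) := fun u => by
    have h1 := HasDerivAt.comp (h := fun x => x ^ 2) u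
      (he.1.differentiable (by simp) (u ^ 2)).hasDerivAt (hasDerivAt_pow 2 u)
    have h2 := h1.congr_of_eventuallyEq (f₁ := Real.cos) (.of_forall fun x => (hcos x).symm)
    have h3 := h2.unique (Real.hasDerivAt_cos u)
    norm_num at h3
    linarith
  refine ⟨fun p => (2 * Real.pi)⁻¹ * multiplierSum H e p,
    fun p => (2 * Real.pi)⁻¹ * multiplierSum (dw H) (fun z => -2 * deriv e z) p,
    contDiff_const.mul (contDiff_multiplierSum h he),
    contDiff_const.mul (contDiff_multiplierSum h.isStripBump_dw hs), fun y w hw => ?_⟩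
  rw [← (hasSum_cosCoeff_sinCoeff h y hw).tsum_eq, tsum_mul_left, mul_left_comm, ← mul_add]
  congr 1
  rw [multiplierSum, multiplierSum, ← tsum_mul_left,
    ← (summable_multiplier h he _).tsum_add ((summable_multiplier h.isStripBump_dw hs _).mul_left _)]
  refine tsum_congr fun n => ?_
  simp only [cosCoeff_dw h, ← mul_pow, hcos, hsin (n * w)]
  ring

end Whitney
end TwoRuled
end

noncomputable section

namespace TwoRuled
open Set MeasureTheory Filter

/-! ### Germs smooth on a whole neighbourhood, and the inverse function theorem for them. -/

section SmoothNear

variable {E F G : Type*} [NormedAddCommGroup E] [NormedSpace ℝ E]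
  [NormedAddCommGroup F] [NormedSpace ℝ F] [NormedAddCommGroup G] [NormedSpace ℝ G]

/-- `f` is `C^∞` on a neighbourhood of `x`. -/
def SmoothNear (f : E → F) (x : E) : Prop := ∀ᶠ y in 𝓝 x, ContDiffAt ℝ ∞ f y

theorem _root_.ContDiff.smoothNear {f : E → F} (h : ContDiff ℝ ∞ f) (x : E) : SmoothNear f x :=
  .of_forall fun _ => h.contDiffAt

theorem _root_.ContDiffOn.smoothNear {f : E → F} {s : Set E} (h : ContDiffOn ℝ ∞ f s)
    (hs : IsOpen s) {x : E} (hx : x ∈ s) : SmoothNear f x := by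
  filter_upwards [hs.mem_nhds hx] with y hy using h.contDiffAt (hs.mem_nhds hy)

namespace SmoothNear

variable {f : E → F} {x : E}

theorem contDiffAt (h : SmoothNear f x) : ContDiffAt ℝ ∞ f x := h.self_of_nhds

theorem continuousAt (h : SmoothNear f x) : ContinuousAt f x := h.contDiffAt.continuousAt

theorem differentiableAt (h : SmoothNear f x) : DifferentiableAt ℝ f x :=
  h.contDiffAt.differentiableAt (by simp)

theorem congr {g : E → F} (h : SmoothNear f x) (hfg : g =ᶠ[𝓝 x] f) : SmoothNear g x := by
  filter_upwards [h, hfg.eventuallyEq_nhds] with y hy hy' using hy.congr_of_eventuallyEq hy'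

theorem comp {g : F → G} (hg : SmoothNear g (f x)) (hf : SmoothNear f x) :
    SmoothNear (fun y => g (f y)) x := by
  filter_upwards [hf, hf.continuousAt.eventually hg] with y h1 h2 using h2.comp y h1

theorem comp_of_eq {g : F → G} {z : F} (hg : SmoothNear g z) (hf : SmoothNear f x) (hz : f x = z) :
    SmoothNear (fun y => g (f y)) x := by
  subst hz; exact hg.comp hf

theorem prodMk {g : E → G} (hf : SmoothNear f x) (hg : SmoothNear g x) :
    SmoothNear (fun y => (f y, g y)) x := by
  filter_upwards [hf, hg] with y h1 h2 using h1.prodMk h2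

theorem add {g : E → F} (hf : SmoothNear f x) (hg : SmoothNear g x) :
    SmoothNear (fun y => f y + g y) x := by
  filter_upwards [hf, hg] with y h1 h2 using h1.add h2

theorem sub {g : E → F} (hf : SmoothNear f x) (hg : SmoothNear g x) :
    SmoothNear (fun y => f y - g y) x := by
  filter_upwards [hf, hg] with y h1 h2 using h1.sub h2

theorem neg (hf : SmoothNear f x) : SmoothNear (fun y => - f y) x := by
  filter_upwards [hf] with y h1 using h1.neg

theorem smul {a : E → ℝ} (ha : SmoothNear a x) (hf : SmoothNear f x) :
    SmoothNear (fun y => a y • f y) x := by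
  filter_upwards [ha, hf] with y h1 h2 using h1.smul h2

theorem mul {a b : E → ℝ} (ha : SmoothNear a x) (hb : SmoothNear b x) :
    SmoothNear (fun y => a y * b y) x := by
  filter_upwards [ha, hb] with y h1 h2 using h1.mul h2

theorem div {a b : E → ℝ} (ha : SmoothNear a x) (hb : SmoothNear b x) (h0 : b x ≠ 0) :
    SmoothNear (fun y => a y / b y) x := by
  filter_upwards [ha, hb, hb.continuousAt.eventually_ne h0] with y h1 h2 h3 using h1.div h2 h3

theorem sqrt {a : E → ℝ} (ha : SmoothNear a x) (h0 : a x ≠ 0) :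
    SmoothNear (fun y => √(a y)) x := by
  filter_upwards [ha, ha.continuousAt.eventually_ne h0] with y h1 h3 using h1.sqrt h3

theorem fderiv (hf : SmoothNear f x) : SmoothNear (_root_.fderiv ℝ f) x := by
  filter_upwards [hf] with y h1 using h1.fderiv_right (by simp)

theorem fderiv_apply (hf : SmoothNear f x) {v : E → E} (hv : SmoothNear v x) :
    SmoothNear (fun y => _root_.fderiv ℝ f y (v y)) x := by
  filter_upwards [hf.fderiv, hv] with y h1 h2 using h1.clm_apply h2

theorem clm_comp (L : F →L[ℝ] G) (hf : SmoothNear f x) : SmoothNear (fun y => L (f y)) x := by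
  filter_upwards [hf] with y h1 using L.contDiff.contDiffAt.comp y h1

theorem deriv {f : ℝ → F} {x : ℝ} (hf : SmoothNear f x) : SmoothNear (_root_.deriv f) x := by
  have := hf.fderiv.clm_comp (ContinuousLinearMap.apply ℝ F (1 : ℝ))
  exact this

/-- Multiplication by a bump function. It lets germs be fed to the results on parameter integrals
and Fourier series, which need globally smooth functions. -/
theorem exists_contDiff [FiniteDimensional ℝ E] (hf : SmoothNear f x) {U : Set E} (hU : U ∈ 𝓝 x) :
    ∃ g : E → F, ContDiff ℝ ∞ g ∧ HasCompactSupport g ∧ tsupport g ⊆ U ∧ g =ᶠ[𝓝 x] f := by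
  obtain ⟨r, hr, hball⟩ := Metric.mem_nhds_iff.1 (inter_mem hU hf)
  let φ : ContDiffBump x := ⟨r / 4, r / 2, by linarith, by linarith⟩
  have hφ : tsupport φ ⊆ Metric.ball x r := by
    rw [φ.tsupport_eq]
    exact Metric.closedBall_subset_ball (by simp only [φ]; linarith)
  have hts : tsupport (fun y => φ y • f y) ⊆ tsupport φ := tsupport_smul_subset_left φ f
  refine ⟨fun y => φ y • f y, contDiff_iff_contDiffAt.2 fun y => ?_,
    φ.hasCompactSupport.smul_right, hts.trans fun y hy => (hball (hφ hy)).1, ?_⟩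
  · by_cases hy : y ∈ tsupport φ
    · exact φ.contDiff.contDiffAt.smul (hball (hφ hy)).2
    · have : (fun y => φ y • f y) =ᶠ[𝓝 y] fun _ => 0 := by
        filter_upwards [(isClosed_tsupport φ).isOpen_compl.mem_nhds hy] with z hz
        rw [image_eq_zero_of_notMem_tsupport hz, zero_smul]
      exact contDiffAt_const.congr_of_eventuallyEq this
  · filter_upwards [φ.eventuallyEq_one] with y hy
    rw [hy]; simp

end SmoothNear

/-- The inverse function theorem for germs. -/
theorem SmoothNear.isLocalDiffeomorphAt [FiniteDimensional ℝ E] {f : E → E} {x : E}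
    (hf : SmoothNear f x) (hker : ∀ v, _root_.fderiv ℝ f x v = 0 → v = 0) :
    IsLocalDiffeomorphAt 𝓘(ℝ, E) 𝓘(ℝ, E) ∞ f x := by
  have hcomplete : CompleteSpace E := FiniteDimensional.complete ℝ E
  have hinj : Function.Injective (_root_.fderiv ℝ f x) :=
    (injective_iff_map_eq_zero (_root_.fderiv ℝ f x)).2 hker
  let L : E ≃L[ℝ] E := (LinearEquiv.ofInjectiveEndo (_root_.fderiv ℝ f x : E →ₗ[ℝ] E) hinj
    ).toContinuousLinearEquiv
  have hL : (L : E →L[ℝ] E) = _root_.fderiv ℝ f x := by ext v; rfl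
  have hx : HasFDerivAt f (L : E →L[ℝ] E) x := hL ▸ hf.differentiableAt.hasFDerivAt
  let e := hf.contDiffAt.toOpenPartialHomeomorph f hx (by simp)
  -- Invertibility of the differential is needed on a neighbourhood, not only at x, for the inverse
  -- to be smooth on its whole domain.
  have hev : ∀ᶠ y in 𝓝 x, ContDiffAt ℝ ∞ f y ∧
      _root_.fderiv ℝ f y ∈ range ((↑) : (E ≃L[ℝ] E) → E →L[ℝ] E) := by
    refine hf.and (hf.fderiv.continuousAt.eventually ?_)
    rw [← hL]; exact L.nhds
  obtain ⟨s, hs, hso, hxs⟩ := mem_nhds_iff.1 hev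
  let e' := e.restrOpen s hso
  have he' : ∀ y ∈ e'.source, y ∈ s := fun y hy => by
    have : y ∈ e.source ∩ s := by simpa [e'] using hy
    exact this.2
  refine ⟨{ toPartialEquiv := e'.toPartialEquiv, open_source := e'.open_source,
            open_target := e'.open_target, contMDiffOn_toFun := ?_, contMDiffOn_invFun := ?_ },
            ?_, fun y _ => rfl⟩
  · exact contMDiffOn_iff_contDiffOn.2 fun y hy => (hs (he' y hy)).1.contDiffWithinAt
  · refine contMDiffOn_iff_contDiffOn.2 fun y hy => ContDiffAt.contDiffWithinAt ?_
    have hy' := he' _ (e'.map_target hy)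
    obtain ⟨L', hL'⟩ := (hs hy').2
    refine e'.contDiffAt_symm (f₀' := L') hy ?_ (hs hy').1
    rw [hL']
    exact ((hs hy').1.differentiableAt (by simp)).hasFDerivAt
  · have : x ∈ e.source ∩ s := ⟨hf.contDiffAt.mem_toOpenPartialHomeomorph_source hx (by simp), hxs⟩
    simpa [e'] using this

section LocalDiffeo

variable {f : E → F} {x : E}

theorem _root_.IsLocalDiffeomorphAt.smoothNear
    (h : IsLocalDiffeomorphAt 𝓘(ℝ, E) 𝓘(ℝ, F) ∞ f x) : SmoothNear f x := by
  obtain ⟨Φ, hx, heq⟩ := h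
  filter_upwards [Φ.open_source.mem_nhds hx] with y hy
  have h1 := contMDiffOn_iff_contDiffOn.1 Φ.contMDiffOn_toFun
  exact (h1.contDiffAt (Φ.open_source.mem_nhds hy)).congr_of_eventuallyEq
    (heq.eventuallyEq_of_mem (Φ.open_source.mem_nhds hy))

/-- A local inverse of a diffeomorphism germ, as a germ. -/
theorem _root_.IsLocalDiffeomorphAt.exists_inverse
    (h : IsLocalDiffeomorphAt 𝓘(ℝ, E) 𝓘(ℝ, F) ∞ f x) :
    ∃ g : F → E, IsLocalDiffeomorphAt 𝓘(ℝ, F) 𝓘(ℝ, E) ∞ g (f x) ∧ g (f x) = x ∧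
      (∀ᶠ y in 𝓝 x, g (f y) = y) ∧ ∀ᶠ z in 𝓝 (f x), f (g z) = z :=
  ⟨h.localInverse, h.localInverse_isLocalDiffeomorphAt,
    h.localInverse_eventuallyEq_left.self_of_nhds, h.localInverse_eventuallyEq_left,
    h.localInverse_eventuallyEq_right⟩

theorem _root_.IsLocalDiffeomorphAt.fderiv_eq_zero
    (h : IsLocalDiffeomorphAt 𝓘(ℝ, E) 𝓘(ℝ, F) ∞ f x) {v : E} (hv : fderiv ℝ f x v = 0) : v = 0 := by
  obtain ⟨g, hg, -, hgf, -⟩ := h.exists_inverse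
  have h1 : HasFDerivAt (fun y => g (f y)) ((fderiv ℝ g (f x)).comp (fderiv ℝ f x)) x :=
    hg.smoothNear.differentiableAt.hasFDerivAt.comp x h.smoothNear.differentiableAt.hasFDerivAt
  have h2 := h1.unique ((hasFDerivAt_id x).congr_of_eventuallyEq hgf)
  have h3 := congrArg (fun L => L v) h2
  simpa [hv] using h3.symm

theorem isLocalDiffeomorphAt_id (x : E) : IsLocalDiffeomorphAt 𝓘(ℝ, E) 𝓘(ℝ, E) ∞ (fun y => y) x :=
  (Diffeomorph.refl 𝓘(ℝ, E) E ∞).isLocalDiffeomorph x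

end LocalDiffeo

end SmoothNear

/-! ### 𝒜-equivalence is an equivalence relation on the germs at hand. -/

section AEquivalent

theorem AEquivalent.congr {f f' g g' : R3 → R4} {p q : R3} (h : AEquivalent f p g q)
    (hf : f' =ᶠ[𝓝 p] f) (hg : g' =ᶠ[𝓝 q] g) : AEquivalent f' p g' q := by
  obtain ⟨φ, Φ, h1, h2, h3, h4, h5⟩ := h
  refine ⟨φ, Φ, h1, h2, by rwa [hf.eq_of_nhds], by rw [hf.eq_of_nhds, hg.eq_of_nhds, h4], ?_⟩
  have hc : Tendsto φ (𝓝 p) (𝓝 q) := h2 ▸ h1.smoothNear.continuousAt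
  filter_upwards [h5, hf, hc.eventually hg] with x e1 e2 e3
  rw [e2, e1, e3]

theorem AEquivalent.trans {f g k : R3 → R4} {p q m : R3} (h : AEquivalent f p g q)
    (h' : AEquivalent g q k m) : AEquivalent f p k m := by
  obtain ⟨φ, Φ, h1, h2, h3, h4, h5⟩ := h
  obtain ⟨φ', Φ', h1', h2', h3', h4', h5'⟩ := h'
  have hc : Tendsto φ (𝓝 p) (𝓝 q) := h2 ▸ h1.smoothNear.continuousAt
  refine ⟨φ' ∘ φ, Φ' ∘ Φ, h1.comp 𝓘(ℝ, R3) R3 (h2 ▸ h1'), by simp [h2, h2'],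
    h3.comp 𝓘(ℝ, R4) R4 (h4 ▸ h3'), by simp [h4, h4'], ?_⟩
  filter_upwards [h5, hc.eventually h5'] with x e1 e2
  simp [e1, e2]

/-- Continuity of f at p is what keeps f(ψ(x)) in the region where the local inverse of Φ undoes Φ.
-/
theorem AEquivalent.symm {f g : R3 → R4} {p q : R3} (h : AEquivalent f p g q)
    (hf : ContinuousAt f p) : AEquivalent g q f p := by
  obtain ⟨φ, Φ, h1, h2, h3, h4, h5⟩ := h
  obtain ⟨ψ, k1, k2, k3, k4⟩ := h1.exists_inverse
  obtain ⟨Ψ, l1, l2, l3, l4⟩ := h3.exists_inverse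
  rw [h2] at k1 k2 k4
  rw [h4] at l1 l2 l4
  have hc : Tendsto ψ (𝓝 q) (𝓝 p) := by
    have := k1.smoothNear.continuousAt
    rwa [ContinuousAt, k2] at this
  refine ⟨ψ, Ψ, k1, k2, l1, l2, ?_⟩
  filter_upwards [hc.eventually h5, k4, hc.eventually (hf.eventually l3)] with x e1 e2 e3
  rw [← e3, e1, e2]

theorem aequivalent_comp_left {f : R3 → R4} {p : R3} {Φ : R4 → R4}
    (hΦ : IsLocalDiffeomorphAt 𝓘(ℝ, R4) 𝓘(ℝ, R4) ∞ Φ (f p)) :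
    AEquivalent f p (fun x => Φ (f x)) p :=
  ⟨fun x => x, Φ, isLocalDiffeomorphAt_id p, rfl, hΦ, rfl, .of_forall fun _ => rfl⟩

theorem aequivalent_comp_right {f : R3 → R4} {p : R3} {φ : R3 → R3}
    (hφ : IsLocalDiffeomorphAt 𝓘(ℝ, R3) 𝓘(ℝ, R3) ∞ φ p) :
    AEquivalent (fun x => f (φ x)) p f (φ p) :=
  ⟨φ, fun x => x, hφ, rfl, isLocalDiffeomorphAt_id _, rfl, .of_forall fun _ => rfl⟩

end AEquivalent
end TwoRuled
end

noncomputable section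

namespace TwoRuled
open Set MeasureTheory Filter

/-! ### Families of folds and a companion function with proportional differential. -/

section Fold

variable {E : Type*} [NormedAddCommGroup E] [NormedSpace ℝ E]

theorem integral_zero_eq_mul_integral (f : ℝ → ℝ) (v : ℝ) :
    ∫ u in (0 : ℝ)..v, f u = v * ∫ σ in (0 : ℝ)..1, f (v * σ) := by
  rw [intervalIntegral.mul_integral_comp_mul_left]; simp

theorem hasDerivAt_snd_of_differentiableAt {F : Type*} [NormedAddCommGroup F] [NormedSpace ℝ F]
    {f : E × ℝ → F} {y : E} {w : ℝ}
    (h : DifferentiableAt ℝ f (y, w)) : HasDerivAt (fun u => f (y, u)) (dw f (y, w)) w := by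
  have h2 : HasDerivAt (fun u : ℝ => (y, u)) ((0 : E), (1 : ℝ)) w :=
    (hasDerivAt_const w y).prodMk (hasDerivAt_id w)
  exact h.hasFDerivAt.comp_hasDerivAt w h2

theorem SmoothNear.dw {F : Type*} [NormedAddCommGroup F] [NormedSpace ℝ F] {f : E × ℝ → F}
    {p : E × ℝ} (h : SmoothNear f p) : SmoothNear (TwoRuled.dw f) p :=
  h.fderiv.clm_comp (ContinuousLinearMap.apply ℝ F ((0 : E), (1 : ℝ)))

variable [FiniteDimensional ℝ E]

/-- The remainder `∫₀¹ σ Λ(e, σ v) dσ`. -/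
def foldFactor (Λ : E × ℝ → ℝ) (p : E × ℝ) : ℝ := ∫ σ in (0 : ℝ)..1, σ * Λ (p.1, σ * p.2)

theorem contDiff_foldFactor {Λ : E × ℝ → ℝ} (h : ContDiff ℝ ∞ Λ) : ContDiff ℝ ∞ (foldFactor Λ) := by
  have : ContDiff ℝ ∞ fun q : (E × ℝ) × ℝ => q.2 * Λ (q.1.1, q.2 * q.1.2) :=
    contDiff_snd.mul (h.comp (by fun_prop))
  exact contDiff_intervalIntegral this 0 1

omit [NormedAddCommGroup E] [NormedSpace ℝ E] [FiniteDimensional ℝ E] in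
theorem integral_mul_eq_sq_mul_foldFactor (Λ : E × ℝ → ℝ) (e : E) (v : ℝ) :
    ∫ u in (0 : ℝ)..v, u * Λ (e, u) = v ^ 2 * foldFactor Λ (e, v) := by
  rw [integral_zero_eq_mul_integral, foldFactor, pow_two, mul_assoc,
    ← intervalIntegral.integral_const_mul v (fun σ => σ * Λ ((e, v).1, σ * (e, v).2))]
  congr 1
  refine intervalIntegral.integral_congr fun σ _ => ?_
  simp only [mul_assoc, mul_comm σ v]

omit [NormedAddCommGroup E] [NormedSpace ℝ E] [FiniteDimensional ℝ E] in
theorem foldFactor_zero (Λ : E × ℝ → ℝ) (e : E) : foldFactor Λ (e, 0) = Λ (e, 0) / 2 := by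
  simp [foldFactor, div_eq_inv_mul]

/-- The third-order remainder `∫₀¹ σ² Q(e, σ² ζ) dσ`. -/
def cubicFactor (Q : E × ℝ → ℝ) (p : E × ℝ) : ℝ := ∫ σ in (0 : ℝ)..1, σ ^ 2 * Q (p.1, σ ^ 2 * p.2)

/-- The second-order remainder `∫₀¹ σ P(e, σ² ζ) dσ`. -/
def quadraticFactor (P : E × ℝ → ℝ) (p : E × ℝ) : ℝ := ∫ σ in (0 : ℝ)..1, σ * P (p.1, σ ^ 2 * p.2)

theorem contDiff_cubicFactor {Q : E × ℝ → ℝ} (h : ContDiff ℝ ∞ Q) :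
    ContDiff ℝ ∞ (cubicFactor Q) := by
  have : ContDiff ℝ ∞ fun q : (E × ℝ) × ℝ => q.2 ^ 2 * Q (q.1.1, q.2 ^ 2 * q.1.2) :=
    (contDiff_snd.pow 2).mul (h.comp (by fun_prop))
  exact contDiff_intervalIntegral this 0 1

theorem contDiff_quadraticFactor {P : E × ℝ → ℝ} (h : ContDiff ℝ ∞ P) :
    ContDiff ℝ ∞ (quadraticFactor P) := by
  have : ContDiff ℝ ∞ fun q : (E × ℝ) × ℝ => q.2 * P (q.1.1, q.2 ^ 2 * q.1.2) :=
    contDiff_snd.mul (h.comp (by fun_prop))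
  exact contDiff_intervalIntegral this 0 1

omit [NormedAddCommGroup E] [NormedSpace ℝ E] [FiniteDimensional ℝ E] in
theorem cubicFactor_zero (Q : E × ℝ → ℝ) (e : E) : cubicFactor Q (e, 0) = Q (e, 0) / 3 := by
  simp [cubicFactor, integral_pow]
  ring

omit [NormedSpace ℝ E] [FiniteDimensional ℝ E] in
theorem integral_mul_even_add_odd {P Q : E × ℝ → ℝ} (hP : Continuous P) (hQ : Continuous Q) (e : E)
    (w : ℝ) : ∫ u in (0 : ℝ)..w, u * (P (e, u ^ 2) + u * Q (e, u ^ 2)) =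
      w ^ 2 * quadraticFactor P (e, w ^ 2) + w ^ 3 * cubicFactor Q (e, w ^ 2) := by
  rw [integral_zero_eq_mul_integral, quadraticFactor, cubicFactor, ←
    intervalIntegral.integral_const_mul (w ^ 2), ← intervalIntegral.integral_const_mul (w ^ 3),
    ← intervalIntegral.integral_add, ← intervalIntegral.integral_const_mul]
  · congr 1 with σ
    rw [mul_pow, mul_comm (w ^ 2)]
    ring
  · exact Continuous.intervalIntegrable (by fun_prop) _ _
  · exact Continuous.intervalIntegrable (by fun_prop) _ _

/-- Normal form of a family of fold germs, together with a function whose differential along the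
family is a multiple `μ` of that of the fold. -/
theorem exists_fold_normal_form {Λ μ : E × ℝ → ℝ} (hΛ : ContDiff ℝ ∞ Λ) (hμ : ContDiff ℝ ∞ μ)
    {e₀ : E} (h0 : Λ (e₀, 0) ≠ 0) :
    ∃ (ε : ℝ) (θ P Q : E × ℝ → ℝ) (a : ℝ) (c : E → ℝ), ε ≠ 0 ∧ a ≠ 0 ∧
      SmoothNear θ (e₀, 0) ∧ θ (e₀, 0) = 0 ∧
      HasFDerivAt θ (a • ContinuousLinearMap.snd ℝ E ℝ) (e₀, 0) ∧
      ContDiff ℝ ∞ P ∧ ContDiff ℝ ∞ Q ∧ DifferentiableAt ℝ c e₀ ∧ c e₀ ≠ 0 ∧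
      (∀ᶠ e in 𝓝 e₀, Q (e, 0) = dw μ (e, 0) * c e) ∧
      (∀ᶠ p in 𝓝 (e₀, 0), ∫ u in (0 : ℝ)..p.2, u * Λ (p.1, u) = ε * θ p ^ 2) ∧
      ∀ᶠ p in 𝓝 (e₀, 0), ∫ u in (0 : ℝ)..p.2, u * Λ (p.1, u) * μ (p.1, u) =
        2 * ε * (θ p ^ 2 * P (p.1, θ p ^ 2) + θ p ^ 3 * Q (p.1, θ p ^ 2)) := by
  set b : E × ℝ := (e₀, 0) with hb
  set q := foldFactor Λ with hq
  have hqs : ContDiff ℝ ∞ q := contDiff_foldFactor hΛ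
  -- ε is the sign of the fold, that is, of q(b) = Λ(e₀, 0) / 2.
  obtain ⟨ε, hε2, hεq⟩ : ∃ ε : ℝ, ε * ε = 1 ∧ 0 < ε * q b := by
    have hqb : q b ≠ 0 := by rw [hq, hb, foldFactor_zero]; exact div_ne_zero h0 two_ne_zero
    rcases lt_or_gt_of_ne hqb with h | h
    · exact ⟨-1, by norm_num, by linarith⟩
    · exact ⟨1, by norm_num, by linarith⟩
  have hε : ε ≠ 0 := fun h => by simp [h] at hε2
  set s : E × ℝ → ℝ := fun p => √(ε * q p) with hs
  have hss : SmoothNear s b := ((contDiff_const.mul hqs).smoothNear b).sqrt hεq.ne'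
  have hsb : s b ≠ 0 := (Real.sqrt_pos.2 hεq).ne'
  -- The integral of uΛ from 0 to v is v²q, so v√(εq) is a square root of it up to the sign ε.
  set θ : E × ℝ → ℝ := fun p => p.2 * s p with hθ
  have hθs : SmoothNear θ b := (contDiff_snd.smoothNear b).mul hss
  have hθd : HasFDerivAt θ (s b • ContinuousLinearMap.snd ℝ E ℝ) b := by
    refine (hasFDerivAt_snd.mul hss.differentiableAt.hasFDerivAt).congr_fderiv ?_
    simp [hb]
  have hsq : ∀ p, 0 < ε * q p → p.2 ^ 2 * q p = ε * θ p ^ 2 := fun p hp => by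
    simp only [hθ, hs, mul_pow, Real.sq_sqrt hp.le]
    linear_combination (- (p.2 ^ 2 * q p)) * hε2
  have hΘs : SmoothNear (fun p : E × ℝ => (p.1, θ p)) b := (contDiff_fst.smoothNear b).prodMk hθs
  have hΘd := (hasFDerivAt_fst (𝕜 := ℝ) (E := E) (F := ℝ) (p := b)).prodMk hθd
  have hΘ := hΘs.isLocalDiffeomorphAt (fun v hv => by
    rw [hΘd.fderiv] at hv
    have h1 : v.1 = 0 := by simpa using congrArg Prod.fst hv
    have h2 : v.2 = 0 := by simpa [hsb] using congrArg Prod.snd hv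
    exact Prod.ext h1 h2)
  have hΘb : ((b.1, θ b) : E × ℝ) = b := by simp [hθ, hb]
  obtain ⟨ψ, hψ, hψb, hleft, hright⟩ := hΘ.exists_inverse
  rw [hΘb] at hψ hψb hright
  have hψs := hψ.smoothNear
  set V : E × ℝ → ℝ := fun p => (ψ p).2 with hV
  have hVs : SmoothNear V b := hψs.clm_comp (ContinuousLinearMap.snd ℝ E ℝ)
  have hμψ : SmoothNear (fun p => μ (ψ p)) b := (hμ.smoothNear _).comp hψs
  have hstrip : {p : E × ℝ | p.2 ∈ Ioo (-Real.pi) Real.pi} ∈ 𝓝 b :=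
    continuous_snd.continuousAt.preimage_mem_nhds
      (Ioo_mem_nhds (by simpa [hb] using Real.pi_pos) (by simpa [hb] using Real.pi_pos))
  -- m is μ in the fold coordinate w, cut off to the strip where the even–odd splitting is
  -- available.
  obtain ⟨m, hm, hmc, hmt, hmeq⟩ := hμψ.exists_contDiff hstrip
  obtain ⟨P, Q, hP, hQ, hPQ⟩ := (IsStripBump.mk hm hmc hmt).exists_even_odd
  have hqc : ∀ᶠ z in 𝓝 b, 0 < ε * q (ψ z) := by
    refine hψs.continuousAt.eventually (p := fun z => 0 < ε * q z) ?_
    rw [hψb]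
    exact (continuousAt_const.mul hqs.continuous.continuousAt).eventually (lt_mem_nhds hεq)
  obtain ⟨r, hr, hball⟩ := Metric.eventually_nhds_iff_ball.1
    (hright.and (hqc.and (hVs.and (hmeq.and hstrip))))
  have hmem : ∀ {e : E} {u : ℝ}, (e, u) ∈ Metric.ball b r ↔ dist e e₀ < r ∧ |u| < r := by
    intro e u
    simp [hb, Prod.dist_eq]
  have hfst : ∀ z ∈ Metric.ball b r, ψ z = (z.1, V z) := fun z hz =>
    by
    have h := congrArg Prod.fst (hball z hz).1
    exact Prod.ext h rfl
  have hVsq : ∀ z ∈ Metric.ball b r, V z * s (ψ z) = z.2 := fun z hz =>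
    congrArg Prod.snd (hball z hz).1
  have hV0 : ∀ e, dist e e₀ < r → V (e, 0) = 0 := fun e he => by
    have hz := hmem.2 ⟨he, (by simpa using hr : |(0 : ℝ)| < r)⟩
    have := hVsq _ hz
    have hs0 : s (ψ (e, 0)) ≠ 0 := (Real.sqrt_pos.2 (hball _ hz).2.1).ne'
    simpa [hs0] using this
  have hVd : ∀ z ∈ Metric.ball b r, HasDerivAt (fun u => V (z.1, u)) (dw V z) z.2 := fun z hz =>
    hasDerivAt_snd_of_differentiableAt ((hball z hz).2.2.1.differentiableAt (by simp))
  have hint : ∀ z ∈ Metric.ball b r, ∫ u in (0 : ℝ)..V z, u * Λ (z.1, u) = ε * z.2 ^ 2 :=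
    fun z hz => by
      rw [integral_mul_eq_sq_mul_foldFactor, ← hVsq z hz]
      have := hsq (ψ z) (hball z hz).2.1
      simp only [hθ] at this
      rw [← hfst z hz]
      exact this
  -- Differentiation of the identity between the fold integral up to V and εw². This turns the
  -- substitution u = V(e, w) in the second integral into integration of 2εw·m.
  have hrel : ∀ z ∈ Metric.ball b r, V z * Λ (z.1, V z) * dw V z = 2 * ε * z.2 := fun z hz => by
    have hc : Continuous fun u => u * Λ (z.1, u) :=
      continuous_id.mul (hΛ.continuous.comp (by fun_prop))
    have h1 : HasDerivAt (fun t => ∫ u in (0 : ℝ)..t, u * Λ (z.1, u)) (V z * Λ (z.1, V z)) (V z) :=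
      intervalIntegral.integral_hasDerivAt_right (hc.intervalIntegrable _ _)
        (hc.stronglyMeasurableAtFilter _ _) hc.continuousAt
    have h2 := HasDerivAt.comp (h := fun u => V (z.1, u)) z.2 h1 (hVd z hz)
    have h3 : HasDerivAt (fun u : ℝ => ε * u ^ 2) (ε * (2 * z.2)) z.2 := by
      simpa using (hasDerivAt_pow 2 z.2).const_mul ε
    have h4 : (fun u : ℝ => ε * u ^ 2) =ᶠ[𝓝 z.2]
        ((fun t => ∫ u in (0 : ℝ)..t, u * Λ (z.1, u)) ∘ fun u => V (z.1, u)) := by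
      have : Tendsto (fun u : ℝ => (z.1, u)) (𝓝 z.2) (𝓝 z) :=
        Continuous.tendsto (by fun_prop) z.2
      filter_upwards [this.eventually (Metric.isOpen_ball.mem_nhds hz)] with u hu
      exact (hint (z.1, u) hu).symm
    have h5 := h2.unique (h3.congr_of_eventuallyEq h4.symm)
    linarith
  have hint2 : ∀ z ∈ Metric.ball b r, ∫ u in (0 : ℝ)..V z, u * Λ (z.1, u) * μ (z.1, u) =
      2 * ε * (z.2 ^ 2 * quadraticFactor P (z.1, z.2 ^ 2) +
        z.2 ^ 3 * cubicFactor Q (z.1, z.2 ^ 2)) := fun z hz => by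
    have hz' := hmem.1 hz
    have hseg : ∀ u ∈ uIcc 0 z.2, (z.1, u) ∈ Metric.ball b r := fun u hu => by
      refine hmem.2 ⟨hz'.1, lt_of_le_of_lt ?_ hz'.2⟩
      have := abs_sub_left_of_mem_uIcc hu
      simpa using this
    have hc : Continuous fun u => u * Λ (z.1, u) * μ (z.1, u) :=
      (continuous_id.mul (hΛ.continuous.comp (by fun_prop))).mul (hμ.continuous.comp (by fun_prop))
    have hcd : ContinuousOn (fun u => dw V (z.1, u)) (uIcc 0 z.2) := fun u hu => by
      have h1 : ContDiffAt ℝ ∞ V (z.1, u) := (hball _ (hseg u hu)).2.2.1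
      have h2 : ContinuousAt (fderiv ℝ V) (z.1, u) :=
        (h1.fderiv_right (m := ∞) (by simp)).continuousAt
      have h3 : ContinuousAt (fun u : ℝ => (z.1, u)) u := by fun_prop
      have h4 : ContinuousAt (fun u => fderiv ℝ V (z.1, u)) u :=
        ContinuousAt.comp (f := fun u : ℝ => (z.1, u)) h2 h3
      exact (h4.clm_apply continuousAt_const).continuousWithinAt
    have h1 := intervalIntegral.integral_comp_mul_deriv (f := fun u => V (z.1, u))
      (f' := fun u => dw V (z.1, u)) (a := 0) (b := z.2) (fun u hu => hVd _ (hseg u hu)) hcd hc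
    have h2 : ∫ u in (0 : ℝ)..z.2, ((fun u => u * Λ (z.1, u) * μ (z.1, u)) ∘ fun u => V (z.1, u)) u *
        dw V (z.1, u) = ∫ u in (0 : ℝ)..z.2, 2 * ε * (u * (P (z.1, u ^ 2) + u * Q (z.1, u ^ 2))) := by
      refine intervalIntegral.integral_congr fun u hu => ?_
      have hu' := hseg u hu
      have e1 := hrel _ hu'
      have e2 := (hball _ hu').2.2.2.1
      have e3 := hPQ z.1 u (hball _ hu').2.2.2.2
      simp only [hfst _ hu'] at e1 e2
      simp only [Function.comp_apply]
      rw [← e3, e2]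
      linear_combination (μ (z.1, V (z.1, u))) * e1
    rw [hV0 _ hz'.1] at h1
    rw [← integral_mul_even_add_odd hP.continuous hQ.continuous,
      ← intervalIntegral.integral_const_mul, ← h2, h1]
  -- Q(e, 0) is the w-derivative at 0 of P(e, w²) + wQ(e, w²), computed a second time by the chain
  -- rule through V.
  have hQ0 : ∀ e, dist e e₀ < r → Q (e, 0) = dw μ (e, 0) * dw V (e, 0) := fun e he => by
    have hz := hmem.2 ⟨he, (by simpa using hr : |(0 : ℝ)| < r)⟩
    have h1 : HasDerivAt (fun u => μ (e, u)) (dw μ (e, 0)) (V (e, 0)) := by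
      rw [hV0 e he]
      exact hasDerivAt_snd_of_differentiableAt (hμ.differentiable (by simp) _)
    have h2 := HasDerivAt.comp (h := fun u => V (e, u)) 0 h1 (hVd _ hz)
    have hPd : DifferentiableAt ℝ (fun u : ℝ => P (e, u)) ((0 : ℝ) ^ 2) :=
      (hP.differentiable (by simp)).differentiableAt.comp _ (by fun_prop)
    have hQd : DifferentiableAt ℝ (fun u : ℝ => Q (e, u)) ((0 : ℝ) ^ 2) :=
      (hQ.differentiable (by simp)).differentiableAt.comp _ (by fun_prop)
    have hsq0 : HasDerivAt (fun u : ℝ => u ^ 2) 0 0 := by simpa using hasDerivAt_pow 2 (0 : ℝ)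
    have h3 := (HasDerivAt.comp (h := fun u : ℝ => u ^ 2) (0 : ℝ) hPd.hasDerivAt hsq0).add
      ((hasDerivAt_id (0 : ℝ)).mul
        (HasDerivAt.comp (h := fun u : ℝ => u ^ 2) (0 : ℝ) hQd.hasDerivAt hsq0))
    have ht : Tendsto (fun u : ℝ => (e, u)) (𝓝 0) (𝓝 (e, 0)) := Continuous.tendsto (by fun_prop) 0
    have h4 := h2.congr_of_eventuallyEq (f₁ := fun u => P (e, u ^ 2) + u * Q (e, u ^ 2)) (by
      filter_upwards [ht.eventually (Metric.isOpen_ball.mem_nhds hz)] with u hu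
      have e2 := (hball _ hu).2.2.2.1
      simp only [hfst _ hu] at e2
      rw [← hPQ e u (hball _ hu).2.2.2.2, e2]
      rfl)
    have h5 := h3.unique h4
    simpa using h5
  -- Since V·(s ∘ ψ) = w and V vanishes at w = 0, a zero derivative of V would make the derivative
  -- of w zero.
  have hdV : dw V b ≠ 0 := fun h => by
    have hz : b ∈ Metric.ball b r := Metric.mem_ball_self hr
    have h1 : HasDerivAt (fun u => V (e₀, u)) 0 0 := by
      have := hVd b hz
      rwa [h] at this
    have h2 : DifferentiableAt ℝ (fun u : ℝ => s (ψ (e₀, u))) 0 := by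
      have : SmoothNear (fun p => s (ψ p)) b := hss.comp_of_eq hψs hψb
      exact this.differentiableAt.comp (0 : ℝ) (f := fun u : ℝ => (e₀, u)) (by fun_prop)
    have h3 := h1.mul h2.hasDerivAt
    have ht : Tendsto (fun u : ℝ => (e₀, u)) (𝓝 0) (𝓝 b) := Continuous.tendsto (by fun_prop) 0
    have h4 := h3.unique ((hasDerivAt_id (0 : ℝ)).congr_of_eventuallyEq (by
      filter_upwards [ht.eventually (Metric.isOpen_ball.mem_nhds hz)] with u hu
      exact hVsq _ hu))
    have h5 : V (e₀, 0) = 0 := hV0 e₀ (by simpa using hr)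
    simp [h5] at h4
  -- The 3 is the integral of σ² over [0, 1], inverted, from `cubicFactor_zero`.
  refine ⟨ε, θ, quadraticFactor P, cubicFactor Q, s b, fun e => dw V (e, 0) / 3, hε, hsb, hθs,
    by simp [hθ, hb], hθd, contDiff_quadraticFactor hP, contDiff_cubicFactor hQ, ?_, ?_, ?_, ?_, ?_⟩
  · have : DifferentiableAt ℝ (fun e => dw V (e, 0)) e₀ :=
      (SmoothNear.dw hVs).differentiableAt.comp e₀ (f := fun e : E => (e, (0 : ℝ))) (by fun_prop)
    simpa only [div_eq_mul_inv] using this.mul_const (3 : ℝ)⁻¹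
  · exact div_ne_zero hdV three_ne_zero
  · filter_upwards [Metric.ball_mem_nhds e₀ hr] with e he
    rw [cubicFactor_zero, hQ0 e he]
    ring
  · have : ∀ᶠ p in 𝓝 b, 0 < ε * q p :=
      (continuousAt_const.mul hqs.continuous.continuousAt).eventually (lt_mem_nhds hεq)
    filter_upwards [this] with p hp
    rw [integral_mul_eq_sq_mul_foldFactor]
    exact hsq p hp
  · have ht : Tendsto (fun p : E × ℝ => (p.1, θ p)) (𝓝 b) (𝓝 b) := by
      have := hΘs.continuousAt
      rwa [ContinuousAt, hΘb] at this
    filter_upwards [ht.eventually (Metric.ball_mem_nhds b hr), hleft] with p hp hp'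
    have h1 := hint2 _ hp
    have h2 : V (p.1, θ p) = p.2 := congrArg Prod.snd hp'
    rw [h2] at h1
    exact h1

end Fold
end TwoRuled
end

noncomputable section

namespace TwoRuled
open Set MeasureTheory Filter

/-! ### Reduction of fold families to the cuspidal cross cap × interval. -/

section NormalForm

theorem hasDerivAt_zero_of_fderiv_eq_zero {E F : Type*} [NormedAddCommGroup E] [NormedSpace ℝ E]
    [NormedAddCommGroup F] [NormedSpace ℝ F] {f : E → F} {p v : E} (hf : DifferentiableAt ℝ f p)
    (h : fderiv ℝ f p v = 0) : HasDerivAt (fun t : ℝ => f (p + t • v)) 0 0 := by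
  have := hf.hasFDerivAt.hasLineDerivAt v
  rwa [h] at this

theorem smoothNear_vec4 {E : Type*} [NormedAddCommGroup E] [NormedSpace ℝ E] {a b c d : E → ℝ}
    {p : E} (ha : SmoothNear a p) (hb : SmoothNear b p) (hc : SmoothNear c p)
    (hd : SmoothNear d p) : SmoothNear (fun x => (!₂[a x, b x, c x, d x] : R4)) p := by
  filter_upwards [ha, hb, hc, hd] with x h1 h2 h3 h4
  refine contDiffAt_euclidean.2 fun i => ?_
  fin_cases i <;> assumption

theorem hasDerivAt_coord {f : ℝ → R4} {f' : R4} {t : ℝ} (h : HasDerivAt f f' t) (i : Fin 4) :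
    HasDerivAt (fun t => f t i) (f' i) t :=
  (EuclideanSpace.proj (𝕜 := ℝ) i).hasFDerivAt.comp_hasDerivAt t h

/-- The normal form of the cuspidal cross cap `×` interval. -/
def crossCapInterval (x : R3) : R4 := !₂[x.1, x.2.1, x.2.2 ^ 2, x.2.1 * x.2.2 ^ 3]

/-- A map with cubic part `w³ K(e, w²)` is a cuspidal cross cap `×` interval when `K` vanishes at
the base point and has nonzero derivative along the first coordinate. -/
theorem aequivalent_of_cubic {K : (ℝ × ℝ) × ℝ → ℝ} (hK : ContDiff ℝ ∞ K) (e₀ : ℝ × ℝ)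
    (h0 : K (e₀, 0) = 0) (h1 : fderiv ℝ (fun e => K (e, 0)) e₀ (1, 0) ≠ 0) :
    AEquivalent (fun x => !₂[x.1, x.2.1, x.2.2 ^ 2, x.2.2 ^ 3 * K ((x.1, x.2.1), x.2.2 ^ 2)])
      (e₀.1, e₀.2, 0) crossCapInterval 0 := by
  set f : R3 → R4 :=
    fun x => !₂[x.1, x.2.1, x.2.2 ^ 2, x.2.2 ^ 3 * K ((x.1, x.2.1), x.2.2 ^ 2)] with hf
  set p : R3 := (e₀.1, e₀.2, 0) with hp
  have hadd : ∀ x y : ℝ, e₀ + (x, y) = (e₀.1 + x, e₀.2 + y) := fun _ _ => rfl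
  have hfp : f p = !₂[e₀.1, e₀.2, 0, 0] := by simp [hf, hp]
  have hKline : ∀ u : ℝ, HasDerivAt (fun t : ℝ => K (e₀ + t • (u, 0), 0))
      (u * fderiv ℝ (fun e => K (e, 0)) e₀ (1, 0)) 0 := fun u => by
    have hd : DifferentiableAt ℝ (fun e => K (e, 0)) e₀ :=
      (hK.differentiable (by simp)).differentiableAt.comp e₀ (f := fun e : ℝ × ℝ => (e, (0 : ℝ)))
        (by fun_prop)
    have h2 := hd.hasFDerivAt.hasLineDerivAt (u, (0 : ℝ))
    have h3 : ((u, 0) : ℝ × ℝ) = u • (1, 0) := by simp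
    rw [h3, map_smul, smul_eq_mul, ← h3] at h2
    exact h2
  -- K depends on w only through w², which is itself a target coordinate. The same change of
  -- variables, with K as second coordinate, is thus available in target and source, and the two
  -- intertwine the maps.
  set N : R4 → R4 := fun y => !₂[y 1 - e₀.2, K ((y 0, y 1), y 2), y 2, y 3] with hN
  set n : R3 → R3 := fun x => (x.2.1 - e₀.2, K ((x.1, x.2.1), x.2.2 ^ 2), x.2.2) with hn
  have hNs : SmoothNear N (f p) := by
    have hc : ∀ i : Fin 4, ContDiff ℝ ∞ fun y : R4 => y i := fun i =>
      (EuclideanSpace.proj (𝕜 := ℝ) i).contDiff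
    exact smoothNear_vec4 (((hc 1).sub contDiff_const).smoothNear _)
      ((hK.comp (((hc 0).prodMk (hc 1)).prodMk (hc 2))).smoothNear _)
      ((hc 2).smoothNear _) ((hc 3).smoothNear _)
  have hns : SmoothNear n p := by
    refine ContDiff.smoothNear ?_ p
    refine ContDiff.prodMk (by fun_prop) (ContDiff.prodMk (hK.comp (by fun_prop)) (by fun_prop))
  have hNd : IsLocalDiffeomorphAt 𝓘(ℝ, R4) 𝓘(ℝ, R4) ∞ N (f p) := by
    refine hNs.isLocalDiffeomorphAt fun v hv => ?_
    have hl := hasDerivAt_zero_of_fderiv_eq_zero hNs.differentiableAt hv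
    have hlin : ∀ a b : ℝ, HasDerivAt (fun t : ℝ => a + t * b) b 0 := fun a b => by
      simpa using ((hasDerivAt_id (0 : ℝ)).mul_const b).const_add a
    have e1 : v 1 = 0 := by
      have h := hasDerivAt_coord hl 0
      simp only [hN, hfp] at h
      refine ((hlin 0 (v 1)).unique (h.congr_of_eventuallyEq (.of_forall fun t => ?_)))
      simp
    have e2 : v 2 = 0 := by
      have h := hasDerivAt_coord hl 2
      simp only [hN, hfp] at h
      refine ((hlin 0 (v 2)).unique (h.congr_of_eventuallyEq (.of_forall fun t => ?_)))
      simp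
    have e3 : v 3 = 0 := by
      have h := hasDerivAt_coord hl 3
      simp only [hN, hfp] at h
      refine ((hlin 0 (v 3)).unique (h.congr_of_eventuallyEq (.of_forall fun t => ?_)))
      simp
    -- With the other components already zero, the K-component of the differential is ∂K/∂e₁ times v
    -- 0.
    have e0 : v 0 = 0 := by
      have h := hasDerivAt_coord hl 1
      simp only [hN, hfp] at h
      have h2 := (hKline (v 0)).unique (h.congr_of_eventuallyEq (.of_forall fun t => by
        simp [e1, e2, hadd]))
      simpa [h1] using h2
    ext i
    fin_cases i <;> simp [e0, e1, e2, e3]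
  have hnd : IsLocalDiffeomorphAt 𝓘(ℝ, R3) 𝓘(ℝ, R3) ∞ n p := by
    refine hns.isLocalDiffeomorphAt fun v hv => ?_
    have hl := hasDerivAt_zero_of_fderiv_eq_zero hns.differentiableAt hv
    have hlin : ∀ a b : ℝ, HasDerivAt (fun t : ℝ => a + t * b) b 0 := fun a b => by
      simpa using ((hasDerivAt_id (0 : ℝ)).mul_const b).const_add a
    have e1 : v.2.1 = 0 := by
      have h := hl.fst
      refine ((hlin 0 v.2.1).unique (h.congr_of_eventuallyEq (.of_forall fun t => ?_)))
      simp [hn, hp]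
    have e2 : v.2.2 = 0 := by
      have h := hl.snd.snd
      refine ((hlin 0 v.2.2).unique (h.congr_of_eventuallyEq (.of_forall fun t => ?_)))
      simp [hn, hp]
    have e0 : v.1 = 0 := by
      have h : HasDerivAt (fun t : ℝ => (n (p + t • v)).2.1) 0 0 := hl.snd.fst
      have h2 := (hKline v.1).unique (h.congr_of_eventuallyEq (.of_forall fun t => by
        simp [hn, hp, e1, e2, hadd]))
      simpa [h1] using h2
    exact Prod.ext e0 (Prod.ext e1 e2)
  have hnp : n p = 0 := by
    have : K ((e₀.1, e₀.2), 0) = 0 := h0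
    simp [hn, hp, this]
  have hNf : (fun x => N (f x)) = fun x => crossCapInterval (n x) := by
    funext x
    simp only [hN, hf, hn, crossCapInterval]
    ext i
    fin_cases i <;> simp [mul_comm]
  have step1 := aequivalent_comp_left (f := f) (p := p) hNd
  have step2 := aequivalent_comp_right (f := crossCapInterval) hnd
  rw [hNf] at step1
  rw [hnp] at step2
  exact step1.trans step2

/-- A family of folds `Z` in the parameter `e`, with a further component `H` satisfying
`∂H = μ ∂Z`, is a cuspidal cross cap `×` interval as soon as `∂μ` vanishes to first order
at the base point. -/
theorem aequivalent_of_fold {ξ : ℝ × ℝ → ℝ × ℝ} {Z₀ H₀ : ℝ × ℝ → ℝ} {Λ μ : (ℝ × ℝ) × ℝ → ℝ}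
    {e₀ : ℝ × ℝ} (hξ : ContDiff ℝ ∞ ξ) (hZ₀ : ContDiff ℝ ∞ Z₀) (hH₀ : ContDiff ℝ ∞ H₀)
    (hΛ : ContDiff ℝ ∞ Λ) (hμ : ContDiff ℝ ∞ μ) (hξd : ∀ v, fderiv ℝ ξ e₀ v = 0 → v = 0)
    (h0 : Λ (e₀, 0) ≠ 0) (hμ0 : dw μ (e₀, 0) = 0)
    (hμ1 : fderiv ℝ (fun e => dw μ (e, 0)) e₀ (1, 0) ≠ 0) :
    AEquivalent (fun x => !₂[(ξ (x.1, x.2.1)).1, (ξ (x.1, x.2.1)).2,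
        Z₀ (x.1, x.2.1) + ∫ u in (0 : ℝ)..x.2.2, u * Λ ((x.1, x.2.1), u),
        H₀ (x.1, x.2.1) + ∫ u in (0 : ℝ)..x.2.2, u * Λ ((x.1, x.2.1), u) * μ ((x.1, x.2.1), u)])
      (e₀.1, e₀.2, 0) crossCapInterval 0 := by
  obtain ⟨ε, θ, P, Q, a, c, hε, ha, hθs, hθ0, hθd, hP, hQ, hc, hc0, hQc, hZ, hH⟩ :=
    exists_fold_normal_form hΛ hμ h0
  set p : R3 := (e₀.1, e₀.2, 0) with hp
  set f : R3 → R4 :=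
    fun x => !₂[x.1, x.2.1, x.2.2 ^ 2, x.2.2 ^ 3 * Q ((x.1, x.2.1), x.2.2 ^ 2)] with hf
  have hadd : ∀ x y : ℝ, e₀ + (x, y) = (e₀.1 + x, e₀.2 + y) := fun _ _ => rfl
  have hfp : f p = !₂[e₀.1, e₀.2, 0, 0] := by simp [hf, hp]
  have hQ0 : Q (e₀, 0) = 0 := by rw [hQc.self_of_nhds, hμ0, zero_mul]
  have hμd : DifferentiableAt ℝ (fun e => dw μ (e, 0)) e₀ :=
    ((hμ.smoothNear (e₀, 0)).dw.differentiableAt).comp e₀ (f := fun e : ℝ × ℝ => (e, (0 : ℝ)))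
      (by fun_prop)
  -- In the product rule for ∂μ·c the term with the derivative of c drops out because ∂μ vanishes at
  -- e₀; only differentiability of c is needed.
  have hQ1 : fderiv ℝ (fun e => Q (e, 0)) e₀ (1, 0) ≠ 0 := by
    have : fderiv ℝ (fun e => Q (e, 0)) e₀ = fderiv ℝ (fun e => dw μ (e, 0) * c e) e₀ :=
      EventuallyEq.fderiv_eq hQc
    rw [this, fderiv_fun_mul hμd hc]
    simp [hμ0, hμ1, hc0]
  have step1 := aequivalent_of_cubic hQ e₀ hQ0 hQ1
  -- G puts back what the normal form dropped: the base map ξ, the initial values, and the even part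
  -- w²P(e, w²), all functions of the target coordinates.
  set G : R4 → R4 := fun y => !₂[(ξ (y 0, y 1)).1, (ξ (y 0, y 1)).2, Z₀ (y 0, y 1) + ε * y 2,
    H₀ (y 0, y 1) + 2 * ε * (y 2 * P ((y 0, y 1), y 2) + y 3)] with hG
  have hGs : SmoothNear G (f p) := by
    have hcd : ∀ i : Fin 4, ContDiff ℝ ∞ fun y : R4 => y i := fun i =>
      (EuclideanSpace.proj (𝕜 := ℝ) i).contDiff
    have h01 : ContDiff ℝ ∞ fun y : R4 => (y 0, y 1) := (hcd 0).prodMk (hcd 1)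
    refine smoothNear_vec4 ?_ ?_ ?_ ?_
    · exact (contDiff_fst.comp (hξ.comp h01)).smoothNear _
    · exact (contDiff_snd.comp (hξ.comp h01)).smoothNear _
    · exact ((hZ₀.comp h01).add (contDiff_const.mul (hcd 2))).smoothNear _
    · exact ((hH₀.comp h01).add (contDiff_const.mul
        (((hcd 2).mul (hP.comp (h01.prodMk (hcd 2)))).add (hcd 3)))).smoothNear _
  have hGd : IsLocalDiffeomorphAt 𝓘(ℝ, R4) 𝓘(ℝ, R4) ∞ G (f p) := by
    refine hGs.isLocalDiffeomorphAt fun v hv => ?_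
    have hl := hasDerivAt_zero_of_fderiv_eq_zero hGs.differentiableAt hv
    have hlin : ∀ a b : ℝ, HasDerivAt (fun t : ℝ => a + t * b) b 0 := fun a b => by
      simpa using ((hasDerivAt_id (0 : ℝ)).mul_const b).const_add a
    have e01 : ((v 0, v 1) : ℝ × ℝ) = 0 := by
      have h := (hasDerivAt_coord hl 0).prodMk (hasDerivAt_coord hl 1)
      simp only [hG, hfp] at h
      apply hξd
      have h2 := ((hξ.differentiable (by simp) e₀).hasFDerivAt.hasLineDerivAt (v 0, v 1))
      have h3 := HasDerivAt.unique h2 (h.congr_of_eventuallyEq (.of_forall fun t => by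
        simp [hadd]))
      exact h3.trans rfl
    have e0 : v 0 = 0 := congrArg Prod.fst e01
    have e1 : v 1 = 0 := congrArg Prod.snd e01
    have e2 : v 2 = 0 := by
      have h := hasDerivAt_coord hl 2
      simp only [hG, hfp] at h
      have := ((hlin (Z₀ e₀) (ε * v 2)).unique (h.congr_of_eventuallyEq (.of_forall fun t => by
        simp [e0, e1]; ring)))
      simpa [hε] using this
    have e3 : v 3 = 0 := by
      have h := hasDerivAt_coord hl 3
      simp only [hG, hfp] at h
      have := ((hlin (H₀ e₀) (2 * ε * v 3)).unique (h.congr_of_eventuallyEq (.of_forall fun t => by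
        simp [e0, e1, e2]; ring)))
      simpa [hε] using this
    ext i
    fin_cases i <;> simp [e0, e1, e2, e3]
  have hfc : ContinuousAt f p := by
    refine SmoothNear.continuousAt ?_
    exact smoothNear_vec4 (ContDiff.smoothNear (by fun_prop) _)
      (ContDiff.smoothNear (by fun_prop) _) (ContDiff.smoothNear (by fun_prop) _)
      (ContDiff.smoothNear (ContDiff.mul (by fun_prop) (hQ.comp (by fun_prop))) _)
  have step2 := ((aequivalent_comp_left (f := f) (p := p) hGd).symm hfc).trans step1
  set ϑ : R3 → R3 := fun x => (x.1, x.2.1, θ ((x.1, x.2.1), x.2.2)) with hϑ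
  have hreb : ContDiff ℝ ∞ fun x : R3 => (((x.1, x.2.1), x.2.2) : (ℝ × ℝ) × ℝ) := by fun_prop
  have hϑs : SmoothNear ϑ p := by
    refine SmoothNear.prodMk (ContDiff.smoothNear (by fun_prop) _)
      (SmoothNear.prodMk (ContDiff.smoothNear (by fun_prop) _) ?_)
    exact SmoothNear.comp_of_eq hθs (hreb.smoothNear p) (by simp [hp])
  have hϑd : IsLocalDiffeomorphAt 𝓘(ℝ, R3) 𝓘(ℝ, R3) ∞ ϑ p := by
    refine hϑs.isLocalDiffeomorphAt fun v hv => ?_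
    have hl := hasDerivAt_zero_of_fderiv_eq_zero hϑs.differentiableAt hv
    have hlin : ∀ a b : ℝ, HasDerivAt (fun t : ℝ => a + t * b) b 0 := fun a b => by
      simpa using ((hasDerivAt_id (0 : ℝ)).mul_const b).const_add a
    have e0 : v.1 = 0 := by
      refine ((hlin e₀.1 v.1).unique (hl.fst.congr_of_eventuallyEq (.of_forall fun t => ?_)))
      simp [hϑ, hp]
    have e1 : v.2.1 = 0 := by
      refine ((hlin e₀.2 v.2.1).unique (hl.snd.fst.congr_of_eventuallyEq (.of_forall fun t => ?_)))
      simp [hϑ, hp]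
    have e2 : v.2.2 = 0 := by
      have h2 := hθd.hasLineDerivAt ((v.1, v.2.1), v.2.2)
      have h : HasDerivAt (fun t : ℝ => (ϑ (p + t • v)).2.2) 0 0 := hl.snd.snd
      have h3 := HasDerivAt.unique h2 (h.congr_of_eventuallyEq (.of_forall fun t => by
        simp [hϑ, hp, hadd]))
      simpa [ha] using h3
    exact Prod.ext e0 (Prod.ext e1 e2)
  have hϑp : ϑ p = p := by simp [hϑ, hp, hθ0]
  have step3 := aequivalent_comp_right (f := fun x => G (f x)) hϑd
  rw [hϑp] at step3
  refine (step3.trans step2).congr ?_ EventuallyEq.rfl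
  have hb : Tendsto (fun x : R3 => (((x.1, x.2.1), x.2.2) : (ℝ × ℝ) × ℝ)) (𝓝 p) (𝓝 (e₀, 0)) :=
    hreb.continuous.tendsto p
  filter_upwards [hb.eventually hZ, hb.eventually hH] with x h2 h3
  simp only [h2, h3, hG, hf, hϑ]
  ext i
  fin_cases i <;> simp

end NormalForm
end TwoRuled
end

noncomputable section

namespace TwoRuled
open Set MeasureTheory Filter

/-! ### The moving frame X, Y, X', Z, its structure equations, and the differential of f. -/

section Frame

theorem det4_eq (u v w z : R4) : det4 u v w z =
    u 0 * (v 1 * (w 2 * z 3 - w 3 * z 2) - v 2 * (w 1 * z 3 - w 3 * z 1) + v 3 * (w 1 * z 2 - w 2 * z 1))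
    - u 1 * (v 0 * (w 2 * z 3 - w 3 * z 2) - v 2 * (w 0 * z 3 - w 3 * z 0) + v 3 * (w 0 * z 2 - w 2 * z 0))
    + u 2 * (v 0 * (w 1 * z 3 - w 3 * z 1) - v 1 * (w 0 * z 3 - w 3 * z 0) + v 3 * (w 0 * z 1 - w 1 * z 0))
    - u 3 * (v 0 * (w 1 * z 2 - w 2 * z 1) - v 1 * (w 0 * z 2 - w 2 * z 0) + v 2 * (w 0 * z 1 - w 1 * z 0)) := by
  simp [det4, Matrix.det_succ_row_zero, Fin.sum_univ_succ, Fin.succAbove]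
  ring

theorem inner_eq (u v : R4) : ⟪u, v⟫ = u 0 * v 0 + u 1 * v 1 + u 2 * v 2 + u 3 * v 3 := by
  simp [PiLp.inner_apply, Fin.sum_univ_four]
  ring

theorem inner_wedge3 (u v w z : R4) : ⟪wedge3 u v w, z⟫ = det4 z u v w := by
  rw [inner_eq, det4_eq]
  simp only [wedge3, det4_eq]
  simp
  ring

/-- The right-hand side is the Gram determinant of u, v, w; it makes Z a unit vector. -/
theorem inner_wedge3_self (u v w : R4) : ⟪wedge3 u v w, wedge3 u v w⟫ =
    ⟪u, u⟫ * ⟪v, v⟫ * ⟪w, w⟫ + 2 * ⟪u, v⟫ * ⟪v, w⟫ * ⟪u, w⟫ - ⟪u, u⟫ * ⟪v, w⟫ ^ 2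
      - ⟪v, v⟫ * ⟪u, w⟫ ^ 2 - ⟪w, w⟫ * ⟪u, v⟫ ^ 2 := by
  simp only [inner_eq, wedge3, det4_eq]
  simp
  ring

theorem hasDerivAt_inner {u v : ℝ → R4} {u' v' : R4} {t : ℝ} (hu : HasDerivAt u u' t)
    (hv : HasDerivAt v v' t) : HasDerivAt (fun t => ⟪u t, v t⟫) (⟪u t, v'⟫ + ⟪u', v t⟫) t :=
  hu.inner ℝ hv

theorem inner_deriv_of_inner_const {u v : ℝ → R4} {t c : ℝ} (hu : DifferentiableAt ℝ u t)
    (hv : DifferentiableAt ℝ v t) (hc : ∀ᶠ x in 𝓝 t, ⟪u x, v x⟫ = c) :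
    ⟪u t, deriv v t⟫ + ⟪deriv u t, v t⟫ = 0 :=
  (hasDerivAt_inner hu.hasDerivAt hv.hasDerivAt).unique
    ((hasDerivAt_const t c).congr_of_eventuallyEq hc)

theorem SmoothNear.inner {E : Type*} [NormedAddCommGroup E] [NormedSpace ℝ E] {u v : E → R4} {x : E}
    (hu : SmoothNear u x) (hv : SmoothNear v x) : SmoothNear (fun x => ⟪u x, v x⟫) x := by
  filter_upwards [hu, hv] with y h1 h2 using h1.inner ℝ h2

variable {I : Set ℝ} {γ X Y : ℝ → R4} {t : ℝ}

namespace IsPseudoNondegenerate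

theorem smoothNear_base (h : IsPseudoNondegenerate I γ X Y) (hI : IsOpen I) (ht : t ∈ I) :
    SmoothNear γ t := h.smooth_base.smoothNear hI ht

theorem smoothNear_fst (h : IsPseudoNondegenerate I γ X Y) (hI : IsOpen I) (ht : t ∈ I) :
    SmoothNear X t := h.smooth_fst.smoothNear hI ht

theorem smoothNear_snd (h : IsPseudoNondegenerate I γ X Y) (hI : IsOpen I) (ht : t ∈ I) :
    SmoothNear Y t := h.smooth_snd.smoothNear hI ht

theorem smoothNear_frameZ (h : IsPseudoNondegenerate I γ X Y) (hI : IsOpen I) (ht : t ∈ I) :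
    SmoothNear (frameZ X Y) t := by
  filter_upwards [h.smoothNear_fst hI ht, h.smoothNear_snd hI ht,
    (h.smoothNear_fst hI ht).deriv] with y h1 h2 h3
  have e1 := contDiffAt_euclidean.1 h1
  have e2 := contDiffAt_euclidean.1 h2
  have e3 := contDiffAt_euclidean.1 h3
  refine contDiffAt_euclidean.2 fun i => ?_
  simp only [frameZ, wedge3, det4_eq]
  fun_prop

theorem inner_fst_fst (h : IsPseudoNondegenerate I γ X Y) (ht : t ∈ I) : ⟪X t, X t⟫ = 1 := by
  rw [real_inner_self_eq_norm_sq, h.norm_fst t ht]; norm_num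

theorem inner_snd_snd (h : IsPseudoNondegenerate I γ X Y) (ht : t ∈ I) : ⟪Y t, Y t⟫ = 1 := by
  rw [real_inner_self_eq_norm_sq, h.norm_snd t ht]; norm_num

theorem inner_deriv_deriv (h : IsPseudoNondegenerate I γ X Y) (ht : t ∈ I) :
    ⟪deriv X t, deriv X t⟫ = 1 := by
  rw [real_inner_self_eq_norm_sq, h.norm_deriv_fst t ht]; norm_num

theorem inner_fst_deriv (h : IsPseudoNondegenerate I γ X Y) (hI : IsOpen I) (ht : t ∈ I) :
    ⟪X t, deriv X t⟫ = 0 := by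
  have hX := (h.smoothNear_fst hI ht).differentiableAt
  have := inner_deriv_of_inner_const (c := 1) hX hX (by
    filter_upwards [hI.mem_nhds ht] with x hx using h.inner_fst_fst hx)
  rw [real_inner_comm (X t)] at this
  linarith [real_inner_comm (X t) (deriv X t)]

theorem inner_snd_deriv_snd (h : IsPseudoNondegenerate I γ X Y) (hI : IsOpen I) (ht : t ∈ I) :
    ⟪Y t, deriv Y t⟫ = 0 := by
  have hX := (h.smoothNear_snd hI ht).differentiableAt
  have := inner_deriv_of_inner_const (c := 1) hX hX (by
    filter_upwards [hI.mem_nhds ht] with x hx using h.inner_snd_snd hx)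
  rw [real_inner_comm (Y t)] at this
  linarith [real_inner_comm (Y t) (deriv Y t)]

theorem inner_snd_deriv_fst (h : IsPseudoNondegenerate I γ X Y) (hI : IsOpen I) (ht : t ∈ I) :
    ⟪Y t, deriv X t⟫ = 0 := by
  have hX := (h.smoothNear_fst hI ht).differentiableAt
  have hY := (h.smoothNear_snd hI ht).differentiableAt
  have := inner_deriv_of_inner_const (c := 0) hX hY (by
    filter_upwards [hI.mem_nhds ht] with x hx using h.inner_fst_snd x hx)
  rw [h.inner_fst_deriv_snd t ht, zero_add] at this
  rwa [real_inner_comm]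

theorem inner_frameZ_fst : ⟪frameZ X Y t, X t⟫ = 0 := by
  rw [frameZ, inner_wedge3, det4_eq]; ring

theorem inner_frameZ_snd : ⟪frameZ X Y t, Y t⟫ = 0 := by
  rw [frameZ, inner_wedge3, det4_eq]; ring

theorem inner_frameZ_deriv : ⟪frameZ X Y t, deriv X t⟫ = 0 := by
  rw [frameZ, inner_wedge3, det4_eq]; ring

theorem inner_frameZ_frameZ (h : IsPseudoNondegenerate I γ X Y) (hI : IsOpen I) (ht : t ∈ I) :
    ⟪frameZ X Y t, frameZ X Y t⟫ = 1 := by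
  rw [frameZ, inner_wedge3_self, h.inner_fst_fst ht, h.inner_snd_snd ht, h.inner_deriv_deriv ht,
    h.inner_fst_snd t ht, h.inner_fst_deriv hI ht, h.inner_snd_deriv_fst hI ht]
  norm_num

theorem orthonormal_frame (h : IsPseudoNondegenerate I γ X Y) (hI : IsOpen I) (ht : t ∈ I) :
    Orthonormal ℝ ![X t, Y t, deriv X t, frameZ X Y t] := by
  rw [orthonormal_iff_ite]
  have e1 := h.inner_fst_fst ht
  have e2 := h.inner_snd_snd ht
  have e3 := h.inner_deriv_deriv ht
  have e4 := h.inner_frameZ_frameZ hI ht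
  have f1 := h.inner_fst_snd t ht
  have f2 := h.inner_fst_deriv hI ht
  have f3 := h.inner_snd_deriv_fst hI ht
  have f4 : ⟪frameZ X Y t, X t⟫ = 0 := inner_frameZ_fst
  have f5 : ⟪frameZ X Y t, Y t⟫ = 0 := inner_frameZ_snd
  have f6 : ⟪frameZ X Y t, deriv X t⟫ = 0 := inner_frameZ_deriv
  have g1 := real_inner_comm (X t) (Y t) ▸ f1
  have g2 := real_inner_comm (X t) (deriv X t) ▸ f2
  have g3 := real_inner_comm (Y t) (deriv X t) ▸ f3
  have g4 := real_inner_comm (frameZ X Y t) (X t) ▸ f4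
  have g5 := real_inner_comm (frameZ X Y t) (Y t) ▸ f5
  have g6 := real_inner_comm (frameZ X Y t) (deriv X t) ▸ f6
  intro i j
  fin_cases i <;> fin_cases j <;> simp_all

/-- The moving frame `X, Y, X', Z` as an orthonormal basis. -/
def frame (h : IsPseudoNondegenerate I γ X Y) (hI : IsOpen I) (ht : t ∈ I) :
    OrthonormalBasis (Fin 4) ℝ R4 :=
  OrthonormalBasis.mk (h.orthonormal_frame hI ht) (by
    rw [(h.orthonormal_frame hI ht).linearIndependent.span_eq_top_of_card_eq_finrank' (by simp)])

theorem coe_frame (h : IsPseudoNondegenerate I γ X Y) (hI : IsOpen I) (ht : t ∈ I) :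
    ⇑(h.frame hI ht) = ![X t, Y t, deriv X t, frameZ X Y t] := by simp [frame]

theorem eq_sum_frame (h : IsPseudoNondegenerate I γ X Y) (hI : IsOpen I) (ht : t ∈ I) (u : R4) :
    u = ⟪u, X t⟫ • X t + ⟪u, Y t⟫ • Y t + ⟪u, deriv X t⟫ • deriv X t +
      ⟪u, frameZ X Y t⟫ • frameZ X Y t := by
  have := (h.frame hI ht).sum_repr' u
  rw [coe_frame, Fin.sum_univ_four] at this
  rw [real_inner_comm (X t) u, real_inner_comm (Y t) u, real_inner_comm (deriv X t) u,
    real_inner_comm (frameZ X Y t) u]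
  exact this.symm

theorem inner_comb_fst (h : IsPseudoNondegenerate I γ X Y) (hI : IsOpen I) (ht : t ∈ I)
    (a b c : ℝ) : ⟪a • X t + b • Y t + c • deriv X t, X t⟫ = a := by
  rw [inner_add_left, inner_add_left, real_inner_smul_left, real_inner_smul_left,
    real_inner_smul_left, h.inner_fst_fst ht, real_inner_comm (X t), h.inner_fst_snd t ht,
    real_inner_comm (X t), h.inner_fst_deriv hI ht]
  ring

theorem inner_comb_snd (h : IsPseudoNondegenerate I γ X Y) (hI : IsOpen I) (ht : t ∈ I)
    (a b c : ℝ) : ⟪a • X t + b • Y t + c • deriv X t, Y t⟫ = b := by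
  rw [inner_add_left, inner_add_left, real_inner_smul_left, real_inner_smul_left,
    real_inner_smul_left, h.inner_snd_snd ht, h.inner_fst_snd t ht,
    real_inner_comm (Y t), h.inner_snd_deriv_fst hI ht]
  ring

theorem inner_comb_deriv (h : IsPseudoNondegenerate I γ X Y) (hI : IsOpen I) (ht : t ∈ I)
    (a b c : ℝ) : ⟪a • X t + b • Y t + c • deriv X t, deriv X t⟫ = c := by
  rw [inner_add_left, inner_add_left, real_inner_smul_left, real_inner_smul_left,
    real_inner_smul_left, h.inner_snd_deriv_fst hI ht, h.inner_fst_deriv hI ht,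
    h.inner_deriv_deriv ht]
  ring

theorem inner_comb_frameZ (a b c : ℝ) :
    ⟪a • X t + b • Y t + c • deriv X t, frameZ X Y t⟫ = 0 := by
  rw [real_inner_comm, inner_add_right, inner_add_right, real_inner_smul_right,
    real_inner_smul_right, real_inner_smul_right, inner_frameZ_fst, inner_frameZ_snd,
    inner_frameZ_deriv]
  ring

/-- This is where the rank condition enters: X, Y, X' already span a space of dimension 3, so Y'
lies in it and is orthogonal to Z. -/
theorem inner_deriv_snd_frameZ (h : IsPseudoNondegenerate I γ X Y) (hI : IsOpen I) (ht : t ∈ I) :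
    ⟪deriv Y t, frameZ X Y t⟫ = 0 := by
  have hli : LinearIndependent ℝ ![X t, Y t, deriv X t] := by
    have := ((h.orthonormal_frame hI ht).linearIndependent).comp (Fin.castSucc : Fin 3 → Fin 4)
      (Fin.castSucc_injective 3)
    have e : ![X t, Y t, deriv X t] =
        ![X t, Y t, deriv X t, frameZ X Y t] ∘ (Fin.castSucc : Fin 3 → Fin 4) := by
      funext i
      fin_cases i <;> rfl
    rw [e]
    exact this
  have h3 : Module.finrank ℝ (Submodule.span ℝ (range ![X t, Y t, deriv X t])) = 3 := by
    rw [finrank_span_eq_card hli]; simp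
  have hle : Submodule.span ℝ (range ![X t, Y t, deriv X t]) ≤
      Submodule.span ℝ ({X t, Y t, deriv X t, deriv Y t} : Set R4) := by
    refine Submodule.span_mono ?_
    rintro _ ⟨i, rfl⟩
    fin_cases i <;> simp
  have heq := Submodule.eq_of_le_of_finrank_eq hle (by rw [h3, h.finrank_span t ht])
  have hmem : deriv Y t ∈ Submodule.span ℝ (range ![X t, Y t, deriv X t]) := by
    rw [heq]; exact Submodule.subset_span (by simp)
  have hz : Submodule.span ℝ (range ![X t, Y t, deriv X t]) ≤ (ℝ ∙ frameZ X Y t)ᗮ := by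
    refine Submodule.span_le.2 ?_
    rintro _ ⟨i, rfl⟩
    refine Submodule.mem_orthogonal_singleton_iff_inner_right.2 ?_
    fin_cases i
    · exact inner_frameZ_fst
    · exact inner_frameZ_snd
    · exact inner_frameZ_deriv
  exact Submodule.mem_orthogonal_singleton_iff_inner_left.1 (hz hmem)

theorem deriv_snd (h : IsPseudoNondegenerate I γ X Y) (hI : IsOpen I) (ht : t ∈ I) :
    deriv Y t = coeffA X Y t • deriv X t := by
  have := h.eq_sum_frame hI ht (deriv Y t)
  rw [real_inner_comm, h.inner_fst_deriv_snd t ht, real_inner_comm, h.inner_snd_deriv_snd hI ht,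
    h.inner_deriv_snd_frameZ hI ht] at this
  simpa [coeffA] using this

theorem inner_deriv2_frameZ : ⟪deriv (deriv X) t, frameZ X Y t⟫ = coeffDelta X Y t := by
  rw [real_inner_comm, frameZ, inner_wedge3, coeffDelta, det4_eq, det4_eq]; ring

/-- The coefficients along X, Y and X' come from differentiating the orthonormality relations; the
one along Z is the definition of δ. -/
theorem deriv_deriv_fst (h : IsPseudoNondegenerate I γ X Y) (hI : IsOpen I) (ht : t ∈ I) :
    deriv (deriv X) t = -X t - coeffA X Y t • Y t + coeffDelta X Y t • frameZ X Y t := by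
  have hX := (h.smoothNear_fst hI ht).differentiableAt
  have hY := (h.smoothNear_snd hI ht).differentiableAt
  have hW := (h.smoothNear_fst hI ht).deriv.differentiableAt
  have e1 := inner_deriv_of_inner_const (c := 0) hX hW (by
    filter_upwards [hI.mem_nhds ht] with x hx using h.inner_fst_deriv hI hx)
  have e2 := inner_deriv_of_inner_const (c := 0) hY hW (by
    filter_upwards [hI.mem_nhds ht] with x hx using h.inner_snd_deriv_fst hI hx)
  have e3 := inner_deriv_of_inner_const (c := 1) hW hW (by
    filter_upwards [hI.mem_nhds ht] with x hx using h.inner_deriv_deriv hx)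
  have f1 : ⟪deriv (deriv X) t, X t⟫ = -1 := by
    rw [real_inner_comm]; linarith [h.inner_deriv_deriv ht]
  have f2 : ⟪deriv (deriv X) t, Y t⟫ = -coeffA X Y t := by
    rw [real_inner_comm, coeffA]; linarith
  have f3 : ⟪deriv (deriv X) t, deriv X t⟫ = 0 := by
    rw [real_inner_comm] at e3; linarith
  have := h.eq_sum_frame hI ht (deriv (deriv X) t)
  rw [f1, f2, f3, inner_deriv2_frameZ] at this
  rw [this]
  module

/-- Z' is orthogonal to X and Y because X' and Y' are orthogonal to Z, and its X'-component is minus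
the Z-component of X''. The normal thus turns only towards X', at rate -δ. -/
theorem deriv_frameZ (h : IsPseudoNondegenerate I γ X Y) (hI : IsOpen I) (ht : t ∈ I) :
    deriv (frameZ X Y) t = -coeffDelta X Y t • deriv X t := by
  have hX := (h.smoothNear_fst hI ht).differentiableAt
  have hY := (h.smoothNear_snd hI ht).differentiableAt
  have hW := (h.smoothNear_fst hI ht).deriv.differentiableAt
  have hZ := (h.smoothNear_frameZ hI ht).differentiableAt
  have e1 := inner_deriv_of_inner_const (c := 0) hZ hX (.of_forall fun _ => inner_frameZ_fst)
  have e2 := inner_deriv_of_inner_const (c := 0) hZ hY (.of_forall fun _ => inner_frameZ_snd)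
  have e3 := inner_deriv_of_inner_const (c := 0) hZ hW (.of_forall fun _ => inner_frameZ_deriv)
  have e4 := inner_deriv_of_inner_const (c := 1) hZ hZ (by
    filter_upwards [hI.mem_nhds ht] with x hx using h.inner_frameZ_frameZ hI hx)
  rw [inner_frameZ_deriv, zero_add] at e1
  rw [h.deriv_snd hI ht, inner_smul_right, inner_frameZ_deriv, mul_zero, zero_add] at e2
  rw [real_inner_comm, inner_deriv2_frameZ] at e3
  rw [real_inner_comm] at e4
  have := h.eq_sum_frame hI ht (deriv (frameZ X Y) t)
  rw [e1, e2, eq_neg_of_add_eq_zero_right e3,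
    show ⟪deriv (frameZ X Y) t, frameZ X Y t⟫ = 0 by linarith] at this
  simpa using this

theorem smoothNear_coeffA (h : IsPseudoNondegenerate I γ X Y) (hI : IsOpen I) (ht : t ∈ I) :
    SmoothNear (coeffA X Y) t :=
  (h.smoothNear_snd hI ht).deriv.inner (h.smoothNear_fst hI ht).deriv

theorem smoothNear_coeffB1 (h : IsPseudoNondegenerate I γ X Y) (hI : IsOpen I) (ht : t ∈ I) :
    SmoothNear (coeffB1 γ X) t :=
  (h.smoothNear_base hI ht).deriv.inner (h.smoothNear_fst hI ht)

theorem smoothNear_coeffB2 (h : IsPseudoNondegenerate I γ X Y) (hI : IsOpen I) (ht : t ∈ I) :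
    SmoothNear (coeffB2 γ Y) t :=
  (h.smoothNear_base hI ht).deriv.inner (h.smoothNear_snd hI ht)

theorem smoothNear_coeffB3 (h : IsPseudoNondegenerate I γ X Y) (hI : IsOpen I) (ht : t ∈ I) :
    SmoothNear (coeffB3 γ X) t :=
  (h.smoothNear_base hI ht).deriv.inner (h.smoothNear_fst hI ht).deriv

theorem smoothNear_coeffDelta (h : IsPseudoNondegenerate I γ X Y) (hI : IsOpen I) (ht : t ∈ I) :
    SmoothNear (coeffDelta X Y) t := by
  have := (h.smoothNear_fst hI ht).deriv.deriv.inner (h.smoothNear_frameZ hI ht)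
  exact this.congr (.of_forall fun _ => inner_deriv2_frameZ.symm)

theorem smoothNear_identifier (h : IsPseudoNondegenerate I γ X Y) (hI : IsOpen I) {p : R3}
    (hp : p.1 ∈ I) : SmoothNear (identifier γ X Y) p := by
  have h1 : SmoothNear (fun p : R3 => p.1) p := contDiff_fst.smoothNear p
  exact (((h.smoothNear_coeffB3 hI hp).comp h1).add (ContDiff.smoothNear (by fun_prop) p)).add
    ((ContDiff.smoothNear (by fun_prop) p).mul ((h.smoothNear_coeffA hI hp).comp h1))

theorem smoothNear_twoRuled (h : IsPseudoNondegenerate I γ X Y) (hI : IsOpen I) {p : R3}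
    (hp : p.1 ∈ I) : SmoothNear (twoRuled γ X Y) p := by
  have h1 : SmoothNear (fun p : R3 => p.1) p := contDiff_fst.smoothNear p
  exact (((h.smoothNear_base hI hp).comp h1).add
    (SmoothNear.smul (ContDiff.smoothNear (by fun_prop) p) ((h.smoothNear_fst hI hp).comp h1))).add
    (SmoothNear.smul (ContDiff.smoothNear (by fun_prop) p) ((h.smoothNear_snd hI hp).comp h1))

/-- The derivative of `λ`. -/
theorem fderiv_identifier (h : IsPseudoNondegenerate I γ X Y) (hI : IsOpen I) {p : R3}
    (hp : p.1 ∈ I) (v : R3) : fderiv ℝ (identifier γ X Y) p v =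
      v.1 * (deriv (coeffB3 γ X) p.1 + p.2.2 * deriv (coeffA X Y) p.1) + v.2.1 +
        v.2.2 * coeffA X Y p.1 := by
  have hb := (h.smoothNear_coeffB3 hI hp).differentiableAt.hasDerivAt
  have ha := (h.smoothNear_coeffA hI hp).differentiableAt.hasDerivAt
  have h1 : HasFDerivAt (fun p : R3 => p.1) (ContinuousLinearMap.fst ℝ ℝ (ℝ × ℝ)) p :=
    hasFDerivAt_fst
  have h2 : HasFDerivAt (fun p : R3 => p.2.1) _ p :=
    (hasFDerivAt_snd (𝕜 := ℝ) (E := ℝ) (F := ℝ × ℝ) (p := p)).fst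
  have h3 : HasFDerivAt (fun p : R3 => p.2.2) _ p :=
    (hasFDerivAt_snd (𝕜 := ℝ) (E := ℝ) (F := ℝ × ℝ) (p := p)).snd
  have := ((hb.comp_hasFDerivAt p h1).add h2).add (h3.mul (ha.comp_hasFDerivAt p h1))
  have h4 : HasFDerivAt (identifier γ X Y) _ p := this
  rw [h4.fderiv]
  simp
  ring

end IsPseudoNondegenerate

namespace IsPseudoNondegenerateFrontal

theorem deriv_base (h : IsPseudoNondegenerateFrontal I γ X Y) (hI : IsOpen I) (ht : t ∈ I) :
    deriv γ t = coeffB1 γ X t • X t + coeffB2 γ Y t • Y t + coeffB3 γ X t • deriv X t := by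
  have := h.eq_sum_frame hI ht (deriv γ t)
  have h4 : ⟪deriv γ t, frameZ X Y t⟫ = 0 := h.coeffB4_eq_zero t ht
  rw [h4, zero_smul, add_zero] at this
  exact this

/-- The differential of the two-ruled frontal in the moving frame. -/
theorem fderiv_twoRuled (h : IsPseudoNondegenerateFrontal I γ X Y) (hI : IsOpen I) {p : R3}
    (hp : p.1 ∈ I) (v : R3) : fderiv ℝ (twoRuled γ X Y) p v =
      (v.1 * coeffB1 γ X p.1 + v.2.1) • X p.1 + (v.1 * coeffB2 γ Y p.1 + v.2.2) • Y p.1 +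
        (v.1 * identifier γ X Y p) • deriv X p.1 := by
  have hγ := (h.smoothNear_base hI hp).differentiableAt.hasDerivAt
  have hX := (h.smoothNear_fst hI hp).differentiableAt.hasDerivAt
  have hY := (h.smoothNear_snd hI hp).differentiableAt.hasDerivAt
  have h1 : HasFDerivAt (fun p : R3 => p.1) (ContinuousLinearMap.fst ℝ ℝ (ℝ × ℝ)) p :=
    hasFDerivAt_fst
  have h2 : HasFDerivAt (fun p : R3 => p.2.1) _ p :=
    (hasFDerivAt_snd (𝕜 := ℝ) (E := ℝ) (F := ℝ × ℝ) (p := p)).fst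
  have h3 : HasFDerivAt (fun p : R3 => p.2.2) _ p :=
    (hasFDerivAt_snd (𝕜 := ℝ) (E := ℝ) (F := ℝ × ℝ) (p := p)).snd
  have k1 : HasFDerivAt (fun p : R3 => γ p.1) _ p := hγ.hasFDerivAt.comp p h1
  have k2 : HasFDerivAt (fun p : R3 => X p.1) _ p := hX.hasFDerivAt.comp p h1
  have k3 : HasFDerivAt (fun p : R3 => Y p.1) _ p := hY.hasFDerivAt.comp p h1
  have := (k1.add (h2.smul k2)).add (h3.smul k3)
  have h4 : HasFDerivAt (twoRuled γ X Y) _ p := this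
  rw [h4.fderiv]
  simp [h.deriv_base hI hp, h.deriv_snd hI hp, identifier]
  module

/-- Off λ = 0 the three frame coefficients of df(v) successively force v = 0; on it, η is a kernel
vector with first component 1. -/
theorem isSingularPoint_iff (h : IsPseudoNondegenerateFrontal I γ X Y) (hI : IsOpen I) {p : R3}
    (hp : p.1 ∈ I) : IsSingularPoint (twoRuled γ X Y) p ↔ identifier γ X Y p = 0 := by
  rw [IsSingularPoint, injective_iff_map_eq_zero, not_forall]
  constructor
  · rintro ⟨v, hv⟩
    by_contra hl
    refine hv fun hz => ?_
    rw [h.fderiv_twoRuled hI hp] at hz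
    have g1 := congrArg (fun u => ⟪u, X p.1⟫) hz
    have g2 := congrArg (fun u => ⟪u, Y p.1⟫) hz
    have g3 := congrArg (fun u => ⟪u, deriv X p.1⟫) hz
    simp only [h.inner_comb_fst hI hp, h.inner_comb_snd hI hp, h.inner_comb_deriv hI hp,
      inner_zero_left] at g1 g2 g3
    have v1 : v.1 = 0 := (mul_eq_zero.1 g3).resolve_right hl
    simp only [v1, zero_mul, zero_add] at g1 g2
    exact Prod.ext v1 (Prod.ext g1 g2)
  · intro hl
    refine ⟨nullField γ X Y p, fun hz => ?_⟩
    have := hz (by rw [h.fderiv_twoRuled hI hp, hl]; simp [nullField])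
    exact one_ne_zero (congrArg Prod.fst this)

end IsPseudoNondegenerateFrontal

end Frame
end TwoRuled
end

noncomputable section

namespace TwoRuled
open Set MeasureTheory Filter

/-! ### The fold criterion for germs. -/

section FoldGerm

variable {E : Type*} [NormedAddCommGroup E] [NormedSpace ℝ E]

theorem dw_congr {F : Type*} [NormedAddCommGroup F] [NormedSpace ℝ F] {f g : E × ℝ → F}
    {p : E × ℝ} (h : f =ᶠ[𝓝 p] g) : dw f =ᶠ[𝓝 p] dw g := by
  filter_upwards [h.eventuallyEq_nhds] with q hq
  rw [dw, dw, hq.fderiv_eq]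

variable [FiniteDimensional ℝ E]

/-- Hadamard's lemma in the last variable. -/
theorem exists_eq_add_mul {f : E × ℝ → ℝ} (hf : ContDiff ℝ ∞ f) :
    ∃ g : E × ℝ → ℝ, ContDiff ℝ ∞ g ∧ (∀ e, g (e, 0) = dw f (e, 0)) ∧
      ∀ e v, f (e, v) = f (e, 0) + v * g (e, v) := by
  have hd : ContDiff ℝ ∞ (dw f) :=
    (contDiff_infty_iff_fderiv.1 hf).2.clm_apply contDiff_const
  refine ⟨fun p => ∫ σ in (0 : ℝ)..1, dw f (p.1, σ * p.2), ?_, fun e => by simp, fun e v => ?_⟩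
  · have : ContDiff ℝ ∞ fun q : (E × ℝ) × ℝ => dw f (q.1.1, q.2 * q.1.2) := hd.comp (by fun_prop)
    exact contDiff_intervalIntegral this 0 1
  · have h1 := intervalIntegral.integral_eq_sub_of_hasDerivAt (a := 0) (b := v)
      (f := fun u => f (e, u)) (f' := fun u => dw f (e, u))
      (fun u _ => hasDerivAt_snd_of_differentiableAt (hf.differentiable (by simp) _))
      ((hd.continuous.comp (by fun_prop)).intervalIntegrable _ _)
    rw [integral_zero_eq_mul_integral] at h1
    simp only [mul_comm v] at h1 ⊢
    linarith

/-- Germ version of `aequivalent_of_fold`. -/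
theorem aequivalent_of_fold_germ {ξ : ℝ × ℝ → ℝ × ℝ} {z h μ : (ℝ × ℝ) × ℝ → ℝ} {e₀ : ℝ × ℝ}
    (hξ : SmoothNear ξ e₀) (hz : SmoothNear z (e₀, 0)) (hh : SmoothNear h (e₀, 0))
    (hμ : SmoothNear μ (e₀, 0)) (hξd : ∀ v, fderiv ℝ ξ e₀ v = 0 → v = 0)
    (hz0 : ∀ᶠ e in 𝓝 e₀, dw z (e, 0) = 0) (hz1 : dw (dw z) (e₀, 0) ≠ 0)
    (hhz : ∀ᶠ p in 𝓝 (e₀, 0), dw h p = μ p * dw z p) (hμ0 : dw μ (e₀, 0) = 0)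
    (hμ1 : fderiv ℝ (fun e => dw μ (e, 0)) e₀ (1, 0) ≠ 0) :
    AEquivalent (fun x => !₂[(ξ (x.1, x.2.1)).1, (ξ (x.1, x.2.1)).2, z ((x.1, x.2.1), x.2.2),
      h ((x.1, x.2.1), x.2.2)]) (e₀.1, e₀.2, 0) crossCapInterval 0 := by
  have hi : Tendsto (fun e : ℝ × ℝ => (e, (0 : ℝ))) (𝓝 e₀) (𝓝 (e₀, 0)) :=
    Continuous.tendsto (by fun_prop) e₀
  have hic : ContDiff ℝ ∞ fun e : ℝ × ℝ => (e, (0 : ℝ)) := by fun_prop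
  obtain ⟨ξ', hξ's, -, -, hξ'⟩ := hξ.exists_contDiff univ_mem
  obtain ⟨z', hz's, -, -, hz'⟩ := (hz.comp_of_eq (hic.smoothNear e₀) rfl).exists_contDiff univ_mem
  obtain ⟨h', hh's, -, -, hh'⟩ := (hh.comp_of_eq (hic.smoothNear e₀) rfl).exists_contDiff univ_mem
  -- It is ∂z that is extended globally, so that division by the last variable yields a global
  -- smooth Λ with Λ(e₀, 0) = ∂²z(e₀, 0).
  obtain ⟨l, hls, -, -, hl⟩ := hz.dw.exists_contDiff univ_mem
  obtain ⟨m, hms, -, -, hm⟩ := hμ.exists_contDiff univ_mem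
  obtain ⟨Λ, hΛ, hΛ0, hlΛ⟩ := exists_eq_add_mul hls
  have hdm := dw_congr hm
  have hdm' : (fun e => dw m (e, 0)) =ᶠ[𝓝 e₀] fun e => dw μ (e, 0) := hi.eventually hdm
  have hfold := aequivalent_of_fold hξ's hz's hh's hΛ hms (e₀ := e₀)
    (by rw [hξ'.fderiv_eq]; exact hξd)
    (by rw [hΛ0, (dw_congr hl).eq_of_nhds]; exact hz1) (by rw [hdm.eq_of_nhds, hμ0])
    (by rw [hdm'.fderiv_eq]; exact hμ1)
  refine hfold.congr ?_ EventuallyEq.rfl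
  -- A ball in the product contains the whole segment from (e, 0) to (e, v), over which z and h are
  -- recovered from their derivatives.
  obtain ⟨r, hr, hball⟩ := Metric.eventually_nhds_iff_ball.1
    (hz.and (hh.and (hl.and (hm.and hhz))))
  have hreb : Continuous fun x : R3 => (((x.1, x.2.1), x.2.2) : (ℝ × ℝ) × ℝ) := by fun_prop
  have hre : Continuous fun x : R3 => ((x.1, x.2.1) : ℝ × ℝ) := by fun_prop
  have ht := hreb.tendsto (e₀.1, e₀.2, 0)
  have ht' := hre.tendsto (e₀.1, e₀.2, 0)
  filter_upwards [ht.eventually (Metric.ball_mem_nhds (e₀, (0 : ℝ)) hr), ht'.eventually hξ',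
    ht'.eventually hz', ht'.eventually hh', ht'.eventually hz0] with x hx e1 e2 e3 e4
  set e : ℝ × ℝ := (x.1, x.2.1) with he
  have hx' : dist e e₀ < r ∧ |x.2.2| < r := by simpa [Prod.dist_eq] using hx
  have hseg : ∀ u ∈ uIcc 0 x.2.2, (e, u) ∈ Metric.ball (e₀, (0 : ℝ)) r := fun u hu => by
    have h1 : |u| ≤ |x.2.2| := by simpa using abs_sub_left_of_mem_uIcc hu
    simpa [Prod.dist_eq] using And.intro hx'.1 (h1.trans_lt hx'.2)
  have hzΛ : ∀ u ∈ uIcc 0 x.2.2, dw z (e, u) = u * Λ (e, u) := fun u hu => by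
    have h0 : l (e, 0) = 0 := by
      rw [(hball _ (hseg 0 left_mem_uIcc)).2.2.1, e4]
    rw [← (hball _ (hseg u hu)).2.2.1, hlΛ, h0, zero_add]
  have hc1 : Continuous fun u => u * Λ (e, u) :=
    continuous_id.mul (hΛ.continuous.comp (by fun_prop))
  have hc2 : Continuous fun u => u * Λ (e, u) * m (e, u) :=
    hc1.mul (hms.continuous.comp (by fun_prop))
  have i1 := intervalIntegral.integral_eq_sub_of_hasDerivAt (a := 0) (b := x.2.2)
    (f := fun u => z (e, u)) (f' := fun u => u * Λ (e, u))
    (fun u hu => by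
      rw [← hzΛ u hu]
      exact hasDerivAt_snd_of_differentiableAt
        ((hball _ (hseg u hu)).1.differentiableAt (by simp))) (hc1.intervalIntegrable _ _)
  have i2 := intervalIntegral.integral_eq_sub_of_hasDerivAt (a := 0) (b := x.2.2)
    (f := fun u => h (e, u)) (f' := fun u => u * Λ (e, u) * m (e, u))
    (fun u hu => by
      rw [← hzΛ u hu, (hball _ (hseg u hu)).2.2.2.1, mul_comm, ← (hball _ (hseg u hu)).2.2.2.2]
      exact hasDerivAt_snd_of_differentiableAt
        ((hball _ (hseg u hu)).2.1.differentiableAt (by simp))) (hc2.intervalIntegrable _ _)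
  rw [i1, i2, e1, e2, e3]
  simp

end FoldGerm
end TwoRuled
end

noncomputable section

namespace TwoRuled
open Set MeasureTheory Filter

/-! ### Sufficiency of δ = 0, δ' ≠ 0 when η is transverse to the singular set. -/

section Sufficiency

variable {I : Set ℝ} {γ X Y : ℝ → R4} {t₀ s₀ r₀ : ℝ}

/-- The parametrization `(t, r) ↦ (t, -(b₃ + r a), r)` of the singular set. -/
def singularParam (γ X Y : ℝ → R4) (e : ℝ × ℝ) : R3 :=
  (e.1, -(coeffB3 γ X e.1 + e.2 * coeffA X Y e.1), e.2)

theorem identifier_singularParam (e : ℝ × ℝ) : identifier γ X Y (singularParam γ X Y e) = 0 := by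
  simp [identifier, singularParam]

theorem nullDerivIdentifier_eq (h : IsPseudoNondegenerate I γ X Y) (hI : IsOpen I) {p : R3}
    (hp : p.1 ∈ I) : nullDerivIdentifier γ X Y p = deriv (coeffB3 γ X) p.1 +
      p.2.2 * deriv (coeffA X Y) p.1 - coeffB1 γ X p.1 - coeffB2 γ Y p.1 * coeffA X Y p.1 := by
  rw [nullDerivIdentifier, h.fderiv_identifier hI hp]
  simp [nullField]
  ring

theorem smoothNear_singularParam (h : IsPseudoNondegenerate I γ X Y) (hI : IsOpen I) {e : ℝ × ℝ}
    (he : e.1 ∈ I) : SmoothNear (singularParam γ X Y) e := by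
  have h1 : SmoothNear (fun e : ℝ × ℝ => e.1) e := contDiff_fst.smoothNear e
  have h2 : SmoothNear (fun e : ℝ × ℝ => e.2) e := contDiff_snd.smoothNear e
  exact h1.prodMk (((((h.smoothNear_coeffB3 hI he).comp h1).add
    (h2.mul ((h.smoothNear_coeffA hI he).comp h1))).neg).prodMk h2)

theorem fderiv_singularParam (h : IsPseudoNondegenerate I γ X Y) (hI : IsOpen I) {e : ℝ × ℝ}
    (he : e.1 ∈ I) (v : ℝ × ℝ) : fderiv ℝ (singularParam γ X Y) e v =
      (v.1, -(v.1 * (deriv (coeffB3 γ X) e.1 + e.2 * deriv (coeffA X Y) e.1) +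
        v.2 * coeffA X Y e.1), v.2) := by
  have hb := (h.smoothNear_coeffB3 hI he).differentiableAt.hasDerivAt
  have ha := (h.smoothNear_coeffA hI he).differentiableAt.hasDerivAt
  have h1 : HasFDerivAt (fun p : ℝ × ℝ => p.1) (ContinuousLinearMap.fst ℝ ℝ ℝ) e := hasFDerivAt_fst
  have h2 : HasFDerivAt (fun p : ℝ × ℝ => p.2) (ContinuousLinearMap.snd ℝ ℝ ℝ) e := hasFDerivAt_snd
  have : HasFDerivAt (singularParam γ X Y) _ e := h1.prodMk
    ((((hb.comp_hasFDerivAt e h1).add (h2.mul (ha.comp_hasFDerivAt e h1))).neg).prodMk h2)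
  rw [this.fderiv]
  ext <;> simp
  ring

/-- Since Z' = -δX', the slope -⟨w, Z⟩ / ⟨z, Z⟩ of the plane orthogonal to Z changes at a rate
divisible by δ. -/
theorem hasDerivAt_tilt (h : IsPseudoNondegenerate I γ X Y) (hI : IsOpen I) {t : ℝ} (ht : t ∈ I)
    (w z : R4) (hz : ⟪z, frameZ X Y t⟫ ≠ 0) :
    HasDerivAt (fun t => -⟪w, frameZ X Y t⟫ / ⟪z, frameZ X Y t⟫)
      (coeffDelta X Y t * ((⟪w, deriv X t⟫ * ⟪z, frameZ X Y t⟫ -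
        ⟪w, frameZ X Y t⟫ * ⟪z, deriv X t⟫) / ⟪z, frameZ X Y t⟫ ^ 2)) t := by
  have hZ := (h.smoothNear_frameZ hI ht).differentiableAt.hasDerivAt
  rw [h.deriv_frameZ hI ht] at hZ
  have h1 := hasDerivAt_inner (hasDerivAt_const t w) hZ
  have h2 := hasDerivAt_inner (hasDerivAt_const t z) hZ
  rw [inner_zero_left, inner_smul_right, add_zero] at h1 h2
  have h3 := h1.fun_neg.fun_div h2 hz
  refine h3.congr_deriv ?_
  ring

/-- Q(e, v) runs along the curve on which both ⟨f, X(t₀)⟩ and ⟨f, Y(t₀)⟩ are constant, from its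
singular point at v = 0, with t = e.1 + v. Along such curves f moves in a plane, which the condition
of being orthogonal to Z(t) cuts to a line. This supplies the relation dk = μ dz required by
`aequivalent_of_fold_germ`. -/
theorem IsPseudoNondegenerateFrontal.aequivalent_of_adapted_chart
    (h : IsPseudoNondegenerateFrontal I γ X Y) (hI : IsOpen I) (ht : t₀ ∈ I)
    (hη : nullDerivIdentifier γ X Y (t₀, s₀, r₀) ≠ 0) (hδ : coeffDelta X Y t₀ = 0)
    (hδ' : deriv (coeffDelta X Y) t₀ ≠ 0) {ξ : ℝ × ℝ → ℝ × ℝ} {Q : (ℝ × ℝ) × ℝ → R3}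
    (hξs : SmoothNear ξ (t₀, r₀)) (hξd : ∀ v, fderiv ℝ ξ (t₀, r₀) v = 0 → v = 0)
    (hQs : SmoothNear Q ((t₀, r₀), 0)) (hQq : Q ((t₀, r₀), 0) = (t₀, s₀, r₀))
    (hQt : ∀ᶠ q in 𝓝 ((t₀, r₀), (0 : ℝ)), (Q q).1 = q.1.1 + q.2)
    (hQξ : ∀ᶠ q in 𝓝 ((t₀, r₀), (0 : ℝ)), ⟪twoRuled γ X Y (Q q), X t₀⟫ = (ξ q.1).1 ∧
      ⟪twoRuled γ X Y (Q q), Y t₀⟫ = (ξ q.1).2)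
    (hQc : ∀ᶠ e in 𝓝 (t₀, r₀), identifier γ X Y (Q (e, 0)) = 0) :
    AEquivalent (twoRuled γ X Y) (t₀, s₀, r₀) crossCapInterval 0 := by
  set f := twoRuled γ X Y with hf
  set p : R3 := (t₀, s₀, r₀) with hp
  set e₀ : ℝ × ℝ := (t₀, r₀) with he₀
  set q₀ : (ℝ × ℝ) × ℝ := (e₀, 0) with hq₀
  have hfs : SmoothNear f p := h.smoothNear_twoRuled hI ht
  set F : (ℝ × ℝ) × ℝ → R4 := fun q => f (Q q) with hF
  have hFs : SmoothNear F q₀ := hfs.comp_of_eq hQs hQq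
  have hi : Tendsto (fun e : ℝ × ℝ => (e, (0 : ℝ))) (𝓝 e₀) (𝓝 q₀) :=
    Continuous.tendsto (by fun_prop) e₀
  have hfib : ∀ {φ : (ℝ × ℝ) × ℝ → Prop}, (∀ᶠ q in 𝓝 q₀, φ q) →
      ∀ᶠ q in 𝓝 q₀, ∀ᶠ u in 𝓝 q.2, φ (q.1, u) := fun {φ} hφ => by
    filter_upwards [hφ.eventually_nhds] with q hq
    exact (Continuous.tendsto' (by fun_prop) q.2 q rfl :
      Tendsto (fun u : ℝ => (q.1, u)) (𝓝 q.2) (𝓝 q)).eventually hq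
  have hFd : ∀ᶠ q in 𝓝 q₀, HasDerivAt (fun u => F (q.1, u)) (dw F q) q.2 := by
    filter_upwards [hFs] with q hq
    exact hasDerivAt_snd_of_differentiableAt (hq.differentiableAt (by simp))
  have hQd : ∀ᶠ q in 𝓝 q₀, HasDerivAt (fun u => Q (q.1, u)) (dw Q q) q.2 := by
    filter_upwards [hQs] with q hq
    exact hasDerivAt_snd_of_differentiableAt (hq.differentiableAt (by simp))
  have hwd : ∀ u : R4, ∀ᶠ q in 𝓝 q₀, dw (fun q => ⟪F q, u⟫) q = ⟪dw F q, u⟫ := fun u => by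
    filter_upwards [hFs, hFd] with q hq hd
    have h1 : DifferentiableAt ℝ (fun q => ⟪F q, u⟫) q :=
      (hq.differentiableAt (by simp)).inner ℝ (differentiableAt_const u)
    have := (hasDerivAt_snd_of_differentiableAt (y := q.1) (w := q.2) h1).unique
      (hasDerivAt_inner hd (hasDerivAt_const q.2 u))
    simpa using this
  have hQ1 : Tendsto (fun q => (Q q).1) (𝓝 q₀) (𝓝 t₀) := by
    have := (continuous_fst.tendsto (Q q₀)).comp hQs.continuousAt
    rw [hQq] at this
    exact this
  have hQI : ∀ᶠ q in 𝓝 q₀, (Q q).1 ∈ I := hQ1.eventually (hI.mem_nhds ht)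
  -- the velocity of the last variable
  have hw1 : ∀ᶠ q in 𝓝 q₀, (dw Q q).1 = 1 := by
    filter_upwards [hQd, hfib hQt] with q hq hq1
    have h1 : HasDerivAt (fun u : ℝ => q.1.1 + u) 1 q.2 := (hasDerivAt_id _).const_add _
    have h2 : HasDerivAt (fun u => (Q (q.1, u)).1) (dw Q q).1 q.2 := hq.fst
    exact h2.unique (h1.congr_of_eventuallyEq hq1)
  have hΨ : ∀ᶠ q in 𝓝 q₀, dw F q = (coeffB1 γ X (Q q).1 + (dw Q q).2.1) • X (Q q).1 +
      (coeffB2 γ Y (Q q).1 + (dw Q q).2.2) • Y (Q q).1 +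
      identifier γ X Y (Q q) • deriv X (Q q).1 := by
    filter_upwards [hFd, hQd, hw1, hQI] with q h1 h2 h3 h4
    have h5 : HasFDerivAt f (fderiv ℝ f (Q q)) (Q q) :=
      (h.smoothNear_twoRuled hI h4).differentiableAt.hasFDerivAt
    have h6 : HasFDerivAt f (fderiv ℝ f (Q q)) (Q (q.1, q.2)) := h5
    have h7 : HasDerivAt (fun u => F (q.1, u)) (fderiv ℝ f (Q q) (dw Q q)) q.2 :=
      HasFDerivAt.comp_hasDerivAt (l := f) (f := fun u => Q (q.1, u)) q.2 h6 h2
    rw [h1.unique h7, hf, h.fderiv_twoRuled hI h4, h3]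
    simp only [one_mul]
  have hΨX : ∀ᶠ q in 𝓝 q₀, ⟪dw F q, X t₀⟫ = 0 ∧ ⟪dw F q, Y t₀⟫ = 0 := by
    filter_upwards [hFd, hfib hQξ] with q h1 h2
    have h3 := hasDerivAt_inner h1 (hasDerivAt_const q.2 (X t₀))
    have h4 := hasDerivAt_inner h1 (hasDerivAt_const q.2 (Y t₀))
    rw [inner_zero_right, zero_add] at h3 h4
    exact ⟨h3.unique ((hasDerivAt_const _ (ξ q.1).1).congr_of_eventuallyEq (h2.mono fun _ h => h.1)),
      h4.unique ((hasDerivAt_const _ (ξ q.1).2).congr_of_eventuallyEq (h2.mono fun _ h => h.2))⟩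
  -- along the singular set the velocity is in the null direction
  have hD : ∀ᶠ t in 𝓝 t₀, ⟪X t, X t₀⟫ * ⟪Y t, Y t₀⟫ - ⟪Y t, X t₀⟫ * ⟪X t, Y t₀⟫ ≠ 0 := by
    have hX := (h.smoothNear_fst hI ht).continuousAt
    have hY := (h.smoothNear_snd hI ht).continuousAt
    have : ContinuousAt
        (fun t => ⟪X t, X t₀⟫ * ⟪Y t, Y t₀⟫ - ⟪Y t, X t₀⟫ * ⟪X t, Y t₀⟫) t₀ := by fun_prop
    refine this.eventually_ne ?_
    rw [h.inner_fst_fst ht, h.inner_snd_snd ht, h.inner_fst_snd t₀ ht]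
    norm_num
  have hnull : ∀ᶠ e in 𝓝 e₀, coeffB1 γ X (Q (e, 0)).1 + (dw Q (e, 0)).2.1 = 0 ∧
      coeffB2 γ Y (Q (e, 0)).1 + (dw Q (e, 0)).2.2 = 0 := by
    filter_upwards [hi.eventually hΨ, hi.eventually hΨX, hQc, (hQ1.comp hi).eventually hD] with
      e h1 h2 h3 h4
    rw [h3, zero_smul, add_zero] at h1
    simp only [h1, inner_add_left, real_inner_smul_left] at h2
    obtain ⟨h5, h6⟩ := h2
    simp only [Function.comp_apply] at h4
    constructor
    · refine (mul_eq_zero.1 ?_).resolve_right h4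
      linear_combination ⟪Y (Q (e, 0)).1, Y t₀⟫ * h5 - ⟪Y (Q (e, 0)).1, X t₀⟫ * h6
    · refine (mul_eq_zero.1 ?_).resolve_right h4
      linear_combination ⟪X (Q (e, 0)).1, X t₀⟫ * h6 - ⟪X (Q (e, 0)).1, Y t₀⟫ * h5
  have hΨ0 : ∀ᶠ e in 𝓝 e₀, dw F (e, 0) = 0 := by
    filter_upwards [hi.eventually hΨ, hnull, hQc] with e h1 h2 h3
    rw [h1, h2.1, h2.2, h3]
    simp
  -- the fold components
  set z : (ℝ × ℝ) × ℝ → ℝ := fun q => ⟪F q, deriv X t₀⟫ with hz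
  set k : (ℝ × ℝ) × ℝ → ℝ := fun q => ⟪F q, frameZ X Y t₀⟫ with hk
  have hzs : SmoothNear z q₀ := hFs.inner (contDiff_const.smoothNear q₀)
  have hks : SmoothNear k q₀ := hFs.inner (contDiff_const.smoothNear q₀)
  have hz0 : ∀ᶠ e in 𝓝 e₀, dw z (e, 0) = 0 := by
    filter_upwards [hi.eventually (hwd (deriv X t₀)), hΨ0] with e h1 h2
    rw [h1, h2, inner_zero_left]
  -- The velocity of f vanishes at q₀, so its product with X'(t) has the same derivative there as
  -- its product with the frozen X'(t₀). The former product is λ along the curve, and the curve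
  -- starts in the direction η, so the derivative is ηλ.
  have hz1 : dw (dw z) q₀ ≠ 0 := by
    have h1 : HasDerivAt (fun u => dw F (e₀, u)) (dw (dw F) q₀) 0 :=
      hasDerivAt_snd_of_differentiableAt hFs.dw.differentiableAt
    have h2 : HasDerivAt (fun u => Q (e₀, u)) (dw Q q₀) 0 :=
      hasDerivAt_snd_of_differentiableAt hQs.differentiableAt
    have h3 : HasDerivAt (fun u => deriv X (Q (e₀, u)).1) _ 0 :=
      HasDerivAt.scomp (h := fun u => (Q (e₀, u)).1) (0 : ℝ)
        (hQq ▸ (h.smoothNear_fst hI ht).deriv.differentiableAt.hasDerivAt :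
          HasDerivAt (deriv X) (deriv (deriv X) t₀) (Q (e₀, 0)).1) h2.fst
    have h4 : HasDerivAt (fun u => identifier γ X Y (Q (e₀, u)))
        (fderiv ℝ (identifier γ X Y) p (dw Q q₀)) 0 := by
      have hp' : HasFDerivAt (identifier γ X Y) (fderiv ℝ (identifier γ X Y) p) (Q (e₀, 0)) := by
        rw [hQq]
        exact (h.smoothNear_identifier hI (p := p) ht).differentiableAt.hasFDerivAt
      exact HasFDerivAt.comp_hasDerivAt (l := identifier γ X Y) (f := fun u => Q (e₀, u))
        (0 : ℝ) hp' h2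
    have h5 : dw F (e₀, 0) = 0 := hΨ0.self_of_nhds
    have h6 := hasDerivAt_inner h1 h3
    rw [h5, inner_zero_left, zero_add, hQq] at h6
    have h7 : (fun u => ⟪dw F (e₀, u), deriv X (Q (e₀, u)).1⟫) =ᶠ[𝓝 0]
        fun u => identifier γ X Y (Q (e₀, u)) := by
      have : Tendsto (fun u : ℝ => (e₀, u)) (𝓝 0) (𝓝 q₀) := Continuous.tendsto (by fun_prop) 0
      filter_upwards [this.eventually hΨ, this.eventually hQI] with u h8 h9
      rw [h8]
      exact h.inner_comb_deriv hI h9 _ _ _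
    have h8 := h6.unique (h4.congr_of_eventuallyEq h7)
    have h9 : dw Q q₀ = nullField γ X Y p := by
      have g1 : (dw Q q₀).1 = 1 := hw1.self_of_nhds
      have g2 := hnull.self_of_nhds
      rw [← hq₀, hQq] at g2
      exact Prod.ext g1 (Prod.ext (eq_neg_of_add_eq_zero_right g2.1)
        (eq_neg_of_add_eq_zero_right g2.2))
    have h10 : HasDerivAt (fun u => dw z (e₀, u)) (dw (dw z) q₀) 0 :=
      hasDerivAt_snd_of_differentiableAt hzs.dw.differentiableAt
    have h11 := hasDerivAt_inner h1 (hasDerivAt_const (0 : ℝ) (deriv X t₀))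
    have h12 : (fun u => dw z (e₀, u)) =ᶠ[𝓝 0] fun u => ⟪dw F (e₀, u), deriv X t₀⟫ := by
      have : Tendsto (fun u : ℝ => (e₀, u)) (𝓝 0) (𝓝 q₀) := Continuous.tendsto (by fun_prop) 0
      exact this.eventually (hwd _)
    rw [h10.unique (h11.congr_of_eventuallyEq h12), inner_zero_right, zero_add]
    have h13 : ⟪dw (dw F) q₀, deriv X t₀⟫ = nullDerivIdentifier γ X Y p := by
      rw [nullDerivIdentifier, ← h9]
      exact h8
    rw [h13]
    exact hη
  -- the ratio of the fold components
  set m : ℝ → ℝ := fun t => -⟪deriv X t₀, frameZ X Y t⟫ / ⟪frameZ X Y t₀, frameZ X Y t⟫ with hm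
  have hZs := h.smoothNear_frameZ hI ht
  have hZZ : ⟪frameZ X Y t₀, frameZ X Y t₀⟫ = 1 := h.inner_frameZ_frameZ hI ht
  have hZne : ∀ᶠ t in 𝓝 t₀, ⟪frameZ X Y t₀, frameZ X Y t⟫ ≠ 0 :=
    ContinuousAt.eventually_ne (continuousAt_const.inner hZs.continuousAt) (by rw [hZZ]; norm_num)
  have hms : SmoothNear m t₀ :=
    ((SmoothNear.inner (contDiff_const.smoothNear t₀) hZs).neg).div
      (SmoothNear.inner (contDiff_const.smoothNear t₀) hZs) (by rw [hZZ]; norm_num)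
  have hsum : Tendsto (fun q : (ℝ × ℝ) × ℝ => q.1.1 + q.2) (𝓝 q₀) (𝓝 t₀) :=
    Continuous.tendsto' (by fun_prop) _ _ (by simp [q₀, e₀])
  set μ : (ℝ × ℝ) × ℝ → ℝ := fun q => m (q.1.1 + q.2) with hμ
  have hμs : SmoothNear μ q₀ :=
    hms.comp_of_eq (ContDiff.smoothNear (f := fun q : (ℝ × ℝ) × ℝ => q.1.1 + q.2) (by fun_prop) q₀)
      (by simp [q₀, e₀])
  -- The velocity is dz·X'(t₀) + dk·Z(t₀); pairing it with Z(t) gives zero, which is solved for dk.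
  have hkz : ∀ᶠ q in 𝓝 q₀, dw k q = μ q * dw z q := by
    filter_upwards [hΨ, hΨX, hwd (deriv X t₀), hwd (frameZ X Y t₀), hQt, hsum.eventually hZne] with
      q h1 h2 h3 h4 h5 h6
    have h7 := h.eq_sum_frame hI ht (dw F q)
    rw [h2.1, h2.2, ← h3, ← h4, zero_smul, zero_smul, zero_add, zero_add] at h7
    have h8 : ⟪dw F q, frameZ X Y (Q q).1⟫ = 0 := by
      rw [h1]; exact IsPseudoNondegenerate.inner_comb_frameZ _ _ _
    rw [h7, inner_add_left, real_inner_smul_left, real_inner_smul_left, h5] at h8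
    simp only [hμ, hm]
    field_simp
    linear_combination h8
  have hdμ : ∀ᶠ e in 𝓝 e₀, dw μ (e, 0) = deriv m e.1 := by
    filter_upwards [hi.eventually hμs, (continuous_fst.tendsto e₀).eventually hms] with e h1 h2
    have h3 : HasDerivAt m (deriv m e.1) (e.1 + 0) := by
      rw [add_zero]; exact (h2.differentiableAt (by simp)).hasDerivAt
    have h4 : HasDerivAt (fun u : ℝ => e.1 + u) 1 0 := (hasDerivAt_id _).const_add _
    have h5 := (hasDerivAt_snd_of_differentiableAt (y := e) (w := 0)
      (h1.differentiableAt (by simp))).unique (h3.comp (0 : ℝ) h4)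
    simpa using h5
  have hdm : deriv m =ᶠ[𝓝 t₀] fun t => coeffDelta X Y t *
      ((⟪deriv X t₀, deriv X t⟫ * ⟪frameZ X Y t₀, frameZ X Y t⟫ -
        ⟪deriv X t₀, frameZ X Y t⟫ * ⟪frameZ X Y t₀, deriv X t⟫) /
          ⟪frameZ X Y t₀, frameZ X Y t⟫ ^ 2) := by
    filter_upwards [hZne, hI.mem_nhds ht] with t h1 h2
    exact (hasDerivAt_tilt h.toIsPseudoNondegenerate hI h2 _ _ h1).deriv
  have hμ0 : dw μ q₀ = 0 := by
    rw [hdμ.self_of_nhds, hdm.self_of_nhds]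
    simp only [hδ, zero_mul]
  -- m' is δ times a smooth factor equal to 1 at t₀; as δ(t₀) = 0, its derivative there is δ'(t₀).
  have hμ1 : fderiv ℝ (fun e => dw μ (e, 0)) e₀ (1, 0) ≠ 0 := by
    have hWs := (h.smoothNear_fst hI ht).deriv
    have hc1 : SmoothNear (fun _ : ℝ => deriv X t₀) t₀ := contDiff_const.smoothNear t₀
    have hc2 : SmoothNear (fun _ : ℝ => frameZ X Y t₀) t₀ := contDiff_const.smoothNear t₀
    have hn : SmoothNear (fun t => (⟪deriv X t₀, deriv X t⟫ * ⟪frameZ X Y t₀, frameZ X Y t⟫ -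
        ⟪deriv X t₀, frameZ X Y t⟫ * ⟪frameZ X Y t₀, deriv X t⟫) /
          (⟪frameZ X Y t₀, frameZ X Y t⟫ * ⟪frameZ X Y t₀, frameZ X Y t⟫)) t₀ :=
      (((hc1.inner hWs).mul (hc2.inner hZs)).sub ((hc1.inner hZs).mul (hc2.inner hWs))).div
        ((hc2.inner hZs).mul (hc2.inner hZs)) (by rw [hZZ]; norm_num)
    simp only [← pow_two] at hn
    have h1 := (h.smoothNear_coeffDelta hI ht).differentiableAt.hasDerivAt.mul
      hn.differentiableAt.hasDerivAt
    have h2 := h1.congr_of_eventuallyEq hdm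
    rw [hδ, hZZ, h.inner_deriv_deriv ht, IsPseudoNondegenerate.inner_frameZ_deriv] at h2
    have h3 : HasFDerivAt (fun e : ℝ × ℝ => deriv m e.1) _ e₀ :=
      HasFDerivAt.comp (g := deriv m) (f := Prod.fst) e₀ h2.hasFDerivAt hasFDerivAt_fst
    rw [(h3.congr_of_eventuallyEq hdμ).fderiv]
    simpa using hδ'
  -- assembly
  have hfold := aequivalent_of_fold_germ hξs hzs hks hμs hξd hz0 hz1 hkz hμ0 hμ1
  set Q' : R3 → R3 := fun x => Q ((x.1, x.2.1), x.2.2) with hQ'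
  have hQ's : SmoothNear Q' (t₀, r₀, 0) :=
    hQs.comp_of_eq (ContDiff.smoothNear
      (f := fun x : R3 => ((x.1, x.2.1), x.2.2)) (by fun_prop) (t₀, r₀, 0)) rfl
  have hj : Tendsto (fun x : R3 => ((x.1, x.2.1), x.2.2)) (𝓝 (t₀, r₀, 0)) (𝓝 q₀) :=
    Continuous.tendsto (by fun_prop) (t₀, r₀, 0)
  -- A kernel vector of dQ' is killed by the differential of ξ, hence has no e-part; the component t
  -- = e.1 + v then kills the last entry.
  have hQ'd : IsLocalDiffeomorphAt 𝓘(ℝ, R3) 𝓘(ℝ, R3) ∞ Q' (t₀, r₀, 0) := by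
    refine hQ's.isLocalDiffeomorphAt fun v hv => ?_
    have h1 := hasDerivAt_zero_of_fderiv_eq_zero hQ's.differentiableAt hv
    have hl : Tendsto (fun u : ℝ => ((t₀, r₀, 0) : R3) + u • v) (𝓝 0) (𝓝 (t₀, r₀, 0)) :=
      Continuous.tendsto' (by fun_prop) _ _ (by simp)
    have h2 : HasDerivAt (fun u : ℝ => f (Q' ((t₀, r₀, 0) + u • v))) 0 0 := by
      have : HasFDerivAt f (fderiv ℝ f p) (Q' ((t₀, r₀, 0) + (0 : ℝ) • v)) := by
        rw [zero_smul, add_zero]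
        exact (show Q' (t₀, r₀, 0) = p from hQq) ▸ hfs.differentiableAt.hasFDerivAt
      have h2 := HasFDerivAt.comp_hasDerivAt (l := f)
        (f := fun u : ℝ => Q' ((t₀, r₀, 0) + u • v)) (0 : ℝ) this h1
      rw [map_zero] at h2
      exact h2
    have h3 : HasDerivAt (fun u : ℝ => ξ (e₀ + u • (v.1, v.2.1))) 0 0 := by
      have g1 := hasDerivAt_inner h2 (hasDerivAt_const (0 : ℝ) (X t₀))
      have g2 := hasDerivAt_inner h2 (hasDerivAt_const (0 : ℝ) (Y t₀))
      rw [inner_zero_right, inner_zero_left, add_zero] at g1 g2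
      refine (g1.prodMk g2).congr_of_eventuallyEq ?_
      filter_upwards [hl.eventually (hj.eventually hQξ)] with u hu
      exact Prod.ext hu.1.symm hu.2.symm
    have h4 := hξd (v.1, v.2.1) ((hξs.differentiableAt.hasFDerivAt.hasLineDerivAt _).unique h3)
    have h5 : HasDerivAt (fun u : ℝ => (t₀ + u * v.1) + (0 + u * v.2.2)) (v.1 + v.2.2) 0 := by
      have g1 := (((hasDerivAt_id (0 : ℝ)).mul_const v.1).const_add t₀).fun_add
        (((hasDerivAt_id (0 : ℝ)).mul_const v.2.2).const_add 0)
      simpa using g1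
    have h6 : v.1 + v.2.2 = 0 := by
      have h1' : HasDerivAt (fun u : ℝ => (Q' ((t₀, r₀, 0) + u • v)).1) 0 0 := h1.fst
      refine h5.unique (h1'.congr_of_eventuallyEq ?_)
      filter_upwards [hl.eventually (hj.eventually hQt)] with u hu
      exact hu.symm
    have h7 : v.1 = 0 := congrArg Prod.fst h4
    exact Prod.ext h7 (Prod.ext (congrArg Prod.snd h4) (by simpa [h7] using h6))
  have hQ'q : Q' (t₀, r₀, 0) = p := hQq
  have hfQ' : AEquivalent f p (fun x => f (Q' x)) (t₀, r₀, 0) := by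
    have h1 := aequivalent_comp_right (f := f) hQ'd
    rw [hQ'q] at h1
    exact h1.symm (hfs.comp_of_eq hQ's hQ'q).continuousAt
  -- The target chart is linear: coordinates in the frozen frame at t₀.
  have hL : IsLocalDiffeomorphAt 𝓘(ℝ, R4) 𝓘(ℝ, R4) ∞ (h.frame hI ht).repr (f p) :=
    ((h.frame hI ht).repr.toContinuousLinearEquiv.toDiffeomorph.isLocalDiffeomorph) (f p)
  have hfL : AEquivalent (fun x => f (Q' x)) (t₀, r₀, 0)
      (fun x => (h.frame hI ht).repr (f (Q' x))) (t₀, r₀, 0) :=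
    aequivalent_comp_left (by rw [hQ'q]; exact hL)
  refine (hfQ'.trans hfL).trans (hfold.congr ?_ (.of_forall fun _ => rfl))
  filter_upwards [hj.eventually hQξ] with x hx
  ext i
  rw [OrthonormalBasis.repr_apply_apply, h.coe_frame hI ht, real_inner_comm]
  fin_cases i
  · exact hx.1
  · exact hx.2
  · rfl
  · rfl

/-- What remains is to construct the adapted chart. Two inverse function arguments are involved: one
for (⟨f, X(t₀)⟩, ⟨f, Y(t₀)⟩, t), valid without any transversality, and one for ξ, the first two of
these restricted to the singular set, which needs ηλ ≠ 0. -/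
theorem IsPseudoNondegenerateFrontal.aequivalent_crossCapInterval
    (h : IsPseudoNondegenerateFrontal I γ X Y) (hI : IsOpen I) (ht : t₀ ∈ I)
    (hsing : identifier γ X Y (t₀, s₀, r₀) = 0)
    (hη : nullDerivIdentifier γ X Y (t₀, s₀, r₀) ≠ 0) (hδ : coeffDelta X Y t₀ = 0)
    (hδ' : deriv (coeffDelta X Y) t₀ ≠ 0) :
    AEquivalent (twoRuled γ X Y) (t₀, s₀, r₀) crossCapInterval 0 := by
  set p : R3 := (t₀, s₀, r₀) with hp
  set e₀ : ℝ × ℝ := (t₀, r₀) with he₀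
  set f := twoRuled γ X Y with hf
  set c := singularParam γ X Y with hc
  set X₀ := X t₀ with hX₀
  set Y₀ := Y t₀ with hY₀
  set W₀ := deriv X t₀ with hW₀
  set Z₀ := frameZ X Y t₀ with hZ₀
  have hXX : ⟪X₀, X₀⟫ = 1 := h.inner_fst_fst ht
  have hYY : ⟪Y₀, Y₀⟫ = 1 := h.inner_snd_snd ht
  have hWW : ⟪W₀, W₀⟫ = 1 := h.inner_deriv_deriv ht
  have hZZ : ⟪Z₀, Z₀⟫ = 1 := h.inner_frameZ_frameZ hI ht
  have hXY : ⟪X₀, Y₀⟫ = 0 := h.inner_fst_snd t₀ ht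
  have hXW : ⟪X₀, W₀⟫ = 0 := h.inner_fst_deriv hI ht
  have hYW : ⟪Y₀, W₀⟫ = 0 := h.inner_snd_deriv_fst hI ht
  have hZW : ⟪Z₀, W₀⟫ = 0 := IsPseudoNondegenerate.inner_frameZ_deriv
  have hcp : c e₀ = p := by
    have : coeffB3 γ X t₀ + s₀ + r₀ * coeffA X Y t₀ = 0 := hsing
    simp only [hc, singularParam, hp, he₀]
    ext <;> simp
    linarith
  have hfs : SmoothNear f p := h.smoothNear_twoRuled hI ht
  have hcs : SmoothNear c e₀ := smoothNear_singularParam h.toIsPseudoNondegenerate hI ht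
  have hfcs : SmoothNear (fun e => f (c e)) e₀ := hfs.comp_of_eq hcs hcp
  have hconst : ∀ (u : R4) {E : Type} [NormedAddCommGroup E] [NormedSpace ℝ E] (x : E),
    SmoothNear (fun _ : E => u) x := fun u _ _ _ x => contDiff_const.smoothNear x
  have hfcd : ∀ v : ℝ × ℝ, HasFDerivAt (fun e => f (c e))
      ((fderiv ℝ f p).comp (fderiv ℝ c e₀)) e₀ := fun v =>
    (hcp ▸ hfs.differentiableAt.hasFDerivAt : HasFDerivAt f (fderiv ℝ f p) (c e₀)).comp e₀
      hcs.differentiableAt.hasFDerivAt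
  have hη' := hη
  rw [nullDerivIdentifier_eq h.toIsPseudoNondegenerate hI ht] at hη'
  -- the first two components along the singular set
  set ξ : ℝ × ℝ → ℝ × ℝ := fun e => (⟪f (c e), X₀⟫, ⟪f (c e), Y₀⟫) with hξ
  have hξs : SmoothNear ξ e₀ :=
    (hfcs.inner (hconst _ _)).prodMk (hfcs.inner (hconst _ _))
  have hξd : ∀ v, fderiv ℝ ξ e₀ v = 0 → v = 0 := fun v hv => by
    have h1 : HasDerivAt (fun t : ℝ => f (c (e₀ + t • v))) (fderiv ℝ f p (fderiv ℝ c e₀ v)) 0 :=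
      (hfcd v).hasLineDerivAt v
    have h2 := hasDerivAt_zero_of_fderiv_eq_zero hξs.differentiableAt hv
    have h3 : ⟪fderiv ℝ f p (fderiv ℝ c e₀ v), X₀⟫ = 0 := by
      have := (hasDerivAt_inner h1 (hasDerivAt_const 0 X₀)).unique h2.fst
      simpa using this
    have h4 : ⟪fderiv ℝ f p (fderiv ℝ c e₀ v), Y₀⟫ = 0 := by
      have := (hasDerivAt_inner h1 (hasDerivAt_const 0 Y₀)).unique h2.snd
      simpa using this
    rw [hc, fderiv_singularParam h.toIsPseudoNondegenerate hI ht, hf,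
      h.fderiv_twoRuled hI ht, hsing] at h3 h4
    replace h3 := (h.inner_comb_fst hI ht _ _ _).symm.trans h3
    replace h4 := (h.inner_comb_snd hI ht _ _ _).symm.trans h4
    dsimp only [p, e₀] at h3 h4
    -- Eliminating v.2 from the two linear equations leaves v.1·ηλ(p) = 0.
    have h5 : v.1 * (deriv (coeffB3 γ X) t₀ + r₀ * deriv (coeffA X Y) t₀ - coeffB1 γ X t₀ -
        coeffB2 γ Y t₀ * coeffA X Y t₀) = 0 := by
      linear_combination -h3 - coeffA X Y t₀ * h4
    have h6 : v.1 = 0 := (mul_eq_zero.1 h5).resolve_right hη'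
    exact Prod.ext h6 (by simpa [h6] using h4)
  -- the chart `(⟨f, X₀⟩, ⟨f, Y₀⟩, t)`
  set A : R3 → R3 := fun x => (⟪f x, X₀⟫, ⟪f x, Y₀⟫, x.1) with hA
  have hAs : SmoothNear A p :=
    (hfs.inner (hconst _ _)).prodMk ((hfs.inner (hconst _ _)).prodMk (contDiff_fst.smoothNear p))
  have hAd : IsLocalDiffeomorphAt 𝓘(ℝ, R3) 𝓘(ℝ, R3) ∞ A p := by
    refine hAs.isLocalDiffeomorphAt fun v hv => ?_
    have h1 : HasDerivAt (fun t : ℝ => f (p + t • v)) (fderiv ℝ f p v) 0 :=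
      hfs.differentiableAt.hasFDerivAt.hasLineDerivAt v
    have h2 := hasDerivAt_zero_of_fderiv_eq_zero hAs.differentiableAt hv
    have h3 : ⟪fderiv ℝ f p v, X₀⟫ = 0 := by
      have := (hasDerivAt_inner h1 (hasDerivAt_const 0 X₀)).unique h2.fst
      simpa using this
    have h4 : ⟪fderiv ℝ f p v, Y₀⟫ = 0 := by
      have := (hasDerivAt_inner h1 (hasDerivAt_const 0 Y₀)).unique h2.snd.fst
      simpa using this
    have h5 : v.1 = 0 := by
      have h6 : HasDerivAt (fun t : ℝ => p.1 + t * v.1) v.1 0 := by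
        simpa using ((hasDerivAt_id (0 : ℝ)).mul_const v.1).const_add p.1
      exact h6.unique h2.snd.snd
    rw [hf, h.fderiv_twoRuled hI ht, h5] at h3 h4
    replace h3 := (h.inner_comb_fst hI ht _ _ _).symm.trans h3
    replace h4 := (h.inner_comb_snd hI ht _ _ _).symm.trans h4
    exact Prod.ext h5 (Prod.ext (by simpa using h3) (by simpa using h4))
  obtain ⟨P, hPd, hPA, hPleft, hPright⟩ := hAd.exists_inverse
  -- the adapted source chart
  set q₀ : (ℝ × ℝ) × ℝ := (e₀, 0) with hq₀
  set B : (ℝ × ℝ) × ℝ → R3 := fun q => ((ξ q.1).1, (ξ q.1).2, q.1.1 + q.2) with hB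
  have hBq : B q₀ = A p := by
    simp only [hB, hA, hq₀, hξ, hcp, add_zero]
    rfl
  have hBs : SmoothNear B q₀ := by
    have h1 : SmoothNear (fun q : (ℝ × ℝ) × ℝ => ξ q.1) q₀ :=
      hξs.comp (f := Prod.fst) (contDiff_fst.smoothNear q₀)
    exact (h1.clm_comp (ContinuousLinearMap.fst ℝ ℝ ℝ)).prodMk
      ((h1.clm_comp (ContinuousLinearMap.snd ℝ ℝ ℝ)).prodMk (ContDiff.smoothNear (by fun_prop) _))
  -- B(e, 0) = A(c(e)), so Q(e, 0) = c(e) is the singular point of the curve labelled e.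
  set Q : (ℝ × ℝ) × ℝ → R3 := fun q => P (B q) with hQ
  have hQs : SmoothNear Q q₀ := hPd.smoothNear.comp_of_eq hBs hBq
  have hQq : Q q₀ = p := by simp only [hQ, hBq, hPA]
  have hAQ : ∀ᶠ q in 𝓝 q₀, A (Q q) = B q := by
    have := hBs.continuousAt
    rw [ContinuousAt, hBq] at this
    exact this.eventually hPright
  have hQc : ∀ᶠ e in 𝓝 e₀, Q (e, 0) = c e := by
    have h1 : Tendsto c (𝓝 e₀) (𝓝 p) := hcp ▸ hcs.continuousAt
    filter_upwards [h1.eventually hPleft] with e h2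
    rw [← h2]
    simp [hQ, hB, hA, hξ, hc, singularParam]
  refine h.aequivalent_of_adapted_chart hI ht hη hδ hδ' hξs hξd hQs hQq ?_ ?_ ?_
  · filter_upwards [hAQ] with q hq using congrArg (fun x => x.2.2) hq
  · filter_upwards [hAQ] with q hq using
      ⟨congrArg (fun x => x.1) hq, congrArg (fun x => x.2.1) hq⟩
  · filter_upwards [hQc] with e he
    rw [he]
    exact identifier_singularParam e

end Sufficiency
end TwoRuled
end

noncomputable section

namespace TwoRuled
open Set MeasureTheory Filter

/-! ### Necessity, through the conormal of the normal form. -/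

section Necessity

theorem fderiv_crossCapInterval (y v : R3) : fderiv ℝ crossCapInterval y v =
    !₂[v.1, v.2.1, 2 * y.2.2 * v.2.2, v.2.1 * y.2.2 ^ 3 + y.2.1 * (3 * y.2.2 ^ 2 * v.2.2)] := by
  have hd : SmoothNear crossCapInterval y :=
    smoothNear_vec4 (ContDiff.smoothNear (by fun_prop) y) (ContDiff.smoothNear (by fun_prop) y)
      (ContDiff.smoothNear (by fun_prop) y) (ContDiff.smoothNear (by fun_prop) y)
  have h1 : HasDerivAt (fun σ : ℝ => crossCapInterval (y + σ • v)) _ 0 :=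
    hd.differentiableAt.hasFDerivAt.hasLineDerivAt v
  have l : ∀ a b : ℝ, HasDerivAt (fun σ : ℝ => a + σ * b) b 0 := fun a b => by
    simpa using ((hasDerivAt_id (0 : ℝ)).mul_const b).const_add a
  ext i
  have h2 := hasDerivAt_coord h1 i
  refine h2.unique ?_
  fin_cases i
  · exact l y.1 v.1
  · exact l y.2.1 v.2.1
  · refine ((l y.2.2 v.2.2).pow 2).congr_deriv ?_
    simp
  · refine ((l y.2.1 v.2.1).mul ((l y.2.2 v.2.2).pow 3)).congr_deriv ?_
    simp

/-- A conormal of the normal form of the cuspidal cross cap `×` interval. -/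
def crossCapConormal (y : R3) (u : R4) : ℝ :=
  u 3 - y.2.2 ^ 3 * u 1 - 3 / 2 * y.2.1 * y.2.2 * u 2

theorem crossCapConormal_fderiv (y v : R3) :
    crossCapConormal y (fderiv ℝ crossCapInterval y v) = 0 := by
  rw [fderiv_crossCapInterval]
  simp [crossCapConormal]
  ring

theorem SmoothNear.clm_apply {E : Type*} [NormedAddCommGroup E] [NormedSpace ℝ E]
    {N : E → R4 →L[ℝ] R4} {u : E → R4} {x : E} (hN : SmoothNear N x) (hu : SmoothNear u x) :
    SmoothNear (fun y => N y (u y)) x := by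
  filter_upwards [hN, hu] with y h1 h2 using h1.clm_apply h2

theorem SmoothNear.coord {E : Type*} [NormedAddCommGroup E] [NormedSpace ℝ E] {u : E → R4} {x : E}
    (hu : SmoothNear u x) (i : Fin 4) : SmoothNear (fun y => u y i) x :=
  hu.clm_comp (EuclideanSpace.proj (𝕜 := ℝ) i)

variable {I : Set ℝ} {γ X Y : ℝ → R4} {p : R3} {φ : R3 → R3} {Φ : R4 → R4}

theorem IsPseudoNondegenerate.smoothNear_nullField (h : IsPseudoNondegenerate I γ X Y)
    (hI : IsOpen I) (hp : p.1 ∈ I) : SmoothNear (nullField γ X Y) p := by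
  have h1 : SmoothNear (fun p : R3 => p.1) p := contDiff_fst.smoothNear p
  exact (contDiff_const.smoothNear p).prodMk (((h.smoothNear_coeffB1 hI hp).comp h1).neg.prodMk
    ((h.smoothNear_coeffB2 hI hp).comp h1).neg)

theorem eventually_fderiv_comp_eq {f : R3 → R4} (hf : SmoothNear f p)
    (hφ : IsLocalDiffeomorphAt 𝓘(ℝ, R3) 𝓘(ℝ, R3) ∞ φ p)
    (hΦ : IsLocalDiffeomorphAt 𝓘(ℝ, R4) 𝓘(ℝ, R4) ∞ Φ (f p))
    (heq : ∀ᶠ x in 𝓝 p, Φ (f x) = crossCapInterval (φ x)) :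
    ∀ᶠ x in 𝓝 p, ∀ v, fderiv ℝ Φ (f x) (fderiv ℝ f x v) =
      fderiv ℝ crossCapInterval (φ x) (fderiv ℝ φ x v) := by
  have hd : ∀ y, DifferentiableAt ℝ crossCapInterval y := fun y =>
    (smoothNear_vec4 (ContDiff.smoothNear (by fun_prop) y) (ContDiff.smoothNear (by fun_prop) y)
      (ContDiff.smoothNear (by fun_prop) y)
      (ContDiff.smoothNear (by fun_prop) y)).differentiableAt
  filter_upwards [hf, hφ.smoothNear, hf.continuousAt.eventually hΦ.smoothNear,
    heq.eventually_nhds] with x h1 h2 h3 h4 v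
  have e1 : HasFDerivAt (fun x => Φ (f x)) ((fderiv ℝ Φ (f x)).comp (fderiv ℝ f x)) x :=
    HasFDerivAt.comp (g := Φ) (f := f) x (h3.differentiableAt (by simp)).hasFDerivAt
      (h1.differentiableAt (by simp)).hasFDerivAt
  have e2 : HasFDerivAt (fun x => crossCapInterval (φ x))
      ((fderiv ℝ crossCapInterval (φ x)).comp (fderiv ℝ φ x)) x :=
    HasFDerivAt.comp (g := crossCapInterval) (f := φ) x (hd _).hasFDerivAt
      (h2.differentiableAt (by simp)).hasFDerivAt
  exact congrArg (fun L => L v) (e1.unique (e2.congr_of_eventuallyEq h4))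

namespace IsPseudoNondegenerateFrontal

theorem fderiv_twoRuled_nullField (h : IsPseudoNondegenerateFrontal I γ X Y) (hI : IsOpen I)
    (hp : p.1 ∈ I) : fderiv ℝ (twoRuled γ X Y) p (nullField γ X Y p) =
      identifier γ X Y p • deriv X p.1 := by
  rw [h.fderiv_twoRuled hI hp]
  simp [nullField]

theorem fderiv_twoRuled_fst (h : IsPseudoNondegenerateFrontal I γ X Y) (hI : IsOpen I)
    (hp : p.1 ∈ I) : fderiv ℝ (twoRuled γ X Y) p (0, 1, 0) = X p.1 := by
  rw [h.fderiv_twoRuled hI hp]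
  simp

theorem fderiv_twoRuled_snd (h : IsPseudoNondegenerateFrontal I γ X Y) (hI : IsOpen I)
    (hp : p.1 ∈ I) : fderiv ℝ (twoRuled γ X Y) p (0, 0, 1) = Y p.1 := by
  rw [h.fderiv_twoRuled hI hp]
  simp

/-- The conormal of the normal form pulls back to a conormal of the two-ruled frontal. -/
theorem eventually_crossCapConormal_eq_zero (h : IsPseudoNondegenerateFrontal I γ X Y)
    (hI : IsOpen I) (hp : p.1 ∈ I) (hφ : IsLocalDiffeomorphAt 𝓘(ℝ, R3) 𝓘(ℝ, R3) ∞ φ p)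
    (hΦ : IsLocalDiffeomorphAt 𝓘(ℝ, R4) 𝓘(ℝ, R4) ∞ Φ (twoRuled γ X Y p))
    (heq : ∀ᶠ x in 𝓝 p, Φ (twoRuled γ X Y x) = crossCapInterval (φ x)) :
    ∀ᶠ x in 𝓝 p, crossCapConormal (φ x) (fderiv ℝ Φ (twoRuled γ X Y x) (X x.1)) = 0 ∧
      crossCapConormal (φ x) (fderiv ℝ Φ (twoRuled γ X Y x) (Y x.1)) = 0 ∧
      crossCapConormal (φ x) (fderiv ℝ Φ (twoRuled γ X Y x) (deriv X x.1)) = 0 := by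
  have hfs := h.smoothNear_twoRuled hI hp
  have hxI : ∀ᶠ x : R3 in 𝓝 p, x.1 ∈ I := (continuous_fst.tendsto p).eventually (hI.mem_nhds hp)
  set G : R3 → ℝ := fun x =>
    crossCapConormal (φ x) (fderiv ℝ Φ (twoRuled γ X Y x) (deriv X x.1)) with hG
  have hφs := hφ.smoothNear
  have hU : SmoothNear (fun x : R3 => fderiv ℝ Φ (twoRuled γ X Y x) (deriv X x.1)) p :=
    (hΦ.smoothNear.fderiv.comp hfs).clm_apply
      ((h.smoothNear_fst hI hp).deriv.comp (f := fun x : R3 => x.1) (contDiff_fst.smoothNear p))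
  have hGs : ∀ᶠ x in 𝓝 p, ContinuousAt G x := by
    filter_upwards [(hU.coord 1), (hU.coord 2), (hU.coord 3), hφs] with x h1 h2 h3 h4
    have h1 := h1.continuousAt
    have h2 := h2.continuousAt
    have h3 := h3.continuousAt
    have h4 := h4.continuousAt
    simp only [hG, crossCapConormal]
    fun_prop
  have hc := eventually_fderiv_comp_eq hfs hφ hΦ heq
  have hlG : ∀ᶠ x in 𝓝 p, identifier γ X Y x * G x = 0 := by
    filter_upwards [hc, hxI] with x h1 h2
    have h3 := crossCapConormal_fderiv (φ x) (fderiv ℝ φ x (nullField γ X Y x))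
    rw [← h1, h.fderiv_twoRuled_nullField hI h2, map_smul] at h3
    simp only [crossCapConormal, PiLp.smul_apply, smul_eq_mul] at h3
    simp only [hG, crossCapConormal]
    linear_combination h3
  filter_upwards [hc, hxI, hlG.eventually_nhds, hGs] with x h1 h2 h3 h4
  refine ⟨?_, ?_, ?_⟩
  · rw [← h.fderiv_twoRuled_fst hI h2, h1, crossCapConormal_fderiv]
  · rw [← h.fderiv_twoRuled_snd hI h2, h1, crossCapConormal_fderiv]
  · rcases ne_or_eq (identifier γ X Y x) 0 with h5 | h5
    · exact (mul_eq_zero.1 h3.self_of_nhds).resolve_left h5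
    -- Singular points are limits of regular ones: along ∂ₛ the function λ grows with unit speed,
    -- and G is continuous.
    · have hl : Tendsto (fun σ : ℝ => x + σ • ((0, 1, 0) : R3)) (𝓝 0) (𝓝 x) :=
        Continuous.tendsto' (by fun_prop) _ _ (by simp)
      have h6 : Tendsto (fun σ : ℝ => G (x + σ • ((0, 1, 0) : R3))) (𝓝[≠] 0) (𝓝 (G x)) :=
        (h4.tendsto.comp hl).mono_left nhdsWithin_le_nhds
      refine tendsto_nhds_unique h6 (tendsto_const_nhds.congr' ?_)
      filter_upwards [nhdsWithin_le_nhds (hl.eventually h3), self_mem_nhdsWithin] with σ h7 h8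
      have h9 : identifier γ X Y (x + σ • ((0, 1, 0) : R3)) = σ := by
        have : identifier γ X Y (x + σ • ((0, 1, 0) : R3)) = identifier γ X Y x + σ := by
          simp [identifier]
          ring
        rw [this, h5, zero_add]
      rw [h9] at h7
      exact ((mul_eq_zero.1 h7).resolve_left h8).symm

/-- The differential of the source chart along the null field is transverse to the singular set of
the normal form. -/
theorem fderiv_nullField_ne_zero (h : IsPseudoNondegenerateFrontal I γ X Y) (hI : IsOpen I)
    (hp : p.1 ∈ I) (hsing : identifier γ X Y p = 0)
    (hφ : IsLocalDiffeomorphAt 𝓘(ℝ, R3) 𝓘(ℝ, R3) ∞ φ p)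
    (hΦ : IsLocalDiffeomorphAt 𝓘(ℝ, R4) 𝓘(ℝ, R4) ∞ Φ (twoRuled γ X Y p))
    (heq : ∀ᶠ x in 𝓝 p, Φ (twoRuled γ X Y x) = crossCapInterval (φ x)) :
    (fderiv ℝ φ p (nullField γ X Y p)).2.2 ≠ 0 := fun h0 => by
  have h1 := (eventually_fderiv_comp_eq (h.smoothNear_twoRuled hI hp) hφ hΦ heq).self_of_nhds
    (nullField γ X Y p)
  -- The kernel of the differential of the normal form has zero first and second components, so
  -- dφ(η) can be nonzero only in the third.
  rw [h.fderiv_twoRuled_nullField hI hp, hsing, zero_smul, map_zero, fderiv_crossCapInterval] at h1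
  have h2 := congrArg (fun u : R4 => u 0) h1
  have h3 := congrArg (fun u : R4 => u 1) h1
  simp at h2 h3
  have h4 := hφ.fderiv_eq_zero (Prod.ext h2.symm (Prod.ext h3.symm h0))
  exact one_ne_zero (congrArg Prod.fst h4)

/-- Differentiate, along η at a singular point, the relation that the pulled-back conormal kills X'.
There df(η) = 0, so dΦ is stationary, and X' changes by X'' = -X - aY + δZ, of which only δZ
survives. In the conormal itself r = 0, so the only varying coefficient that counts is -(3/2)sr,
which contributes s times the r-component of dφ(η). -/
theorem eventually_coeffDelta_mul_eq (h : IsPseudoNondegenerateFrontal I γ X Y)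
    (hI : IsOpen I) (hp : p.1 ∈ I) (hsing : identifier γ X Y p = 0)
    (hφ : IsLocalDiffeomorphAt 𝓘(ℝ, R3) 𝓘(ℝ, R3) ∞ φ p)
    (hΦ : IsLocalDiffeomorphAt 𝓘(ℝ, R4) 𝓘(ℝ, R4) ∞ Φ (twoRuled γ X Y p))
    (heq : ∀ᶠ x in 𝓝 p, Φ (twoRuled γ X Y x) = crossCapInterval (φ x)) :
    ∀ᶠ x in 𝓝 p, identifier γ X Y x = 0 →
      coeffDelta X Y x.1 * (fderiv ℝ Φ (twoRuled γ X Y x) (frameZ X Y x.1)) 3 =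
        3 / 2 * (φ x).2.1 * (fderiv ℝ φ x (nullField γ X Y x)).2.2 *
          (fderiv ℝ Φ (twoRuled γ X Y x) (deriv X x.1)) 2 := by
  have hfs := h.smoothNear_twoRuled hI hp
  have hxI : ∀ᶠ x : R3 in 𝓝 p, x.1 ∈ I := (continuous_fst.tendsto p).eventually (hI.mem_nhds hp)
  have hk : SmoothNear (fun x => (fderiv ℝ φ x (nullField γ X Y x)).2.2) p :=
    ((hφ.smoothNear.fderiv_apply (h.smoothNear_nullField hI hp)).clm_comp
      (ContinuousLinearMap.snd ℝ ℝ (ℝ × ℝ))).clm_comp (ContinuousLinearMap.snd ℝ ℝ ℝ)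
  have hk0 := hk.continuousAt.eventually_ne (h.fderiv_nullField_ne_zero hI hp hsing hφ hΦ heq)
  have hc := eventually_fderiv_comp_eq hfs hφ hΦ heq
  have hν := h.eventually_crossCapConormal_eq_zero hI hp hφ hΦ heq
  filter_upwards [hxI, hk0, hc, hν.eventually_nhds, hφ.smoothNear, hfs,
    hfs.continuousAt.eventually hΦ.smoothNear.fderiv] with x h1 h2 h3 h4 h5 h6 h7 hx
  set v := nullField γ X Y x with hv
  have hfv : fderiv ℝ (twoRuled γ X Y) x v = 0 := by
    rw [hv, h.fderiv_twoRuled_nullField hI h1, hx, zero_smul]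
  have h8 := h3 v
  rw [hfv, map_zero, fderiv_crossCapInterval] at h8
  have c1 := congrArg (fun u : R4 => u 1) h8
  have c2 := congrArg (fun u : R4 => u 2) h8
  simp [h2] at c1 c2
  have hl : Tendsto (fun σ : ℝ => x + σ • v) (𝓝 0) (𝓝 x) :=
    Continuous.tendsto' (by fun_prop) _ _ (by simp)
  have d1 : HasDerivAt (fun σ : ℝ => φ (x + σ • v)) (fderiv ℝ φ x v) 0 :=
    (h5.differentiableAt (by simp)).hasFDerivAt.hasLineDerivAt v
  have d2 : HasDerivAt (fun σ : ℝ => twoRuled γ X Y (x + σ • v)) 0 0 :=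
    hasDerivAt_zero_of_fderiv_eq_zero (h6.differentiableAt (by simp)) hfv
  -- The base point f(x + σv) is stationary to first order because v is in the kernel of df.
  have d3 : HasDerivAt (fun σ : ℝ => fderiv ℝ Φ (twoRuled γ X Y (x + σ • v))) 0 0 := by
    have g : HasFDerivAt (fderiv ℝ Φ) (fderiv ℝ (fderiv ℝ Φ) (twoRuled γ X Y x))
        (twoRuled γ X Y (x + (0 : ℝ) • v)) := by
      rw [zero_smul, add_zero]
      exact (h7.differentiableAt (by simp)).hasFDerivAt
    have := HasFDerivAt.comp_hasDerivAt (l := fderiv ℝ Φ)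
      (f := fun σ : ℝ => twoRuled γ X Y (x + σ • v)) (0 : ℝ) g d2
    rw [map_zero] at this
    exact this
  have d4 : HasDerivAt (fun σ : ℝ => deriv X (x + σ • v).1) (deriv (deriv X) x.1) 0 := by
    have g1 : HasDerivAt (fun σ : ℝ => x.1 + σ * 1) 1 0 := by
      simpa using (hasDerivAt_id (0 : ℝ)).const_add x.1
    have g2 : HasDerivAt (deriv X) (deriv (deriv X) x.1) (x.1 + (0 : ℝ) * 1) := by
      rw [zero_mul, add_zero]
      exact (h.smoothNear_fst hI h1).deriv.differentiableAt.hasDerivAt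
    have g3 := HasDerivAt.scomp (h := fun σ : ℝ => x.1 + σ * 1) (0 : ℝ) g2 g1
    rw [one_smul] at g3
    exact g3
  have d5 := d3.clm_apply d4
  simp only [zero_smul, add_zero, zero_apply, zero_add] at d5
  have d12 : HasDerivAt (fun σ : ℝ => (φ (x + σ • v)).2.1) (fderiv ℝ φ x v).2.1 0 := d1.snd.fst
  have d13 : HasDerivAt (fun σ : ℝ => (φ (x + σ • v)).2.2) (fderiv ℝ φ x v).2.2 0 := d1.snd.snd
  have d6 := ((hasDerivAt_coord d5 3).sub ((d13.pow 3).mul (hasDerivAt_coord d5 1))).sub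
    (((d12.const_mul (3 / 2)).mul d13).mul (hasDerivAt_coord d5 2))
  have d7 := d6.unique ((hasDerivAt_const (0 : ℝ) (0 : ℝ)).congr_of_eventuallyEq
    ((hl.eventually h4).mono fun σ hσ => hσ.2.2))
  have e1 := h4.self_of_nhds.1
  have e2 := h4.self_of_nhds.2.1
  rw [h.deriv_deriv_fst hI h1] at d7
  simp only [crossCapConormal, c2] at e1 e2
  simp [c2] at d7 e1 e2
  linear_combination d7 + e1 + coeffA X Y x.1 * e2

/-- In the source chart of the normal form the singular set is the plane `r = 0`. -/
theorem eventually_identifier_eq_zero (h : IsPseudoNondegenerateFrontal I γ X Y)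
    (hI : IsOpen I) (hp : p.1 ∈ I)
    (hΦ : IsLocalDiffeomorphAt 𝓘(ℝ, R4) 𝓘(ℝ, R4) ∞ Φ (twoRuled γ X Y p))
    (heq : ∀ᶠ x in 𝓝 p, Φ (twoRuled γ X Y x) = crossCapInterval (φ x)) {ψ : R3 → R3}
    (hψ : IsLocalDiffeomorphAt 𝓘(ℝ, R3) 𝓘(ℝ, R3) ∞ ψ 0) (hψ0 : ψ 0 = p)
    (hφψ : ∀ᶠ y in 𝓝 0, φ (ψ y) = y) :
    (∃ c : ℝ, fderiv ℝ ψ 0 (0, 0, 1) = c • nullField γ X Y p) ∧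
      ∀ᶠ y in 𝓝 0, y.2.2 = 0 → identifier γ X Y (ψ y) = 0 := by
  have hfs := h.smoothNear_twoRuled hI hp
  have hψt : Tendsto ψ (𝓝 0) (𝓝 p) := hψ0 ▸ hψ.smoothNear.continuousAt
  have hψI : ∀ᶠ y in 𝓝 0, (ψ y).1 ∈ I :=
    hψt.eventually ((continuous_fst.tendsto p).eventually (hI.mem_nhds hp))
  -- f ∘ ψ is a diffeomorphism after the normal form, whose r-derivative vanishes on r = 0.
  have key : ∀ᶠ y in 𝓝 (0 : R3), y.2.2 = 0 →
      fderiv ℝ (twoRuled γ X Y) (ψ y) (fderiv ℝ ψ y (0, 0, 1)) = 0 := by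
    obtain ⟨Ψ, hΨ, -, hΨl, -⟩ := hΦ.exists_inverse
    have hcc : Continuous crossCapInterval := continuous_iff_continuousAt.2 fun y =>
      (smoothNear_vec4 (ContDiff.smoothNear (by fun_prop) y) (ContDiff.smoothNear (by fun_prop) y)
        (ContDiff.smoothNear (by fun_prop) y)
        (ContDiff.smoothNear (by fun_prop) y)).continuousAt
    have hdc : ∀ y, DifferentiableAt ℝ crossCapInterval y := fun y =>
      (smoothNear_vec4 (ContDiff.smoothNear (by fun_prop) y) (ContDiff.smoothNear (by fun_prop) y)
        (ContDiff.smoothNear (by fun_prop) y)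
        (ContDiff.smoothNear (by fun_prop) y)).differentiableAt
    have hg0 : crossCapInterval 0 = Φ (twoRuled γ X Y p) := by
      rw [heq.self_of_nhds, ← hψ0, hφψ.self_of_nhds]
    have h1 : ∀ᶠ y in 𝓝 0, twoRuled γ X Y (ψ y) = Ψ (crossCapInterval y) := by
      filter_upwards [hψt.eventually heq, hφψ, (hfs.continuousAt.tendsto.comp hψt).eventually hΨl]
        with y e1 e2 e3
      rw [e2] at e1
      rw [← e1]
      exact e3.symm
    have h2 : Tendsto crossCapInterval (𝓝 0) (𝓝 (Φ (twoRuled γ X Y p))) := hg0 ▸ hcc.tendsto 0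
    filter_upwards [h1.eventually_nhds, h2.eventually hΨ.smoothNear, hψ.smoothNear, hψI] with
      y e1 e2 e3 e4 e5
    have f1 : HasFDerivAt (fun y => twoRuled γ X Y (ψ y))
        ((fderiv ℝ (twoRuled γ X Y) (ψ y)).comp (fderiv ℝ ψ y)) y :=
      HasFDerivAt.comp (g := twoRuled γ X Y) (f := ψ) y
        (h.smoothNear_twoRuled hI e4).differentiableAt.hasFDerivAt
        (e3.differentiableAt (by simp)).hasFDerivAt
    have f2 : HasFDerivAt (fun y => Ψ (crossCapInterval y))
        ((fderiv ℝ Ψ (crossCapInterval y)).comp (fderiv ℝ crossCapInterval y)) y :=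
      HasFDerivAt.comp (g := Ψ) (f := crossCapInterval) y
        (e2.differentiableAt (by simp)).hasFDerivAt (hdc y).hasFDerivAt
    have f3 := congrArg (fun L => L ((0, 0, 1) : R3)) (f1.unique (f2.congr_of_eventuallyEq e1))
    have f4 : fderiv ℝ crossCapInterval y (0, 0, 1) = 0 := by
      rw [fderiv_crossCapInterval]
      ext i
      fin_cases i <;> simp [e5]
    simp only [ContinuousLinearMap.comp_apply, f4, map_zero] at f3
    exact f3
  set w : R3 → R3 := fun y => fderiv ℝ ψ y (0, 0, 1) with hw
  have hcomb : ∀ {y : R3}, (ψ y).1 ∈ I → fderiv ℝ (twoRuled γ X Y) (ψ y) (w y) = 0 →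
      (w y).1 * coeffB1 γ X (ψ y).1 + (w y).2.1 = 0 ∧
      (w y).1 * coeffB2 γ Y (ψ y).1 + (w y).2.2 = 0 ∧ (w y).1 * identifier γ X Y (ψ y) = 0 :=
    fun {y} hy hz => by
      rw [h.fderiv_twoRuled hI hy] at hz
      have g1 := congrArg (fun u => ⟪u, X (ψ y).1⟫) hz
      have g2 := congrArg (fun u => ⟪u, Y (ψ y).1⟫) hz
      have g3 := congrArg (fun u => ⟪u, deriv X (ψ y).1⟫) hz
      simp only [h.inner_comb_fst hI hy, h.inner_comb_snd hI hy, h.inner_comb_deriv hI hy,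
        inner_zero_left] at g1 g2 g3
      exact ⟨g1, g2, g3⟩
  have hw0 : w 0 = (w 0).1 • nullField γ X Y p := by
    obtain ⟨g1, g2, -⟩ := hcomb hψI.self_of_nhds (key.self_of_nhds rfl)
    rw [hψ0] at g1 g2
    refine Prod.ext ?_ (Prod.ext ?_ ?_)
    · simp [nullField]
    · simp [nullField]; linarith
    · simp [nullField]; linarith
  refine ⟨⟨_, hw0⟩, ?_⟩
  -- Otherwise dψ(∂ᵣ) would be the zero multiple of η, against invertibility of dψ.
  have hw1 : (w 0).1 ≠ 0 := fun h0 => by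
    rw [h0, zero_smul] at hw0
    have := hψ.fderiv_eq_zero hw0
    exact one_ne_zero (congrArg (fun v : R3 => v.2.2) this)
  have hws : SmoothNear (fun y => (w y).1) 0 :=
    (hψ.smoothNear.fderiv_apply (contDiff_const.smoothNear 0)).clm_comp
      (ContinuousLinearMap.fst ℝ ℝ (ℝ × ℝ))
  filter_upwards [key, hψI, hws.continuousAt.eventually_ne hw1] with y k1 k2 k3 k4
  exact (mul_eq_zero.1 (hcomb k2 (k1 k4)).2.2).resolve_left k3

/-- Necessity of the conditions for a cuspidal cross cap `×` interval. -/
theorem necessary_of_aequivalent (h : IsPseudoNondegenerateFrontal I γ X Y) (hI : IsOpen I)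
    (hp : p.1 ∈ I) (hsing : identifier γ X Y p = 0)
    (hA : AEquivalent (twoRuled γ X Y) p crossCapInterval 0) :
    nullDerivIdentifier γ X Y p ≠ 0 ∧ coeffDelta X Y p.1 = 0 ∧
      deriv (coeffDelta X Y) p.1 ≠ 0 := by
  obtain ⟨φ, Φ, hφ, hφp, hΦ, -, heq⟩ := hA
  obtain ⟨ψ, hψ, hψ0, -, hφψ⟩ := hφ.exists_inverse
  rw [hφp] at hψ hψ0 hφψ
  have hfs := h.smoothNear_twoRuled hI hp
  obtain ⟨⟨c, hc⟩, hψs⟩ := h.eventually_identifier_eq_zero hI hp hΦ heq hψ hψ0 hφψ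
  have hψd : ∀ v : R3, HasDerivAt (fun σ : ℝ => ψ (σ • v)) (fderiv ℝ ψ 0 v) 0 := fun v => by
    have : HasDerivAt (fun σ : ℝ => ψ (0 + σ • v)) (fderiv ℝ ψ 0 v) 0 :=
      hψ.smoothNear.differentiableAt.hasFDerivAt.hasLineDerivAt v
    simpa only [zero_add] using this
  have hsm : ∀ v : R3, Tendsto (fun σ : ℝ => σ • v) (𝓝 0) (𝓝 0) := fun v =>
    Continuous.tendsto' (by fun_prop) _ _ (by simp)
  have hids := (h.smoothNear_identifier hI hp).differentiableAt.hasFDerivAt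
  -- the linear algebra of `dΦ` in the moving frame
  set N : R3 → R4 →L[ℝ] R4 := fun x => fderiv ℝ Φ (twoRuled γ X Y x) with hN
  have hNs : SmoothNear N p := hΦ.smoothNear.fderiv.comp hfs
  have hν := (h.eventually_crossCapConormal_eq_zero hI hp hφ hΦ heq).self_of_nhds
  simp only [crossCapConormal, hφp] at hν
  obtain ⟨hX3, hY3, hW3⟩ := hν
  replace hX3 : N p (X p.1) 3 = 0 := by simpa using hX3
  replace hY3 : N p (Y p.1) 3 = 0 := by simpa using hY3
  replace hW3 : N p (deriv X p.1) 3 = 0 := by simpa using hW3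
  have hchain := (eventually_fderiv_comp_eq hfs hφ hΦ heq).self_of_nhds
  have hX2 : N p (X p.1) 2 = 0 := by
    have := hchain (0, 1, 0)
    rw [h.fderiv_twoRuled_fst hI hp, fderiv_crossCapInterval, hφp] at this
    simp [hN, this]
  have hY2 : N p (Y p.1) 2 = 0 := by
    have := hchain (0, 0, 1)
    rw [h.fderiv_twoRuled_snd hI hp, fderiv_crossCapInterval, hφp] at this
    simp [hN, this]
  have hsurj : Function.Surjective (N p) :=
    LinearMap.surjective_of_injective (f := (N p : R4 →ₗ[ℝ] R4))
      ((injective_iff_map_eq_zero (N p)).2 fun v hv => hΦ.fderiv_eq_zero hv)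
  have hexp : ∀ u : R4, N p u 3 = ⟪u, frameZ X Y p.1⟫ * N p (frameZ X Y p.1) 3 ∧
      N p u 2 = ⟪u, deriv X p.1⟫ * N p (deriv X p.1) 2 +
        ⟪u, frameZ X Y p.1⟫ * N p (frameZ X Y p.1) 2 := fun u => by
    have := congrArg (N p) (h.eq_sum_frame hI hp u)
    rw [this]
    simp [hX3, hY3, hW3, hX2, hY2]
  -- Among the frame vectors only Z can contribute to the last component of the surjective map dΦ.
  -- Once that is settled, a preimage of the third basis vector has no Z-part, so its third
  -- component must come from X'.
  have hZ3 : N p (frameZ X Y p.1) 3 ≠ 0 := fun h0 => by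
    obtain ⟨u, hu⟩ := hsurj (EuclideanSpace.single 3 1)
    have := (hexp u).1
    rw [hu, h0] at this
    simp at this
  have hW2 : N p (deriv X p.1) 2 ≠ 0 := fun h0 => by
    obtain ⟨u, hu⟩ := hsurj (EuclideanSpace.single 2 1)
    obtain ⟨g1, g2⟩ := hexp u
    rw [hu] at g1 g2
    rw [h0] at g2
    simp [hZ3] at g1
    simp [g1] at g2
  have hk0 := h.fderiv_nullField_ne_zero hI hp hsing hφ hΦ heq
  have hrel := h.eventually_coeffDelta_mul_eq hI hp hsing hφ hΦ heq
  have hδ : coeffDelta X Y p.1 = 0 := by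
    have := hrel.self_of_nhds hsing
    rw [hφp] at this
    refine (mul_eq_zero.1 (this.trans ?_)).resolve_right hZ3
    simp
  refine ⟨fun h0 => ?_, hδ, fun h0 => ?_⟩
  -- λ ∘ ψ vanishes on the plane r = 0, so its differential is determined by the value on ∂ᵣ, and
  -- dψ(∂ᵣ) is a multiple of η. Were ηλ zero, dλ would vanish, whereas ∂ₛλ = 1.
  · have hd : ∀ v : R3, fderiv ℝ (identifier γ X Y) p (fderiv ℝ ψ 0 v) =
        v.2.2 * fderiv ℝ (identifier γ X Y) p (fderiv ℝ ψ 0 (0, 0, 1)) := fun v => by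
      have h1 : fderiv ℝ (identifier γ X Y) p (fderiv ℝ ψ 0 (v.1, v.2.1, 0)) = 0 := by
        have g : HasFDerivAt (identifier γ X Y) (fderiv ℝ (identifier γ X Y) p)
            (ψ ((0 : ℝ) • ((v.1, v.2.1, 0) : R3))) := by rw [zero_smul, hψ0]; exact hids
        have g1 := HasFDerivAt.comp_hasDerivAt (l := identifier γ X Y)
          (f := fun σ : ℝ => ψ (σ • ((v.1, v.2.1, 0) : R3))) (0 : ℝ) g (hψd (v.1, v.2.1, 0))
        refine g1.unique ((hasDerivAt_const (0 : ℝ) (0 : ℝ)).congr_of_eventuallyEq ?_)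
        filter_upwards [(hsm (v.1, v.2.1, 0)).eventually hψs] with σ hσ using hσ (by simp)
      have h2 : v = (v.1, v.2.1, 0) + v.2.2 • ((0, 0, 1) : R3) := by ext <;> simp
      conv_lhs => rw [h2]
      rw [map_add, map_add, h1, map_smul, map_smul, zero_add, smul_eq_mul]
    have h1 : fderiv ℝ (identifier γ X Y) p (fderiv ℝ ψ 0 (0, 0, 1)) = 0 := by
      rw [hc, map_smul]
      rw [nullDerivIdentifier] at h0
      rw [h0, smul_zero]
    have hsurj' : Function.Surjective (fderiv ℝ ψ 0) :=
      LinearMap.surjective_of_injective (f := (fderiv ℝ ψ 0 : R3 →ₗ[ℝ] R3))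
        ((injective_iff_map_eq_zero (fderiv ℝ ψ 0)).2 fun v hv => hψ.fderiv_eq_zero hv)
    obtain ⟨v, hv⟩ := hsurj' (0, 1, 0)
    have h2 := hd v
    rw [hv, h1, h.fderiv_identifier hI hp] at h2
    simp at h2
  -- The s-axis of the normal form lies in its singular set, and along it the second coordinate of φ
  -- is σ. If δ' were 0, the left side of the relation for δ would have zero derivative at σ = 0,
  -- while the right side has derivative 3/2 times two nonzero factors.
  · set x : ℝ → R3 := fun σ => ψ (σ • ((0, 1, 0) : R3)) with hx
    have hx0 : x 0 = p := by simp only [hx, zero_smul, hψ0]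
    have hxs : SmoothNear x 0 :=
      hψ.smoothNear.comp_of_eq (ContDiff.smoothNear (by fun_prop) 0) (by simp)
    have ht : SmoothNear (fun σ => (x σ).1) 0 :=
      hxs.clm_comp (ContinuousLinearMap.fst ℝ ℝ (ℝ × ℝ))
    have ht0 : (x 0).1 = p.1 := by rw [hx0]
    have hfst : SmoothNear (fun x : R3 => x.1) p := contDiff_fst.smoothNear p
    have hA1 : SmoothNear (fun x : R3 => N x (frameZ X Y x.1) 3) p :=
      (hNs.clm_apply ((h.smoothNear_frameZ hI hp).comp hfst)).coord 3
    have hB1 : SmoothNear (fun x : R3 => N x (deriv X x.1) 2) p :=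
      (hNs.clm_apply ((h.smoothNear_fst hI hp).deriv.comp hfst)).coord 2
    have hK1 : SmoothNear (fun x => (fderiv ℝ φ x (nullField γ X Y x)).2.2) p :=
      ((hφ.smoothNear.fderiv_apply (h.smoothNear_nullField hI hp)).clm_comp
        (ContinuousLinearMap.snd ℝ ℝ (ℝ × ℝ))).clm_comp (ContinuousLinearMap.snd ℝ ℝ ℝ)
    have dA := (hA1.comp_of_eq hxs hx0).differentiableAt.hasDerivAt
    have dB := (hB1.comp_of_eq hxs hx0).differentiableAt.hasDerivAt
    have dK := (hK1.comp_of_eq hxs hx0).differentiableAt.hasDerivAt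
    have dδ : HasDerivAt (fun σ => coeffDelta X Y (x σ).1) 0 0 := by
      have g : HasDerivAt (coeffDelta X Y) 0 (x 0).1 := by
        rw [ht0, ← h0]
        exact (h.smoothNear_coeffDelta hI hp).differentiableAt.hasDerivAt
      have g1 := HasDerivAt.scomp (h := fun σ => (x σ).1) (0 : ℝ) g ht.differentiableAt.hasDerivAt
      rw [smul_zero] at g1
      exact g1
    have hl := dδ.mul dA
    have hr := (((hasDerivAt_id (0 : ℝ)).const_mul (3 / 2)).mul dK).mul dB
    have hlr := hl.unique (hr.congr_of_eventuallyEq ?_)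
    · simp [hx0, hδ, hk0, hW2] at hlr
    · have hxt : Tendsto x (𝓝 0) (𝓝 p) := hx0 ▸ hxs.continuousAt
      filter_upwards [hxt.eventually hrel, (hsm (0, 1, 0)).eventually hψs,
        (hsm (0, 1, 0)).eventually hφψ] with σ g1 g2 g3
      have g4 := g1 (g2 (by simp))
      have g5 : (φ (x σ)).2.1 = σ := by simp only [hx, g3]; simp
      rw [g5] at g4
      exact g4

end IsPseudoNondegenerateFrontal

end Necessity
end TwoRuled
end

theorem mainTheorem3 (I : Set ℝ) (hI : IsOpen I) (γ X Y : ℝ → TwoRuled.R4)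
    (hf : TwoRuled.IsPseudoNondegenerateFrontal I γ X Y) (t s r : ℝ) (ht : t ∈ I) :
    (TwoRuled.IsSingularPoint (TwoRuled.twoRuled γ X Y) (t, s, r) ↔
      TwoRuled.coeffB3 γ X t + s + r * TwoRuled.coeffA X Y t = 0) ∧
    (TwoRuled.IsSingularPoint (TwoRuled.twoRuled γ X Y) (t, s, r) →
      (TwoRuled.nullDerivIdentifier γ X Y (t, s, r) ≠ 0 →
        (TwoRuled.IsCuspidalCrossCapInterval (TwoRuled.twoRuled γ X Y) (t, s, r) ↔
          TwoRuled.coeffDelta X Y t = 0 ∧ deriv (TwoRuled.coeffDelta X Y) t ≠ 0)) ∧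
      (TwoRuled.IsCuspidalCrossCapInterval (TwoRuled.twoRuled γ X Y) (t, s, r) →
        TwoRuled.nullDerivIdentifier γ X Y (t, s, r) ≠ 0)) := by
  have hiff := hf.isSingularPoint_iff hI (p := (t, s, r)) ht
  refine ⟨hiff, fun hsing => ⟨fun hη => ⟨fun hA => ?_, fun hδ => ?_⟩, fun hA => ?_⟩⟩
  · exact (hf.necessary_of_aequivalent hI ht (hiff.1 hsing) hA).2
  · exact hf.aequivalent_crossCapInterval hI ht (hiff.1 hsing) hη hδ.1 hδ.2
  · exact (hf.necessary_of_aequivalent hI ht (hiff.1 hsing) hA).1
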